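/- **Similarity structures.** A ball in a metric space $X$ is a set $\{y : d(x,y)\le r\}$ with $x\in X$, $r>0$. A finite similarity structure $\mathrm{Sim}_X$ on $X$ assigns to each pair of balls $B_1,B_2$ a finite set $\mathrm{Sim}_X(B_1,B_2)$ of surjective similarities $B_1\to B_2$ (maps with $d(hx,hy)=\lambda d(x,y)$ for some constant $\lambda>0$), containing the identities and closed under inverses, compositions, and restrictions $h\mapsto (h|_{B_3}:B_3\to h(B_3))$ to subballs $B_3\subseteq B_1$. Its FSS group $\Gamma(\mathrm{Sim}_X)$ is the group of homeomorphisms $h:X\to X$ such that each $x\in X$ lies in a ball $B$ for which $h(B)$ is a ball and $h|_B\in \mathrm{Sim}_X(B,h(B))$. Write $[B]$ for the class of a ball $B$ under the equivalence relation $A\sim B\iff \mathrm{Sim}_X(A,B)\ne\emptyset$. A linearly ordered ultrametric space is an ultrametric space with a linear order such that, if $B_1,B_2$ are disjoint balls and some point of $B_1$ is less than some point of $B_2$, then every point of $B_1$ is less than every point of $B_2$. On such a space, $\mathrm{Sim}_X$ is small if for all balls $B_1,B_2$ one has $|\mathrm{Sim}_X(B_1,B_2)|\le 1$ and every $h\in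 \mathrm{Sim}_X(B_1,B_2)$ is order-preserving. For $X$ moreover compact and $\mathrm{Sim}_X$ small, $\mathcal P_{\mathrm{Sim}_X}$ is the semigroup presentation with alphabet $\{[B] : B \text{ a ball in } X\}$ and relations $([B],[B_1][B_2]\cdots[B_n])$, for all balls $B$ that are not single points, where $B_1,\dots,B_n$ are the maximal proper subballs of $B$ listed in order. **Braided diagram groups.** A semigroup presentation $\mathcal P=\langle\Sigma\mid\mathcal R\rangle$ consists of a set $\Sigma$ and a set $\mathcal R\subseteq\Sigma^+\times\Sigma^+$ of pairs of nonempty words. It is tree-like if every $(w_1,w_2)\in\mathcal R$ has $|w_1|=1$, $|w_2|>1$, and $(a,w_1),(a,w_2)\in\mathcal R$ implies $w_1=w_2$. For nonempty words $u,v$, a braided $(u,v)$-diagram over $\mathcal P$ consists of a frame, finitely many transistors, and finitely many wires labelled by letters. Each wire runs from a top contact, on the top of the frame or the bottom of a transistor, to a bottom contact, on the bottom of the frame or the top of a transistor; no two wires share a contact. The words read from left to right on the top and the bottom of the frame are $u$ and $v$; for each transistor with top word $p$ and bottom word $q$, $(p,q)\in\mathcal R$ or $(q,p)\in\mathcal R$;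 and the transitive closure of "some wire runs from the bottom of $T'$ to the top of $T$" is a strict partial order on the transistors. Diagrams are equivalent if there are bijections of transistors and wires preserving labels, contacts and left-to-right orders. A dipole is a pair of transistors, $T_2$ above $T_1$, such that the wires at the bottom of $T_2$ are exactly the wires at the top of $T_1$, in the same order, and the top word of $T_2$ equals the bottom word of $T_1$; it is reduced by deleting $T_1$, $T_2$ and the wires between them and gluing the $i$-th wire on top of $T_2$ to the $i$-th wire on the bottom of $T_1$, for each $i$. The braided diagram group $D_b(\mathcal P,w)$ is the group of braided $(w,w)$-diagrams modulo equivalence and reduction and insertion of dipoles, under vertical concatenation. **Theorem.** (1) Let $X$ be a nonempty linearly ordered compact ultrametric space with a small similarity structure $\mathrm{Sim}_X$. Then $\mathcal P_{\mathrm{Sim}_X}$ is tree-like, and $$\Gamma(\mathrm{Sim}_X)\cong D_b(\mathcal P_{\mathrm{Sim}_X},[X]).$$ (2) Conversely, if $\mathcal P=\langle\Sigma\mid\mathcal R\rangle$ is a tree-like semigroup presentation and $x\in\Sigma$, then there are a nonempty linearly ordered compact ultrametric space $X_{\mathcal P}$ and a small similarity structure $\mathrm{Sim}_{X_{\mathcal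 P}}$ on it such that $$D_b(\mathcal P,x)\cong\Gamma(\mathrm{Sim}_{X_{\mathcal P}}).$$ -/

import Mathlib

/-- A semigroup presentation `⟨α ∣ rels⟩`: relations are ordered pairs of nonempty words. -/
structure SemigroupPresentation (α : Type*) where
  rels : Set (List α × List α)
  left_ne_nil : ∀ r ∈ rels, r.1 ≠ []
  right_ne_nil : ∀ r ∈ rels, r.2 ≠ []

/-- Tree-like presentations: every relation is `(a, w)` with a letter `a` and `|w| > 1`, and `a`
determines `w`. -/
structure SemigroupPresentation.IsTreeLike {α : Type*} (P : SemigroupPresentation α) : Prop where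
  length_left : ∀ r ∈ P.rels, r.1.length = 1
  length_right : ∀ r ∈ P.rels, 1 < r.2.length
  right_unique : ∀ (a : α) (w₁ w₂ : List α), ([a], w₁) ∈ P.rels → ([a], w₂) ∈ P.rels → w₁ = w₂

/-- Contacts, read from left to right, on one side of the frame (labelled by the word `w`) and on one
side of each transistor `t : T` (labelled by the word `a t`). -/
abbrev Port {α T : Type*} (w : List α) (a : T → List α) :=
  Fin w.length ⊕ (Σ t : T, Fin (a t).length)

/-- The letter at a contact. -/
def Port.letter {α T : Type*} {w : List α} {a : T → List α} : Port w a → α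
  | .inl i => w.get i
  | .inr ⟨t, k⟩ => (a t).get k

/-- The map of contacts induced by a label-preserving map of transistors. -/
def Port.map {α T T' : Type*} {w : List α} {a : T → List α} {a' : T' → List α} (f : T → T')
    (h : ∀ t, a' (f t) = a t) : Port w a → Port w a'
  | .inl i => .inl i
  | .inr ⟨t, k⟩ => .inr ⟨f t, Fin.cast (congrArg List.length (h t).symm) k⟩

/-- Braided `(u, v)`-diagrams over `P`. `T` is the finite set of transistors, with their top and bottom
labels. A wire has its top contact on the top of the frame or on the bottom of a transistor, and its bottom
contact on the bottom of the frame or on the top of a transistor; distinct wires have distinct contacts.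
So a wire is given by its top contact `o`, its bottom contact is `wire o`, and `wire` is a bijection
that preserves the labels. (For nonempty `u` there is at least one wire.) -/
structure BraidedDiagram {α : Type*} (P : SemigroupPresentation α) (u v : List α) where
  T : Type
  finite : Finite T
  top : T → List α
  bot : T → List α
  mem_rels : ∀ t, (top t, bot t) ∈ P.rels ∨ (bot t, top t) ∈ P.rels
  wire : Port u bot → Port v top
  bijective : Function.Bijective wire
  letter_wire : ∀ o, (wire o).letter = o.letter
  /-- The transitive closure of "a wire runs from the bottom of `s` to the top of `t`" is a strict
  partial order. -/
  acyclic : ∀ t, ¬ Relation.TransGen (fun s t => ∃ k l, wire (.inr ⟨s, k⟩) = .inr ⟨t, l⟩) t t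

namespace BraidedDiagram

variable {α : Type*} {P : SemigroupPresentation α} {u v w x : List α}

/-- A wire runs from the bottom of `s` to the top of `t`. -/
def Above (D : BraidedDiagram P u v) (s t : D.T) : Prop :=
  ∃ k l, D.wire (.inr ⟨s, k⟩) = .inr ⟨t, l⟩

/-- Equivalence of diagrams: a bijection of the transistors that preserves all labels, left to right
orders and wires. -/
def Equivalent (D E : BraidedDiagram P u v) : Prop :=
  ∃ (f : D.T ≃ E.T) (ht : ∀ t, E.top (f t) = D.top t) (hb : ∀ t, E.bot (f t) = D.bot t),
    ∀ o, E.wire (o.map f hb) = (D.wire o).map f ht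

/-- `E` is obtained from `D`, up to equivalence, by reducing a dipole consisting of the transistors
`s` (upper) and `t` (lower): the wires at the bottom of `s` are exactly the wires at the top of `t`, in the
same order, and the top label of `s` is the bottom label of `t`. The transistors of `E` are, via `f`,
those of `D` other than `s` and `t`. A wire of `E` is a wire of `D`, or consists of a wire of `D` ending
at the `k`-th contact on the top of `s` glued to the wire of `D` starting at the `k`-th contact on the bottom
of `t`. -/
def Reduces (D E : BraidedDiagram P u v) : Prop :=
  ∃ (s t : D.T) (hout : D.top s = D.bot t) (hin : D.bot s = D.top t)
    (f : E.T → D.T) (ht : ∀ r, D.top (f r) = E.top r) (hb : ∀ r, D.bot (f r) = E.bot r),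
    s ≠ t ∧
    (∀ k, D.wire (.inr ⟨s, k⟩) = .inr ⟨t, Fin.cast (congrArg List.length hin) k⟩) ∧
    Function.Injective f ∧ Set.range f = {s, t}ᶜ ∧
    ∀ o, D.wire (o.map f hb) = (E.wire o).map f ht ∨
      ∃ k, D.wire (o.map f hb) = .inr ⟨s, k⟩ ∧
        D.wire (.inr ⟨t, Fin.cast (congrArg List.length hout) k⟩) = (E.wire o).map f ht

/-- Equivalence modulo dipoles. -/
def dipoleSetoid (P : SemigroupPresentation α) (u v : List α) : Setoid (BraidedDiagram P u v) :=
  Relation.EqvGen.setoid (fun D E => Equivalent D E ∨ Reduces D E)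

/-- A bottom contact of the lower diagram, as a bottom contact of the concatenation. -/
def concatLower {S T : Type*} {a : S → List α} {b : T → List α} :
    Port w b → Port w (Sum.elim a b : S ⊕ T → List α)
  | .inl i => .inl i
  | .inr ⟨t, k⟩ => .inr ⟨.inr t, k⟩

/-- Where a wire of the concatenation arrives, given where its upper part arrives: the `i`-th contact on
the bottom of the upper frame is glued to the `i`-th contact on the top of the lower frame. -/
def concatUpper (D : BraidedDiagram P u v) (E : BraidedDiagram P v w) :
    Port v D.top → Port w (Sum.elim D.top E.top)
  | .inl i => concatLower (E.wire (.inl i))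
  | .inr ⟨t, k⟩ => .inr ⟨.inl t, k⟩

/-- The wires of the concatenation. -/
def concatWire (D : BraidedDiagram P u v) (E : BraidedDiagram P v w) :
    Port u (Sum.elim D.bot E.bot) → Port w (Sum.elim D.top E.top)
  | .inl i => concatUpper D E (D.wire (.inl i))
  | .inr ⟨.inl t, k⟩ => concatUpper D E (D.wire (.inr ⟨t, k⟩))
  | .inr ⟨.inr t, k⟩ => concatLower (E.wire (.inr ⟨t, k⟩))

theorem concatLower_injective {S T : Type*} {a : S → List α} {b : T → List α} :
    Function.Injective (concatLower (w := w) (a := a) (b := b)) := by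
  rintro (i | ⟨t, k⟩) (j | ⟨t', k'⟩) h <;> cases h <;> rfl

theorem concatUpper_injective (D : BraidedDiagram P u v) (E : BraidedDiagram P v w) :
    Function.Injective (concatUpper D E) := by
  rintro (i | ⟨t, k⟩) (j | ⟨t', k'⟩) h
  · have := E.bijective.1 (concatLower_injective h)
    exact congrArg _ (Sum.inl_injective this)
  · rcases hE : E.wire (.inl i) with a | ⟨a, b⟩ <;> rw [concatUpper, hE] at h <;> cases h
  · rcases hE : E.wire (.inl j) with a | ⟨a, b⟩ <;> rw [concatUpper, concatUpper, hE] at h <;> cases h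
  · cases h
    rfl

theorem concatUpper_ne_lower (D : BraidedDiagram P u v) (E : BraidedDiagram P v w)
    (p : Port v D.top) (t : E.T) (k) :
    concatUpper D E p ≠ concatLower (E.wire (.inr ⟨t, k⟩)) := by
  intro h
  rcases p with i | ⟨s, l⟩
  · have := E.bijective.1 (concatLower_injective h)
    simp at this
  · rcases hE : E.wire (.inr ⟨t, k⟩) with a | ⟨a, b⟩ <;> rw [concatUpper, hE] at h <;> cases h

theorem concatWire_bijective (D : BraidedDiagram P u v) (E : BraidedDiagram P v w) :
    Function.Bijective (concatWire D E) := by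
  constructor
  · rintro (i | ⟨t | t, k⟩) (j | ⟨t' | t', k'⟩) h
    · have := D.bijective.1 (concatUpper_injective D E h); cases this; rfl
    · have := D.bijective.1 (concatUpper_injective D E h); cases this
    · exact absurd h (concatUpper_ne_lower D E _ t' k')
    · have := D.bijective.1 (concatUpper_injective D E h); cases this
    · have := D.bijective.1 (concatUpper_injective D E h); cases this; rfl
    · exact absurd h (concatUpper_ne_lower D E _ t' k')
    · exact absurd h.symm (concatUpper_ne_lower D E _ t k)
    · exact absurd h.symm (concatUpper_ne_lower D E _ t k)
    · have := E.bijective.1 (concatLower_injective h); cases this; rfl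
  · have key : ∀ p, ∃ o, concatWire D E o = concatUpper D E p := by
      intro p
      obtain ⟨i | ⟨t, k⟩, rfl⟩ := D.bijective.2 p
      · exact ⟨.inl i, rfl⟩
      · exact ⟨.inr ⟨.inl t, k⟩, rfl⟩
    have key2 : ∀ p, ∃ o, concatWire D E o = concatLower p := by
      intro p
      obtain ⟨i | ⟨t, k⟩, rfl⟩ := E.bijective.2 p
      · exact key (.inl i)
      · exact ⟨.inr ⟨.inr t, k⟩, rfl⟩
    rintro (i | ⟨t | t, k⟩)
    · exact key2 (.inl i)
    · exact key (.inr ⟨t, k⟩)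
    · exact key2 (.inr ⟨t, k⟩)

theorem letter_concatLower {S T : Type*} {a : S → List α} {b : T → List α} (p : Port w b) :
    (concatLower (a := a) p).letter = p.letter := by
  rcases p with i | ⟨t, k⟩ <;> rfl

theorem letter_concatUpper (D : BraidedDiagram P u v) (E : BraidedDiagram P v w)
    (p : Port v D.top) : (concatUpper D E p).letter = p.letter := by
  rcases p with i | ⟨t, k⟩
  · exact (letter_concatLower _).trans (E.letter_wire _)
  · rfl

theorem concat_acyclic (D : BraidedDiagram P u v) (E : BraidedDiagram P v w) (t : D.T ⊕ E.T) :
    ¬ Relation.TransGen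
      (fun s t => ∃ k l, concatWire D E (.inr ⟨s, k⟩) = .inr ⟨t, l⟩) t t := by
  have hlow : ∀ (p : Port w E.top) (t : D.T ⊕ E.T) l,
      concatLower p = (.inr ⟨t, l⟩ : Port w (Sum.elim D.top E.top)) →
      ∃ t' l', t = .inr t' ∧ p = .inr ⟨t', l'⟩ := by
    rintro (i | ⟨t', k⟩) t l h
    · cases h
    · cases h
      exact ⟨t', k, rfl, rfl⟩
  have hL : ∀ (s : D.T) (t : D.T ⊕ E.T), Relation.TransGen
      (fun s t => ∃ k l, concatWire D E (.inr ⟨s, k⟩) = .inr ⟨t, l⟩) (.inl s) t →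
      ∀ t', t = .inl t' → Relation.TransGen D.Above s t' := by
    intro s t h
    have hstep : ∀ (s : D.T ⊕ E.T) (t' : D.T) k l,
        concatWire D E (.inr ⟨s, k⟩) = .inr ⟨.inl t', l⟩ → ∃ s', s = .inl s' ∧ D.Above s' t' := by
      rintro (s | s) t' k l h
      · refine ⟨s, rfl, k, l, ?_⟩
        simp only [concatWire] at h
        rcases hD : D.wire (.inr ⟨s, k⟩) with i | ⟨t, m⟩
        · rw [hD] at h
          obtain ⟨_, _, h', -⟩ := hlow _ _ _ h
          simp at h'
        · rw [hD] at h
          cases h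
          rfl
      · obtain ⟨_, _, h', -⟩ := hlow _ _ _ h
        simp at h'
    induction h with
    | single h =>
      rintro t' rfl
      obtain ⟨k, l, h⟩ := h
      obtain ⟨s', hs, h⟩ := hstep _ _ _ _ h
      cases hs
      exact .single h
    | tail _ h ih =>
      rintro t' rfl
      obtain ⟨k, l, h⟩ := h
      obtain ⟨s', hs, h⟩ := hstep _ _ _ _ h
      exact .tail (ih _ hs) h
  have hR : ∀ (s : E.T) (t : D.T ⊕ E.T), Relation.TransGen
      (fun s t => ∃ k l, concatWire D E (.inr ⟨s, k⟩) = .inr ⟨t, l⟩) (.inr s) t →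
      ∃ t', t = .inr t' ∧ Relation.TransGen E.Above s t' := by
    intro s t h
    induction h with
    | single h =>
      obtain ⟨k, l, h⟩ := h
      obtain ⟨t', l', rfl, h'⟩ := hlow _ _ _ h
      exact ⟨t', rfl, .single ⟨k, l', h'⟩⟩
    | tail _ h ih =>
      obtain ⟨t', rfl, ih⟩ := ih
      obtain ⟨k, l, h⟩ := h
      obtain ⟨t'', l', rfl, h'⟩ := hlow _ _ _ h
      exact ⟨t'', rfl, .tail ih ⟨k, l', h'⟩⟩
  intro h
  rcases t with t | t
  · exact D.acyclic t (hL t _ h t rfl)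
  · obtain ⟨t', h', h⟩ := hR t _ h
    cases h'
    exact E.acyclic t h

/-- Concatenation, with `D` on top of `E`. -/
def concat (D : BraidedDiagram P u v) (E : BraidedDiagram P v w) : BraidedDiagram P u w where
  T := D.T ⊕ E.T
  finite := by
    have := D.finite
    have := E.finite
    infer_instance
  top := Sum.elim D.top E.top
  bot := Sum.elim D.bot E.bot
  mem_rels := Sum.rec D.mem_rels E.mem_rels
  wire := concatWire D E
  bijective := concatWire_bijective D E
  letter_wire := by
    rintro (i | ⟨t | t, k⟩)
    · exact (letter_concatUpper D E _).trans (D.letter_wire _)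
    · exact (letter_concatUpper D E _).trans (D.letter_wire _)
    · exact (letter_concatLower _).trans (E.letter_wire _)
  acyclic := concat_acyclic D E


theorem map_concatLower {S T S' T' : Type*} {a : S → List α} {b : T → List α} {a' : S' → List α}
    {b' : T' → List α} (f : S → S') (g : T → T')
    (h : ∀ t, (Sum.elim a' b' (Sum.map f g t) : List α) = Sum.elim a b t)
    (h' : ∀ t, b' (g t) = b t) (p : Port w b) :
    (concatLower (a := a) p).map (Sum.map f g) h = concatLower (p.map g h') := by
  rcases p with i | ⟨t, k⟩ <;> rfl

theorem Port.map_id {T : Type*} {a : T → List α} (h : ∀ t, a (id t) = a t) (p : Port w a) :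
    p.map id h = p := by
  rcases p with i | ⟨t, k⟩ <;> rfl

theorem elim_map {S T S' T' : Type*} {a : S → List α} {b : T → List α} {a' : S' → List α}
    {b' : T' → List α} {f : S → S'} {g : T → T'} (hf : ∀ t, a' (f t) = a t)
    (hg : ∀ t, b' (g t) = b t) (t : S ⊕ T) :
    (Sum.elim a' b' (Sum.map f g t) : List α) = Sum.elim a b t := by
  rcases t with t | t
  · exact hf t
  · exact hg t

/-- The upper half of a concatenation may be mapped into another diagram. -/
theorem concatUpper_map {D D' : BraidedDiagram P u v} (E : BraidedDiagram P v w)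
    (f : D'.T → D.T) (ht : ∀ t, D.top (f t) = D'.top t) (p : Port v D'.top) :
    concatUpper D E (p.map f ht) =
      (concatUpper D' E p).map (Sum.map f id) (elim_map ht fun _ => rfl) := by
  rcases p with i | ⟨t, k⟩
  · exact ((map_concatLower f id _ (fun _ => rfl) _).trans
      (congrArg _ (Port.map_id (fun _ => rfl) _))).symm
  · rfl

theorem Equivalent.concat_left {D D' : BraidedDiagram P u v} (h : Equivalent D D')
    (E : BraidedDiagram P v w) : Equivalent (D.concat E) (D'.concat E) := by
  obtain ⟨f, ht, hb, h⟩ := h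
  refine ⟨Equiv.sumCongr f (Equiv.refl _), elim_map ht fun _ => rfl, elim_map hb fun _ => rfl, ?_⟩
  rintro (i | ⟨t | t, k⟩)
  · exact (congrArg _ (h (.inl i))).trans (concatUpper_map E f ht _)
  · exact (congrArg _ (h (.inr ⟨t, k⟩))).trans (concatUpper_map E f ht _)
  · exact ((map_concatLower (⇑f) id _ (fun _ => rfl) _).trans
      (congrArg _ (Port.map_id (fun _ => rfl) _))).symm

theorem Equivalent.concat_right (D : BraidedDiagram P u v) {E E' : BraidedDiagram P v w}
    (h : Equivalent E E') : Equivalent (D.concat E) (D.concat E') := by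
  obtain ⟨f, ht, hb, h⟩ := h
  have hup : ∀ p, concatUpper D E' p = (concatUpper D E p).map
      (Sum.map id f) (elim_map (fun _ => rfl) ht) := by
    rintro (i | ⟨t, k⟩)
    · exact (congrArg concatLower (h (.inl i))).trans (map_concatLower id (⇑f) _ ht _).symm
    · rfl
  refine ⟨Equiv.sumCongr (Equiv.refl _) f, elim_map (fun _ => rfl) ht, elim_map (fun _ => rfl) hb, ?_⟩
  rintro (i | ⟨t | t, k⟩)
  · exact hup _
  · exact hup _
  · exact (congrArg concatLower (h (.inr ⟨t, k⟩))).trans (map_concatLower id (⇑f) _ ht _).symm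

theorem range_map_id {S T S' : Type*} (f : S' → S) {s t : S} (h : Set.range f = {s, t}ᶜ) :
    Set.range (Sum.map f (id : T → T)) = {.inl s, .inl t}ᶜ := by
  ext (r | r)
  · simpa using Set.ext_iff.1 h r
  · simp

theorem range_id_map {S T S' : Type*} (f : S' → S) {s t : S} (h : Set.range f = {s, t}ᶜ) :
    Set.range (Sum.map (id : T → T) f) = {.inr s, .inr t}ᶜ := by
  ext (r | r)
  · simp
  · simpa using Set.ext_iff.1 h r

theorem Reduces.concat_left {D D' : BraidedDiagram P u v} (h : Reduces D D')
    (E : BraidedDiagram P v w) : Reduces (D.concat E) (D'.concat E) := by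
  obtain ⟨s, t, hout, hin, f, ht, hb, hst, hwire, hf, hrange, h⟩ := h
  refine ⟨.inl s, .inl t, hout, hin, Sum.map f id, elim_map ht fun _ => rfl, elim_map hb fun _ => rfl,
    fun h => hst (Sum.inl_injective h), ?_, hf.sumMap Function.injective_id,
    range_map_id f hrange, ?_⟩
  · intro k
    exact congrArg (concatUpper D E) (hwire k)
  · have key : ∀ (o : Port u D'.bot),
        (concatUpper D E (D.wire (o.map f hb)) = concatUpper D E ((D'.wire o).map f ht)) ∨
        ∃ k, concatUpper D E (D.wire (o.map f hb)) = .inr ⟨.inl s, k⟩ ∧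
        concatUpper D E (D.wire (.inr ⟨t, Fin.cast (congrArg List.length hout) k⟩)) =
          concatUpper D E ((D'.wire o).map f ht) := by
      intro o
      rcases h o with h | ⟨k, h1, h2⟩
      · exact .inl (congrArg _ h)
      · exact .inr ⟨k, congrArg (concatUpper D E) h1, congrArg _ h2⟩
    simp only [concatUpper_map] at key
    rintro (i | ⟨r | r, k⟩)
    · exact key (.inl i)
    · exact key (.inr ⟨r, k⟩)
    · exact .inl ((map_concatLower f id _ (fun _ => rfl) _).trans
        (congrArg _ (Port.map_id (fun _ => rfl) _))).symm

theorem Reduces.concat_right (D : BraidedDiagram P u v) {E E' : BraidedDiagram P v w}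
    (h : Reduces E E') : Reduces (D.concat E) (D.concat E') := by
  obtain ⟨s, t, hout, hin, f, ht, hb, hst, hwire, hf, hrange, h⟩ := h
  have key : ∀ (o : Port v E'.bot),
      (concatLower (E.wire (o.map f hb)) = (concatLower (a := D.top) (E'.wire o)).map (Sum.map id f)
        (elim_map (fun _ => rfl) ht)) ∨
      ∃ k, concatLower (a := D.top) (E.wire (o.map f hb)) = .inr ⟨.inr s, k⟩ ∧
      concatLower (E.wire (.inr ⟨t, Fin.cast (congrArg List.length hout) k⟩)) =
        (concatLower (a := D.top) (E'.wire o)).map (Sum.map id f)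
        (elim_map (fun _ => rfl) ht) := by
    intro o
    rw [map_concatLower id f _ ht]
    rcases h o with h | ⟨k, h1, h2⟩
    · exact .inl (congrArg _ h)
    · exact .inr ⟨k, congrArg concatLower h1, congrArg _ h2⟩
  have key2 : ∀ (p : Port v D.top),
      (concatUpper D E p = (concatUpper D E' p).map (Sum.map id f)
        (elim_map (fun _ => rfl) ht)) ∨
      ∃ k, concatUpper D E p = .inr ⟨.inr s, k⟩ ∧
      concatLower (E.wire (.inr ⟨t, Fin.cast (congrArg List.length hout) k⟩)) =
        (concatUpper D E' p).map (Sum.map id f)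
        (elim_map (fun _ => rfl) ht) := by
    rintro (i | ⟨r, k⟩)
    · exact key (.inl i)
    · exact .inl rfl
  refine ⟨.inr s, .inr t, hout, hin, Sum.map id f, elim_map (fun _ => rfl) ht,
    elim_map (fun _ => rfl) hb,
    fun h => hst (Sum.inr_injective h), ?_, Function.injective_id.sumMap hf,
    range_id_map f hrange, ?_⟩
  · intro k
    exact congrArg concatLower (hwire k)
  · rintro (i | ⟨r | r, k⟩)
    · exact key2 _
    · exact key2 _
    · exact key (.inr ⟨r, k⟩)

/-- The diagram without transistors whose wires run straight from top to bottom. -/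
def idDiagram (P : SemigroupPresentation α) (u : List α) : BraidedDiagram P u u where
  T := Empty
  finite := inferInstance
  top := Empty.elim
  bot := Empty.elim
  mem_rels := fun t => t.elim
  wire := Sum.map id fun t => t.1.elim
  bijective := by
    constructor
    · rintro (i | ⟨⟨⟩, k⟩) (j | ⟨⟨⟩, k⟩) h
      exact h
    · rintro (i | ⟨⟨⟩, k⟩)
      exact ⟨.inl i, rfl⟩
  letter_wire := by
    rintro (i | ⟨⟨⟩, k⟩)
    rfl
  acyclic := fun t => t.elim

/-- The top contact of the wire with a given bottom contact. -/
noncomputable def invWire (D : BraidedDiagram P u v) : Port v D.top → Port u D.bot :=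
  (Equiv.ofBijective D.wire D.bijective).symm

/-- Reflection in a horizontal line. -/
noncomputable def inv (D : BraidedDiagram P u v) : BraidedDiagram P v u where
  T := D.T
  finite := D.finite
  top := D.bot
  bot := D.top
  mem_rels := fun t => (D.mem_rels t).symm
  wire := D.invWire
  bijective := Equiv.bijective _
  letter_wire := by
    intro o
    rw [← D.letter_wire]
    exact congrArg _ ((Equiv.ofBijective D.wire D.bijective).apply_symm_apply o)
  acyclic := by
    intro t h
    refine D.acyclic t (Relation.transGen_swap.1 (Relation.TransGen.mono ?_ _ _ h))
    rintro s t ⟨k, l, h⟩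
    exact ⟨l, k, (((Equiv.ofBijective D.wire D.bijective).symm_apply_eq).1 h).symm⟩

theorem id_concat (D : BraidedDiagram P u v) : Equivalent ((idDiagram P u).concat D) D := by
  refine ⟨Equiv.emptySum Empty D.T, ?_, ?_, ?_⟩
  · rintro (⟨⟨⟩⟩ | t)
    rfl
  · rintro (⟨⟨⟩⟩ | t)
    rfl
  · have key : ∀ (h) (p : Port v D.top), p = (concatLower (a := (idDiagram P u).top) p).map
        (Equiv.emptySum Empty D.T) h := by
      rintro h (i | ⟨t, k⟩) <;> rfl
    rintro (i | ⟨⟨⟨⟩⟩ | t, k⟩)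
    · exact key _ _
    · exact key _ _

theorem concat_id (D : BraidedDiagram P u v) : Equivalent (D.concat (idDiagram P v)) D := by
  refine ⟨Equiv.sumEmpty D.T Empty, ?_, ?_, ?_⟩
  · rintro (t | ⟨⟨⟩⟩)
    rfl
  · rintro (t | ⟨⟨⟩⟩)
    rfl
  · have key : ∀ (h) (p : Port v D.top), p = (concatUpper D (idDiagram P v) p).map
        (Equiv.sumEmpty D.T Empty) h := by
      rintro h (i | ⟨t, k⟩) <;> rfl
    rintro (i | ⟨t | ⟨⟨⟩⟩, k⟩)
    · exact key _ _
    · exact key _ _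

theorem concat_assoc (D : BraidedDiagram P u v) (E : BraidedDiagram P v w)
    (F : BraidedDiagram P w x) : Equivalent ((D.concat E).concat F) (D.concat (E.concat F)) := by
  have htop : ∀ t, (D.concat (E.concat F)).top (Equiv.sumAssoc D.T E.T F.T t) =
      ((D.concat E).concat F).top t := by
    rintro ((t | t) | t) <;> rfl
  have h3 : ∀ p : Port x F.top, concatLower (a := D.top) (concatLower (a := E.top) p) =
      (concatLower (a := (D.concat E).top) p).map (Equiv.sumAssoc D.T E.T F.T) htop := by
    rintro (i | ⟨t, k⟩) <;> rfl
  have h2 : ∀ p : Port w E.top, concatLower (a := D.top) (concatUpper E F p) =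
      (concatUpper (D.concat E) F (concatLower p)).map (Equiv.sumAssoc D.T E.T F.T) htop := by
    rintro (i | ⟨t, k⟩)
    · exact h3 _
    · rfl
  have h1 : ∀ p : Port v D.top, concatUpper D (E.concat F) p =
      (concatUpper (D.concat E) F (concatUpper D E p)).map (Equiv.sumAssoc D.T E.T F.T) htop := by
    rintro (i | ⟨t, k⟩)
    · exact h2 _
    · rfl
  refine ⟨Equiv.sumAssoc D.T E.T F.T, htop, ?_, ?_⟩
  · rintro ((t | t) | t) <;> rfl
  · rintro (i | ⟨(t | t) | t, k⟩)
    · exact h1 _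
    · exact h1 _
    · exact h2 _
    · exact h3 _


theorem invWire_eq (D : BraidedDiagram P u v) {o : Port u D.bot} {p : Port v D.top}
    (h : D.wire o = p) : D.invWire p = o :=
  (Equiv.ofBijective D.wire D.bijective).symm_apply_eq.2 h.symm

theorem wire_invWire (D : BraidedDiagram P u v) (p : Port v D.top) : D.wire (D.invWire p) = p :=
  (Equiv.ofBijective D.wire D.bijective).apply_symm_apply p

theorem Equivalent.inv {D E : BraidedDiagram P u v} (h : Equivalent D E) :
    Equivalent D.inv E.inv := by
  obtain ⟨f, ht, hb, h⟩ := h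
  refine ⟨f, hb, ht, fun p => invWire_eq E ?_⟩
  exact (h (D.invWire p)).trans (congrArg (Port.map _ ht) (wire_invWire D p))

theorem Reduces.inv {D E : BraidedDiagram P u v} (h : Reduces D E) : Reduces D.inv E.inv := by
  obtain ⟨s, t, hout, hin, f, ht, hb, hst, hwire, hf, hrange, h⟩ := h
  refine ⟨t, s, hout.symm, hin.symm, f, hb, ht, hst.symm, fun k => invWire_eq D ?_, hf, ?_, ?_⟩
  · exact hwire _
  · exact hrange.trans (congrArg _ (Set.pair_comm s t))
  · intro p
    have hp := congrArg (Port.map f ht) (wire_invWire E p)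
    rcases h (E.invWire p) with h | ⟨k, h1, h2⟩
    · exact .inl (invWire_eq D (h.trans hp))
    · exact .inr ⟨_, invWire_eq D (h2.trans hp), invWire_eq D h1⟩

section Double

variable (D : BraidedDiagram P u v) (S : Set D.T)

/-- Top contacts of the wires in the upper part of a diagram. -/
abbrev upIncl (o : Port u (fun t : S => D.bot t)) : Port u D.bot :=
  o.map Subtype.val fun _ => rfl

/-- Bottom contacts at the transistors in the upper part of a diagram. -/
abbrev upIn (q : Σ t : S, Fin (D.top t).length) : Port v D.top := .inr ⟨q.1.1, q.2⟩

/-- A part of a diagram that contains with a transistor everything above it. -/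
def UpClosed : Prop := ∀ s t, D.Above s t → t ∈ S → s ∈ S

variable {D S}

theorem upIncl_injective : Function.Injective (upIncl D S) := by
  rintro (i | ⟨⟨t, ht⟩, k⟩) (j | ⟨⟨t', ht'⟩, k'⟩) h
  · cases h; rfl
  · cases h
  · cases h
  · obtain rfl : t = t' := congrArg Sigma.fst (Sum.inr_injective h)
    have := eq_of_heq (Sigma.mk.inj (Sum.inr_injective h)).2
    cases k; cases k'
    cases this
    rfl

theorem upIn_injective : Function.Injective (upIn D S) := by
  rintro ⟨⟨t, ht⟩, k⟩ ⟨⟨t', ht'⟩, k'⟩ h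
  cases h
  rfl

theorem UpClosed.exists_pred (hS : UpClosed D S) (q) : ∃ o, D.wire (upIncl D S o) = upIn D S q := by
  obtain ⟨i | ⟨s, k⟩, h⟩ := D.bijective.2 (upIn D S q)
  · exact ⟨.inl i, h⟩
  · exact ⟨.inr ⟨⟨s, hS s q.1 ⟨k, q.2, h⟩ q.1.2⟩, k⟩, h⟩

variable (D S)

open Classical in
/-- Wires of the double that start in its upper half. -/
noncomputable def doubleUp (o : Port u (fun t : S => D.bot t)) :
    Port u (Sum.elim (fun t : S => D.top t) (fun t : S => D.bot t)) :=
  if h : ∃ q, D.wire (upIncl D S o) = upIn D S q then .inr ⟨.inl h.choose.1, h.choose.2⟩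
  else concatLower o

/-- Wires of the double of the upper part `S` of `D`: the part `S`, glued to its mirror image. -/
noncomputable def doubleWire (hS : UpClosed D S) :
    Port u (Sum.elim (fun t : S => D.bot t) (fun t : S => D.top t)) →
    Port u (Sum.elim (fun t : S => D.top t) (fun t : S => D.bot t))
  | .inl i => doubleUp D S (.inl i)
  | .inr ⟨.inl t, k⟩ => doubleUp D S (.inr ⟨t, k⟩)
  | .inr ⟨.inr t, k⟩ => concatLower (hS.exists_pred ⟨t, k⟩).choose

variable {D S}

theorem doubleUp_pos {o q} (h : D.wire (upIncl D S o) = upIn D S q) :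
    doubleUp D S o = .inr ⟨.inl q.1, q.2⟩ := by
  have h' : ∃ q, D.wire (upIncl D S o) = upIn D S q := ⟨q, h⟩
  have : h'.choose = q := upIn_injective (h'.choose_spec.symm.trans h)
  rw [doubleUp, dif_pos h', this]

theorem doubleUp_neg {o} (h : ∀ q, D.wire (upIncl D S o) ≠ upIn D S q) :
    doubleUp D S o = concatLower o := by
  rw [doubleUp, dif_neg]
  rintro ⟨q, h'⟩
  exact h q h'

theorem doubleWire_lower (hS : UpClosed D S) {t : S} {k o}
    (h : D.wire (upIncl D S o) = upIn D S ⟨t, k⟩) :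
    doubleWire D S hS (.inr ⟨.inr t, k⟩) = concatLower o := by
  have : (hS.exists_pred ⟨t, k⟩).choose = o :=
    upIncl_injective (D.bijective.1 ((hS.exists_pred ⟨t, k⟩).choose_spec.trans h.symm))
  exact congrArg concatLower this

theorem doubleUp_cases (o) :
    (∃ q, D.wire (upIncl D S o) = upIn D S q ∧ doubleUp D S o = .inr ⟨.inl q.1, q.2⟩) ∨
    ((∀ q, D.wire (upIncl D S o) ≠ upIn D S q) ∧ doubleUp D S o = concatLower o) := by
  by_cases h : ∃ q, D.wire (upIncl D S o) = upIn D S q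
  · obtain ⟨q, h⟩ := h
    exact .inl ⟨q, h, doubleUp_pos h⟩
  · push Not at h
    exact .inr ⟨h, doubleUp_neg h⟩

theorem doubleWire_lower_cases (hS : UpClosed D S) (t : S) (k) :
    ∃ o, D.wire (upIncl D S o) = upIn D S ⟨t, k⟩ ∧
      doubleWire D S hS (.inr ⟨.inr t, k⟩) = concatLower o := by
  obtain ⟨o, h⟩ := hS.exists_pred ⟨t, k⟩
  exact ⟨o, h, doubleWire_lower hS h⟩

theorem concatLower_ne {S T : Type*} {a : S → List α} {b : T → List α} (p : Port w b) (t : S) (k) :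
    concatLower (a := a) p ≠ .inr ⟨.inl t, k⟩ := by
  rintro h
  rcases p with i | ⟨s, l⟩ <;> cases h

theorem doubleUp_injective : Function.Injective (doubleUp D S) := by
  intro o o' h
  rcases doubleUp_cases o with ⟨q, h1, h2⟩ | ⟨h1, h2⟩ <;>
    rcases doubleUp_cases o' with ⟨q', h1', h2'⟩ | ⟨h1', h2'⟩ <;> rw [h2, h2'] at h
  · cases q; cases q'; cases h
    exact upIncl_injective (D.bijective.1 (h1.trans h1'.symm))
  · exact absurd h.symm (concatLower_ne _ _ _)
  · exact absurd h (concatLower_ne _ _ _)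
  · exact concatLower_injective h

theorem doubleUp_ne_lower (hS : UpClosed D S) (o) (t : S) (k) :
    doubleUp D S o ≠ doubleWire D S hS (.inr ⟨.inr t, k⟩) := by
  intro h
  obtain ⟨o', h', h''⟩ := doubleWire_lower_cases hS t k
  rw [h''] at h
  rcases doubleUp_cases o with ⟨q, h1, h2⟩ | ⟨h1, h2⟩ <;> rw [h2] at h
  · exact absurd h.symm (concatLower_ne _ _ _)
  · cases concatLower_injective h
    exact h1 _ h'

theorem doubleWire_bijective (hS : UpClosed D S) : Function.Bijective (doubleWire D S hS) := by
  constructor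
  · rintro (i | ⟨t | t, k⟩) (j | ⟨t' | t', k'⟩) h
    · cases doubleUp_injective h; rfl
    · cases doubleUp_injective h
    · exact absurd h (doubleUp_ne_lower hS _ t' k')
    · cases doubleUp_injective h
    · cases doubleUp_injective h; rfl
    · exact absurd h (doubleUp_ne_lower hS _ t' k')
    · exact absurd h.symm (doubleUp_ne_lower hS _ t k)
    · exact absurd h.symm (doubleUp_ne_lower hS _ t k)
    · obtain ⟨o, h1, h2⟩ := doubleWire_lower_cases hS t k
      obtain ⟨o', h1', h2'⟩ := doubleWire_lower_cases hS t' k'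
      rw [h2, h2'] at h
      cases concatLower_injective h
      cases upIn_injective (h1.symm.trans h1')
      rfl
  · have key : ∀ o, ∃ o', doubleWire D S hS o' = doubleUp D S o := by
      rintro (i | ⟨t, k⟩)
      · exact ⟨.inl i, rfl⟩
      · exact ⟨.inr ⟨.inl t, k⟩, rfl⟩
    have key2 : ∀ o, ∃ o', doubleWire D S hS o' = concatLower o := by
      intro o
      rcases doubleUp_cases o with ⟨q, h1, h2⟩ | ⟨h1, h2⟩
      · exact ⟨.inr ⟨.inr q.1, q.2⟩, doubleWire_lower hS h1⟩
      · rw [← h2]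
        exact key o
    rintro (i | ⟨t | t, k⟩)
    · exact key2 (.inl i)
    · obtain ⟨o, h⟩ := hS.exists_pred ⟨t, k⟩
      obtain ⟨o', h'⟩ := key o
      exact ⟨o', h'.trans (doubleUp_pos h)⟩
    · exact key2 (.inr ⟨t, k⟩)

theorem letter_upIncl (o) : (upIncl D S o).letter = o.letter := by
  rcases o with i | ⟨t, k⟩ <;> rfl

theorem doubleWire_letter (hS : UpClosed D S) (o) : (doubleWire D S hS o).letter = o.letter := by
  have key : ∀ o, (doubleUp D S o).letter = o.letter := by
    intro o
    rcases doubleUp_cases o with ⟨q, h1, h2⟩ | ⟨h1, h2⟩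
    · rw [h2, ← letter_upIncl, ← D.letter_wire, h1]
      rfl
    · rw [h2, letter_concatLower]
  rcases o with i | ⟨t | t, k⟩
  · exact key _
  · exact key _
  · obtain ⟨o, h1, h2⟩ := doubleWire_lower_cases hS t k
    rw [h2, letter_concatLower, ← letter_upIncl, ← D.letter_wire, h1]
    rfl

theorem doubleWire_acyclic (hS : UpClosed D S) (t : S ⊕ S) :
    ¬ Relation.TransGen
      (fun s t => ∃ k l, doubleWire D S hS (.inr ⟨s, k⟩) = .inr ⟨t, l⟩) t t := by
  set R : S ⊕ S → S ⊕ S → Prop :=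
    fun s t => ∃ k l, doubleWire D S hS (.inr ⟨s, k⟩) = .inr ⟨t, l⟩ with hR
  have step1 : ∀ s t, R s (.inl t) → ∃ s', s = .inl s' ∧ D.Above s' t := by
    rintro (s | s) t ⟨k, l, h⟩
    · refine ⟨s, rfl, k, l, ?_⟩
      change doubleUp D S _ = _ at h
      rcases doubleUp_cases (D := D) (S := S) (.inr ⟨s, k⟩) with ⟨q, h1, h2⟩ | ⟨h1, h2⟩
      · rw [h2] at h
        cases q; cases h
        exact h1
      · rw [h2] at h
        exact absurd h (concatLower_ne _ _ _)
    · obtain ⟨o, h1, h2⟩ := doubleWire_lower_cases hS s k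
      rw [h2] at h
      exact absurd h (concatLower_ne _ _ _)
  have step2 : ∀ s t, R (.inr s) t → ∃ t', t = .inr t' ∧ D.Above t' s := by
    rintro s (t | t) ⟨k, l, h⟩ <;> obtain ⟨o, h1, h2⟩ := doubleWire_lower_cases hS s k <;>
      rw [h2] at h
    · exact absurd h (concatLower_ne _ _ _)
    · rcases o with i | ⟨t', l'⟩
      · cases h
      · cases h
        exact ⟨_, rfl, _, _, h1⟩
  have h1 : ∀ s t, Relation.TransGen R s t → ∀ t', t = .inl t' →
      ∃ s', s = .inl s' ∧ Relation.TransGen D.Above s' t' := by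
    intro s t h
    induction h using Relation.TransGen.head_induction_on with
    | single h =>
      rintro t' rfl
      obtain ⟨s', rfl, h'⟩ := step1 _ _ h
      exact ⟨s', rfl, .single h'⟩
    | head h _ ih =>
      rintro t' rfl
      obtain ⟨s', rfl, ih'⟩ := ih t' rfl
      obtain ⟨s'', rfl, h'⟩ := step1 _ _ h
      exact ⟨s'', rfl, .head h' ih'⟩
  have h2 : ∀ s t, Relation.TransGen R s t → ∀ s', s = .inr s' →
      ∃ t', t = .inr t' ∧ Relation.TransGen D.Above t' s' := by
    intro s t h
    induction h with
    | single h =>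
      rintro s' rfl
      obtain ⟨t', rfl, h'⟩ := step2 _ _ h
      exact ⟨t', rfl, .single h'⟩
    | tail _ h ih =>
      rintro s' rfl
      obtain ⟨t', rfl, ih'⟩ := ih s' rfl
      obtain ⟨t'', rfl, h'⟩ := step2 _ _ h
      exact ⟨t'', rfl, .head h' ih'⟩
  intro h
  rcases t with t | t
  · obtain ⟨t', h', h⟩ := h1 _ _ h t rfl
    cases h'
    exact D.acyclic t h
  · obtain ⟨t', h', h⟩ := h2 _ _ h t rfl
    cases h'
    exact D.acyclic t h

/-- The upper part `S` of `D` glued to its mirror image. -/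
noncomputable def double (hS : UpClosed D S) : BraidedDiagram P u u where
  T := S ⊕ S
  finite := by
    have := D.finite
    infer_instance
  top := Sum.elim (fun t => D.top t) (fun t => D.bot t)
  bot := Sum.elim (fun t => D.bot t) (fun t => D.top t)
  mem_rels := Sum.rec (fun t => D.mem_rels t) (fun t => (D.mem_rels t).symm)
  wire := doubleWire D S hS
  bijective := doubleWire_bijective hS
  letter_wire := doubleWire_letter hS
  acyclic := doubleWire_acyclic hS

theorem double_empty (h : UpClosed D ∅) : Equivalent (double h) (idDiagram P u) := by
  have : IsEmpty ((∅ : Set D.T) ⊕ (∅ : Set D.T)) := inferInstance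
  refine ⟨Equiv.equivOfIsEmpty ((∅ : Set D.T) ⊕ (∅ : Set D.T)) Empty, fun t => this.elim t,
    fun t => this.elim t, ?_⟩
  rintro (i | ⟨t, k⟩)
  · have h' : (double h).wire (.inl i) = .inl i := doubleUp_neg (D := D) (S := ∅) (o := .inl i)
      fun q => q.1.2.elim
    rw [h']
    rfl
  · exact (this.false t).elim

theorem double_univ (h : UpClosed D Set.univ) : Equivalent (D.concat D.inv) (double h) := by
  let e : D.T ≃ (Set.univ : Set D.T) := (Equiv.Set.univ _).symm
  have ht : ∀ t, (double h).top (Equiv.sumCongr e e t) = (D.concat D.inv).top t := by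
    rintro (t | t) <;> rfl
  have hb : ∀ t, (double h).bot (Equiv.sumCongr e e t) = (D.concat D.inv).bot t := by
    rintro (t | t) <;> rfl
  have hlow : ∀ (p : Port u D.bot), concatLower (p.map e fun _ => rfl) =
      (concatLower (a := D.top) p).map (Equiv.sumCongr e e) ht := by
    rintro (i | ⟨t, k⟩) <;> rfl
  have hincl : ∀ (p : Port u D.bot), upIncl D Set.univ (p.map e fun _ => rfl) = p := by
    rintro (i | ⟨t, k⟩) <;> rfl
  have hup : ∀ (o : Port u D.bot), doubleUp D Set.univ (o.map e fun _ => rfl) =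
      (concatUpper D D.inv (D.wire o)).map (Equiv.sumCongr e e) ht := by
    intro o
    rcases hD : D.wire o with i | ⟨t, k⟩
    · rw [doubleUp_neg, hlow]
      · exact congrArg (fun p => Port.map _ ht (concatLower p)) (invWire_eq D hD).symm
      · intro q hq
        rw [hincl, hD] at hq
        cases hq
    · rw [doubleUp_pos (q := ⟨e t, k⟩)]
      · rfl
      · rw [hincl, hD]
        rfl
  refine ⟨Equiv.sumCongr e e, ht, hb, ?_⟩
  rintro (i | ⟨t | t, k⟩)
  · exact hup (.inl i)
  · exact hup (.inr ⟨t, k⟩)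
  · have h1 : D.wire (upIncl D Set.univ ((D.invWire (.inr ⟨t, k⟩)).map e fun _ => rfl)) =
        upIn D Set.univ ⟨e t, k⟩ := by
      exact (congrArg _ (hincl _)).trans (wire_invWire D _)
    exact (doubleWire_lower h h1).trans (hlow _)

theorem double_reduces (hS : UpClosed D S) {t : D.T} (ht : t ∈ S)
    (hmin : ∀ s ∈ S, ¬ D.Above t s) (hS' : UpClosed D (S \ {t})) :
    Reduces (double hS) (double hS') := by
  let j : ↥(S \ {t}) → S := fun r => ⟨r.1, r.2.1⟩
  have hj : Function.Injective j := fun a b h => Subtype.ext (congrArg (fun r : S => r.1) h)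
  have htop : ∀ r, (double hS).top (Sum.map j j r) = (double hS').top r := by
    rintro (r | r) <;> rfl
  have hbot : ∀ r, (double hS).bot (Sum.map j j r) = (double hS').bot r := by
    rintro (r | r) <;> rfl
  have hlow : ∀ (p : Port u fun r : ↥(S \ {t}) => D.bot r),
      concatLower (p.map j fun _ => rfl) =
      (concatLower (a := fun r : ↥(S \ {t}) => D.top r) p).map (Sum.map j j) htop := by
    rintro (i | ⟨t, k⟩) <;> rfl
  have hincl : ∀ (p : Port u fun r : ↥(S \ {t}) => D.bot r),
      upIncl D S (p.map j fun _ => rfl) = upIncl D (S \ {t}) p := by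
    rintro (i | ⟨t, k⟩) <;> rfl
  have hup : ∀ (o : Port u fun r : ↥(S \ {t}) => D.bot r),
      doubleUp D S (o.map j fun _ => rfl) =
        (doubleUp D (S \ {t}) o).map (Sum.map j j) htop ∨
      ∃ k, doubleUp D S (o.map j fun _ => rfl) = .inr ⟨.inl ⟨t, ht⟩, k⟩ ∧
        doubleWire D S hS (.inr ⟨.inr ⟨t, ht⟩, k⟩) =
        (doubleUp D (S \ {t}) o).map (Sum.map j j) htop := by
    intro o
    rcases doubleUp_cases o with ⟨q, h1, h2⟩ | ⟨h1, h2⟩ <;> rw [h2]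
    · left
      rw [doubleUp_pos (q := ⟨j q.1, q.2⟩)]
      · rfl
      · rw [hincl, h1]
    · rcases doubleUp_cases (o.map j fun _ => rfl) with ⟨⟨⟨r, hr⟩, k⟩, h3, h4⟩ | ⟨h3, h4⟩ <;> rw [h4]
      · right
        by_cases hrt : r = t
        · subst hrt
          refine ⟨k, rfl, ?_⟩
          rw [doubleWire_lower hS h3, hlow]
        · exact absurd ((congrArg _ (hincl o)).symm.trans h3) (h1 ⟨⟨r, hr, hrt⟩, k⟩)
      · left
        exact hlow o
  refine ⟨.inl ⟨t, ht⟩, .inr ⟨t, ht⟩, rfl, rfl, Sum.map j j, htop, hbot, ?_, ?_,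
    hj.sumMap hj, ?_, ?_⟩
  · exact Sum.inl_ne_inr
  · intro k
    refine doubleUp_neg (D := D) (S := S) (o := .inr ⟨⟨t, ht⟩, k⟩) ?_
    rintro q hq
    exact hmin q.1 q.1.2 ⟨k, q.2, hq⟩
  · have : Set.range (Sum.map j j) = {.inl ⟨t, ht⟩, .inr ⟨t, ht⟩}ᶜ := by
      ext (⟨r, hr⟩ | ⟨r, hr⟩) <;> simp [j, hr]
    exact this
  · rintro (i | ⟨r | r, k⟩)
    · exact hup (.inl i)
    · exact hup (.inr ⟨r, k⟩)
    · left
      obtain ⟨o, h1, h2⟩ := doubleWire_lower_cases hS' r k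
      have h3 : D.wire (upIncl D S (o.map j fun _ => rfl)) = upIn D S ⟨j r, k⟩ := by
        rw [hincl, h1]
      exact (doubleWire_lower hS h3).trans ((hlow o).trans (congrArg _ h2.symm))

theorem double_rel (n : ℕ) : ∀ (S : Set D.T) (hS : UpClosed D S), S.ncard = n →
    dipoleSetoid P u u (double hS) (idDiagram P u) := by
  have := D.finite
  induction n with
  | zero =>
    intro S hS h
    obtain rfl := (Set.ncard_eq_zero S.toFinite).1 h
    exact .rel _ _ (.inl (double_empty hS))
  | succ n ih =>
    intro S hS h
    have hne : S.Nonempty := Set.nonempty_of_ncard_ne_zero (by omega)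
    have hirr : Std.Irrefl (Function.swap (Relation.TransGen D.Above)) := ⟨D.acyclic⟩
    have htr : IsTrans D.T (Function.swap (Relation.TransGen D.Above)) :=
      ⟨fun _ _ _ h1 h2 => Relation.TransGen.trans h2 h1⟩
    obtain ⟨t, ht, hmin⟩ := (Finite.wellFounded_of_trans_of_irrefl
      (Function.swap (Relation.TransGen D.Above))).has_min S hne
    have hmin' : ∀ s ∈ S, ¬ D.Above t s := fun s hs h => hmin s hs (.single h)
    have hS' : UpClosed D (S \ {t}) := by
      rintro r s hrs ⟨hs, _⟩
      refine ⟨hS r s hrs hs, ?_⟩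
      rintro rfl
      exact hmin' s hs hrs
    refine .trans _ _ _ (.rel _ _ (.inr (double_reduces hS ht hmin' hS'))) (ih _ hS' ?_)
    rw [Set.ncard_sdiff_singleton_of_mem ht, h, Nat.add_sub_cancel]

theorem concat_inv (D : BraidedDiagram P u v) :
    dipoleSetoid P u u (D.concat D.inv) (idDiagram P u) :=
  have h : UpClosed D Set.univ := fun _ _ _ _ => trivial
  .trans _ _ _ (.rel _ _ (.inl (double_univ h))) (double_rel _ _ h rfl)

end Double

theorem rel_concat {D D' : BraidedDiagram P u v} {E E' : BraidedDiagram P v w}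
    (hD : dipoleSetoid P u v D D') (hE : dipoleSetoid P v w E E') :
    dipoleSetoid P u w (D.concat E) (D'.concat E') := by
  have h1 : dipoleSetoid P u w (D.concat E) (D'.concat E) := by
    clear hE
    induction hD with
    | rel _ _ h => exact .rel _ _ (h.imp (fun h => h.concat_left E) (fun h => h.concat_left E))
    | refl => exact .refl _
    | symm _ _ _ ih => exact .symm _ _ ih
    | trans _ _ _ _ _ ih1 ih2 => exact .trans _ _ _ ih1 ih2
  have h2 : dipoleSetoid P u w (D'.concat E) (D'.concat E') := by
    clear h1
    induction hE with
    | rel _ _ h => exact .rel _ _ (h.imp (fun h => h.concat_right D') (fun h => h.concat_right D'))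
    | refl => exact .refl _
    | symm _ _ _ ih => exact .symm _ _ ih
    | trans _ _ _ _ _ ih1 ih2 => exact .trans _ _ _ ih1 ih2
  exact .trans _ _ _ h1 h2

theorem rel_inv {D D' : BraidedDiagram P u v} (hD : dipoleSetoid P u v D D') :
    dipoleSetoid P v u D.inv D'.inv := by
  induction hD with
  | rel _ _ h => exact .rel _ _ (h.imp (fun h => h.inv) (fun h => h.inv))
  | refl => exact .refl _
  | symm _ _ _ ih => exact .symm _ _ ih
  | trans _ _ _ _ _ ih1 ih2 => exact .trans _ _ _ ih1 ih2

end BraidedDiagram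

/-- The braided diagram group over `P` based at the word `w`: braided `(w, w)`-diagrams modulo
dipoles, under concatenation. -/
def BraidedDiagramGroup {α : Type*} (P : SemigroupPresentation α) (w : List α) :=
  Quotient (BraidedDiagram.dipoleSetoid P w w)

noncomputable instance BraidedDiagramGroup.instGroup {α : Type*} (P : SemigroupPresentation α) (w : List α) :
    Group (BraidedDiagramGroup P w) :=
  letI : Mul (BraidedDiagramGroup P w) :=
    ⟨Quotient.map₂ (fun D E => D.concat E) fun _ _ h _ _ h' => BraidedDiagram.rel_concat h h'⟩
  letI : One (BraidedDiagramGroup P w) := ⟨Quotient.mk _ (BraidedDiagram.idDiagram P w)⟩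
  letI : Inv (BraidedDiagramGroup P w) :=
    ⟨Quotient.map (fun D => D.inv) fun _ _ h => BraidedDiagram.rel_inv h⟩
  Group.ofRightAxioms
    (by
      rintro ⟨D⟩ ⟨E⟩ ⟨F⟩
      exact Quotient.sound (.rel _ _ (.inl (D.concat_assoc E F))))
    (by
      rintro ⟨D⟩
      exact Quotient.sound (.rel _ _ (.inl D.concat_id)))
    (by
      rintro ⟨D⟩
      exact Quotient.sound D.concat_inv)

/-- Balls of a metric space: closed balls of positive radius, as sets. -/
abbrev MetricBall (X : Type*) [MetricSpace X] :=
  {B : Set X // ∃ x r, 0 < r ∧ B = Metric.closedBall x r}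

/-- A nonempty compact metric space is a ball. -/
def MetricBall.whole (X : Type*) [MetricSpace X] [CompactSpace X] [Nonempty X] : MetricBall X :=
  ⟨Set.univ, by
    obtain ⟨x⟩ := ‹Nonempty X›
    refine ⟨x, Metric.diam (Set.univ : Set X) + 1, by positivity, ?_⟩
    symm
    rw [Set.eq_univ_iff_forall]
    intro y
    have := Metric.dist_le_diam_of_mem isCompact_univ.isBounded (Set.mem_univ y) (Set.mem_univ x)
    rw [Metric.mem_closedBall]
    linarith⟩

/-- Finite similarity structures: finite sets of surjective similarities between balls, closed under
identities, inverses, compositions and restrictions. A similarity is injective, so a surjective one is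
an equivalence. -/
structure FiniteSimilarityStructure (X : Type*) [MetricSpace X] where
  Sim : (B₁ B₂ : MetricBall X) → Set (B₁.1 ≃ B₂.1)
  similarity : ∀ (B₁ B₂ : MetricBall X), ∀ h ∈ Sim B₁ B₂,
    ∃ c : ℝ, 0 < c ∧ ∀ x y, dist (h x) (h y) = c * dist x y
  finite : ∀ B₁ B₂ : MetricBall X, (Sim B₁ B₂).Finite
  id_mem : ∀ B : MetricBall X, Equiv.refl B.1 ∈ Sim B B
  symm_mem : ∀ (B₁ B₂ : MetricBall X), ∀ h ∈ Sim B₁ B₂, h.symm ∈ Sim B₂ B₁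
  trans_mem : ∀ (B₁ B₂ B₃ : MetricBall X), ∀ h₁ ∈ Sim B₁ B₂, ∀ h₂ ∈ Sim B₂ B₃,
    h₁.trans h₂ ∈ Sim B₁ B₃
  /-- The restriction of `h` to a ball `B₃` belongs to `Sim B₃ B₄`, where `B₄` is the image of `B₃`. -/
  restrict_mem : ∀ (B₁ B₂ : MetricBall X), ∀ h ∈ Sim B₁ B₂, ∀ (B₃ : MetricBall X) (h₃ : B₃.1 ⊆ B₁.1),
    ∃ (B₄ : MetricBall X), ∃ g ∈ Sim B₃ B₄, ∀ x : B₃.1, (g x : X) = h ⟨x, h₃ x.2⟩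

namespace FiniteSimilarityStructure

variable {X : Type*} [MetricSpace X]

/-- A homeomorphism `X → X` is locally determined by `S` if every point lies in a ball `B` such that the
restriction to `B` belongs to `S.Sim B B'`, for some ball `B'` (the image of `B`). -/
def LocallyDetermined (S : FiniteSimilarityStructure X) (h : X ≃ₜ X) : Prop :=
  ∀ x, ∃ B : MetricBall X, x ∈ B.1 ∧ ∃ (B' : MetricBall X), ∃ g ∈ S.Sim B B', ∀ y : B.1, (g y : X) = h y

/-- The FSS group: homeomorphisms of `X` locally determined by `S`, under composition. -/
def group [IsUltrametricDist X] (S : FiniteSimilarityStructure X) : Subgroup (X ≃ₜ X) where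
  carrier := {h | S.LocallyDetermined h}
  one_mem' := fun x => ⟨⟨Metric.closedBall x 1, x, 1, one_pos, rfl⟩,
    Metric.mem_closedBall_self zero_le_one, _, _, S.id_mem _, fun _ => rfl⟩
  inv_mem' := by
    intro a ha x
    obtain ⟨B, hx, B', g, hg, h⟩ := ha (a⁻¹ x)
    have h' : ∀ y, (g.symm y : X) = a⁻¹ y := by
      intro y
      have := h (g.symm y)
      rw [Equiv.apply_symm_apply] at this
      rw [this]
      exact (a.symm_apply_apply _).symm
    refine ⟨B', ?_, B, g.symm, S.symm_mem _ _ _ hg, h'⟩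
    have := (g ⟨_, hx⟩).2
    rw [h] at this
    exact (congrArg (· ∈ B'.1) (a.apply_symm_apply x)).mp this
  mul_mem' := by
    intro a b ha hb x
    obtain ⟨B, hx, B', g, hg, h⟩ := hb x
    obtain ⟨C, hx', C', k, hk, h'⟩ := ha (b x)
    have hbx : b x ∈ B'.1 := by
      have := (g ⟨x, hx⟩).2
      rwa [h] at this
    have h2 : g ⟨x, hx⟩ = ⟨b x, hbx⟩ := Subtype.ext (h _)
    have hnest : B'.1 ⊆ C.1 ∨ C.1 ⊆ B'.1 := by
      obtain ⟨y, r, -, hB⟩ := B'.2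
      obtain ⟨z, s, -, hC⟩ := C.2
      rw [hB] at hbx ⊢
      rw [hC] at hx' ⊢
      rcases IsUltrametricDist.closedBall_subset_trichotomy y z r s with h | h | h
      · exact .inl h
      · exact .inr h
      · exact absurd hx' (Set.disjoint_left.1 h hbx)
    rcases hnest with hn | hn
    · obtain ⟨D, m, hm, hm'⟩ := S.restrict_mem _ _ k hk B' hn
      refine ⟨B, hx, D, g.trans m, S.trans_mem _ _ _ _ hg _ hm, fun y => ?_⟩
      rw [Equiv.trans_apply, hm', h']
      exact congrArg a (h y)
    · obtain ⟨D, m, hm, hm'⟩ := S.restrict_mem _ _ _ (S.symm_mem _ _ _ hg) C hn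
      refine ⟨D, ?_, C', m.symm.trans k, S.trans_mem _ _ _ _ (S.symm_mem _ _ _ hm) _ hk, fun y => ?_⟩
      · have h1 := (m ⟨b x, hx'⟩).2
        rw [hm'] at h1
        rwa [← h2, Equiv.symm_apply_apply] at h1
      · have h1 := hm' (m.symm y)
        rw [Equiv.apply_symm_apply] at h1
        rw [Equiv.trans_apply, h']
        refine congrArg a ?_
        have h2 := h (g.symm ⟨m.symm y, hn (m.symm y).2⟩)
        rw [Equiv.apply_symm_apply, ← h1] at h2
        exact h2

/-- Similarity classes of balls. -/
def setoid (S : FiniteSimilarityStructure X) : Setoid (MetricBall X) where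
  r B₁ B₂ := (S.Sim B₁ B₂).Nonempty
  iseqv :=
    { refl := fun B => ⟨_, S.id_mem B⟩
      symm := fun ⟨_, h⟩ => ⟨_, S.symm_mem _ _ _ h⟩
      trans := fun ⟨_, h⟩ ⟨_, h'⟩ => ⟨_, S.trans_mem _ _ _ _ h _ h'⟩ }

/-- The class `[B]` of a ball `B`. -/
def cls (S : FiniteSimilarityStructure X) (B : MetricBall X) : Quotient S.setoid := Quotient.mk _ B

/-- Small similarity structures: at most one similarity between any two balls, and all similarities
preserve the order. -/
structure IsSmall [LinearOrder X] (S : FiniteSimilarityStructure X) : Prop where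
  subsingleton : ∀ B₁ B₂ : MetricBall X, (S.Sim B₁ B₂).Subsingleton
  order_preserving : ∀ (B₁ B₂ : MetricBall X), ∀ h ∈ S.Sim B₁ B₂, ∀ x y, x < y → h x < h y

/-- `B₁, …, Bₙ` are the maximal proper subballs of `B`, without repetition and listed in order. -/
def MaximalSubballs [LinearOrder X] (B : MetricBall X) (L : List (MetricBall X)) : Prop :=
  (∀ C : MetricBall X, C ∈ L ↔ Maximal (fun C : MetricBall X => C.1 ⊂ B.1) C) ∧
    L.Pairwise (fun C₁ C₂ => ∀ x ∈ C₁.1, ∀ y ∈ C₂.1, x < y)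

/-- The presentation whose letters are the classes of balls, with relations
`([B], [B₁]⋯[Bₙ])`, where `B₁, …, Bₙ`, `n ≥ 1`, are the maximal proper subballs of `B` in order. -/
def presentation [LinearOrder X] (S : FiniteSimilarityStructure X) :
    SemigroupPresentation (Quotient S.setoid) where
  rels := {r | ∃ B L, L ≠ [] ∧ MaximalSubballs B L ∧ r = ([S.cls B], L.map S.cls)}
  left_ne_nil := by
    rintro _ ⟨B, L, -, -, rfl⟩
    exact List.cons_ne_nil _ _
  right_ne_nil := by
    rintro _ ⟨B, L, h, -, rfl⟩
    simpa using h

end FiniteSimilarityStructure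

/-- The compatibility of a linear order with the balls: if `B₁`, `B₂` are disjoint balls and some point
of `B₁` is less than some point of `B₂`, then every point of `B₁` is less than every point of `B₂`. -/
def OrderSeparatesBalls (X : Type*) [MetricSpace X] [LinearOrder X] : Prop :=
  ∀ B₁ B₂ : MetricBall X, Disjoint B₁.1 B₂.1 → (∃ x ∈ B₁.1, ∃ y ∈ B₂.1, x < y) →
    ∀ x ∈ B₁.1, ∀ y ∈ B₂.1, x < y

/-!
In a tree-like presentation every letter has a word of children, the right side of its relation, or is a
leaf. The iterated children of a letter `x` form a tree, and the space `P.Ends x` of its ends carries the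
action of both groups. The theorem holds because both act faithfully, by the same permutations: those that
are *local* (`IsLocal`), that is, that locally replace an initial path of an end by a path to the same letter.

**Diagrams.** A transistor of a tree-like presentation splits a letter into its children or merges the children
of a letter, so it identifies the ends below the letters on its top with those below the letters on its bottom.
Functions on ends are transported through a diagram along the wires (`BraidedDiagram.Transports`), uniquely
and invariantly under dipoles (`Transports.of_rel`), and transport is local (`exists_replacement`). This gives
the action `BraidedDiagramGroup.endAction`.

It is faithful: let a diagram without dipoles transport the ends to themselves. Nothing but splits can occur
above a split, so the wires below a lowest split are described by paths from the top of the frame, and,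
since nothing but merges can occur below, also by paths from the bottom of the frame. The paths agree, so
these wires lead to a single merge that forms a dipole with the split (`not_isSplit`). Hence there is no
transistor, and the diagram is trivial (`rel_id_of_transports`).

Its image consists of all local permutations: by bar induction the paths that are replaced can be chosen to
form a finite cover of the ends (`exists_cover`). A cover is obtained from the trivial one by passing to
children repeatedly (`Cover.induction`), hence is the bottom of a diagram of splits
(`exists_transports_cover`). A local permutation is realized by the diagram of one cover followed by the
inverse of the diagram of another (`exists_acts_eq`).

**Similarities.** If the points of an ultrametric space are identified with the ends in such a way that
similarities become replacements of paths to the same letter (`FiniteSimilarityStructure.Coding`), then the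
elements of the similarity group become the local permutations, so the groups are isomorphic
(`Coding.nonempty_mulEquiv`). A tree-like presentation codes the space of ends itself, with the
lexicographic order and the metric of first differences (`coding_endSimilarities`); compactness is bar
induction again. Conversely, in a compact ultrametric space every ball is contained in finitely many balls,
so that a ball with several points is the disjoint union of finitely many maximal proper subballs. A small
similarity structure preserves these and their order. So the tree of iterated maximal subballs is the tree
of their classes, its ends are the points, and similarities are replacements of paths to the same class
(`exists_coding`).
-/

local infixr:67 " ::ₛ " => Stream'.cons

/-! ### Paths and ends in the tree of iterated children of a letter -/

namespace SemigroupPresentation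

variable {α : Type*} (P : SemigroupPresentation α)

open Classical in
/-- The word into which a letter `a` of a tree-like presentation splits. A letter that is not the left
side of a relation is given itself as its only child, so that every letter has a child. -/
noncomputable def children (a : α) : List α :=
  if h : ∃ w, ([a], w) ∈ P.rels then h.choose else [a]

/-- The `k`-th child of a letter (and the letter itself if it has fewer children). -/
noncomputable def child (a : α) (k : ℕ) : α := (P.children a).getD k a

/-- The letter reached from `a` by the path `τ` in the tree of iterated children. -/
noncomputable def label : α → List ℕ → α
  | a, [] => a
  | a, k :: τ => label (P.child a k) τ

/-- `τ`, read as a list of indices of children, is a path in the tree of iterated children of `a`. -/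
def Addr : α → List ℕ → Prop
  | _, [] => True
  | a, k :: τ => k < (P.children a).length ∧ Addr (P.child a k) τ

/-- `s` is an end of the tree of iterated children of `a`, that is, an infinite path from the root. Below
a letter without relation the only path is constantly `0`, so such a letter has exactly one end. -/
def IsEnd (a : α) (s : Stream' ℕ) : Prop := ∀ n, P.Addr a (s.take n)

variable {P}

theorem children_pos (a : α) : 0 < (P.children a).length := by
  unfold children
  split_ifs with h
  · exact List.length_pos_iff.2 (P.right_ne_nil _ h.choose_spec)
  · simp

theorem IsTreeLike.children_eq (hP : P.IsTreeLike) {a : α} {w : List α} (h : ([a], w) ∈ P.rels) :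
    P.children a = w := by
  have h' : ∃ w, ([a], w) ∈ P.rels := ⟨w, h⟩
  rw [children, dif_pos h']
  exact hP.right_unique a _ _ h'.choose_spec h

theorem children_mem {a : α} (h : ∃ w, ([a], w) ∈ P.rels) : ([a], P.children a) ∈ P.rels := by
  rw [children, dif_pos h]
  exact h.choose_spec

theorem children_leaf {a : α} (h : ¬ ∃ w, ([a], w) ∈ P.rels) : P.children a = [a] := by
  rw [children, dif_neg h]

theorem child_eq {a : α} {k : ℕ} (h : k < (P.children a).length) :
    P.child a k = (P.children a)[k] := by
  simp [child, h]

theorem IsTreeLike.child_get (hP : P.IsTreeLike) {a : α} {w : List α} (h : ([a], w) ∈ P.rels)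
    (k : Fin w.length) : P.child a k = w.get k := by
  have := hP.children_eq h
  subst this
  exact child_eq k.2

@[simp] theorem label_nil (a : α) : P.label a [] = a := rfl

@[simp] theorem label_cons (a : α) (k : ℕ) (τ : List ℕ) :
    P.label a (k :: τ) = P.label (P.child a k) τ := rfl

@[simp] theorem addr_nil (a : α) : P.Addr a [] := trivial

@[simp] theorem addr_cons {a : α} {k : ℕ} {τ : List ℕ} :
    P.Addr a (k :: τ) ↔ k < (P.children a).length ∧ P.Addr (P.child a k) τ := Iff.rfl

theorem label_append (a : α) (τ ρ : List ℕ) :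
    P.label a (τ ++ ρ) = P.label (P.label a τ) ρ := by
  induction τ generalizing a with
  | nil => rfl
  | cons k τ ih => exact ih _

theorem addr_append {a : α} {τ ρ : List ℕ} :
    P.Addr a (τ ++ ρ) ↔ P.Addr a τ ∧ P.Addr (P.label a τ) ρ := by
  induction τ generalizing a with
  | nil => simp
  | cons k τ ih => simp [ih, and_assoc]

theorem isEnd_cons {a : α} {k : ℕ} {s : Stream' ℕ} :
    P.IsEnd a (k ::ₛ s) ↔ k < (P.children a).length ∧ P.IsEnd (P.child a k) s := by
  constructor
  · intro h
    exact ⟨(h 1).1, fun n => (h (n + 1)).2⟩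
  · rintro ⟨h1, h2⟩ (_ | n)
    · trivial
    · exact ⟨h1, h2 n⟩

theorem isEnd_append {a : α} {τ : List ℕ} {s : Stream' ℕ} :
    P.IsEnd a (τ ++ₛ s) ↔ P.Addr a τ ∧ P.IsEnd (P.label a τ) s := by
  induction τ generalizing a with
  | nil => simp
  | cons k τ ih => rw [Stream'.cons_append_stream, isEnd_cons, ih, addr_cons, label_cons, and_assoc]

theorem isEnd_head_tail {a : α} {s : Stream' ℕ} :
    P.IsEnd a s ↔ s.head < (P.children a).length ∧ P.IsEnd (P.child a s.head) s.tail := by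
  rw [← isEnd_cons, Stream'.eta]

theorem IsEnd.drop {a : α} {s : Stream' ℕ} (h : P.IsEnd a s) (n : ℕ) :
    P.IsEnd (P.label a (s.take n)) (s.drop n) := by
  rw [← Stream'.append_take_drop n s, isEnd_append] at h
  rw [← Stream'.append_take_drop n s] at h ⊢
  simpa using h.2

theorem isEnd_zero (a : α) : P.IsEnd a (Stream'.const 0) := by
  intro n
  induction n generalizing a with
  | zero => trivial
  | succ n ih => exact ⟨children_pos a, ih _⟩

/-- A letter without relation has only one end. -/
theorem isEnd_leaf {a : α} (h : ¬ ∃ w, ([a], w) ∈ P.rels) {s : Stream' ℕ} (hs : P.IsEnd a s) :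
    s = Stream'.const 0 := by
  have : ∀ n (s : Stream' ℕ), P.IsEnd a s → s.get n = 0 := by
    intro n
    induction n with
    | zero =>
      intro s hs
      have := (isEnd_head_tail.1 hs).1
      rw [children_leaf h] at this
      exact Nat.lt_one_iff.1 this
    | succ n ih =>
      intro s hs
      have := (isEnd_head_tail.1 hs).2
      rw [child, children_leaf h] at this
      refine ih s.tail ?_
      rcases hk : s.head with _ | k <;> rw [hk] at this <;> exact this
  exact Stream'.ext fun n => this n s hs

theorem child_leaf {a : α} (h : ¬ ∃ w, ([a], w) ∈ P.rels) (k : ℕ) : P.child a k = a := by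
  rw [child, children_leaf h]
  rcases k with _ | k <;> rfl

theorem append_stream_injective {τ ρ : List ℕ} {s t : Stream' ℕ} (hl : τ.length = ρ.length)
    (h : τ ++ₛ s = ρ ++ₛ t) : τ = ρ ∧ s = t := by
  induction τ generalizing ρ with
  | nil =>
    cases List.length_eq_zero_iff.1 hl.symm
    exact ⟨rfl, h⟩
  | cons k τ ih =>
    rcases ρ with _ | ⟨l, ρ⟩
    · simp at hl
    · rw [Stream'.cons_append_stream, Stream'.cons_append_stream] at h
      obtain ⟨h1, h2⟩ := Stream'.cons_injective2 h
      obtain ⟨h3, h4⟩ := ih (by simpa using hl) h2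
      exact ⟨by rw [h1, h3], h4⟩

/-- If an end starts with two paths, then the longer path extends the shorter one. -/
theorem append_stream_eq_append_stream {τ ρ : List ℕ} {s t : Stream' ℕ}
    (hl : τ.length ≤ ρ.length) (h : τ ++ₛ s = ρ ++ₛ t) : ∃ σ, ρ = τ ++ σ ∧ s = σ ++ₛ t := by
  rw [← List.take_append_drop τ.length ρ, Stream'.append_append_stream] at h
  obtain ⟨h1, h2⟩ := append_stream_injective (by simp [hl]) h
  refine ⟨ρ.drop τ.length, ?_, h2⟩
  conv_lhs => rw [← List.take_append_drop τ.length ρ, ← h1]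

theorem IsTreeLike.one_lt_children (hP : P.IsTreeLike) {a : α} (h : ∃ w, ([a], w) ∈ P.rels) :
    1 < (P.children a).length := hP.length_right _ (children_mem h)

/-- A proper extension of a path cannot lead to the same ends, unless the path leads to a leaf. -/
theorem IsTreeLike.eq_nil_of_append (hP : P.IsTreeLike) {a b : α} (ha : ∃ w, ([a], w) ∈ P.rels)
    {τ : List ℕ} (h : ∀ s, P.IsEnd a s → ∃ t, P.IsEnd b t ∧ s = τ ++ₛ t) : τ = [] := by
  rcases τ with _ | ⟨k, τ⟩
  · rfl
  exfalso
  have h1 := hP.one_lt_children ha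
  obtain ⟨l, hl, hkl⟩ : ∃ l < (P.children a).length, l ≠ k := by
    by_cases hk : k = 0
    · exact ⟨1, h1, by omega⟩
    · exact ⟨0, by omega, by omega⟩
  obtain ⟨t, -, ht⟩ := h (l ::ₛ Stream'.const 0) (isEnd_cons.2 ⟨hl, isEnd_zero _⟩)
  rw [Stream'.cons_append_stream] at ht
  exact hkl (Stream'.cons_injective2 ht).1

end SemigroupPresentation

/-! ### Transport of functions along the wires of a diagram -/

namespace SemigroupPresentation

variable {α Z : Type*} (P : SemigroupPresentation α)

/-- Functions on the ends below the contacts of a transistor with top word `p` and bottom word `q` are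
compatible if they agree under the identification of the ends below a letter with the ends below its
children. -/
def Compat {p q : List α} (B : Fin p.length → Stream' ℕ → Z) (A : Fin q.length → Stream' ℕ → Z) :
    Prop :=
  ((p, q) ∈ P.rels → ∀ k l s, P.IsEnd (q.get l) s → B k (l.1 ::ₛ s) = A l s) ∧
  ((q, p) ∈ P.rels → ∀ k l s, P.IsEnd (p.get k) s → B k s = A l (k.1 ::ₛ s))

variable {P}

theorem Compat.symm {p q : List α} {B : Fin p.length → Stream' ℕ → Z}
    {A : Fin q.length → Stream' ℕ → Z} (h : P.Compat B A) : P.Compat A B :=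
  ⟨fun h' k l s hs => (h.2 h' l k s hs).symm, fun h' k l s hs => (h.1 h' l k s hs).symm⟩

theorem Compat.comp {W : Type*} {p q : List α} {B : Fin p.length → Stream' ℕ → Z}
    {A : Fin q.length → Stream' ℕ → Z} (h : P.Compat B A) (φ : Z → W) :
    P.Compat (fun k s => φ (B k s)) (fun l s => φ (A l s)) :=
  ⟨fun h' k l s hs => congrArg φ (h.1 h' k l s hs), fun h' k l s hs => congrArg φ (h.2 h' k l s hs)⟩

theorem Compat.cast {p q p' q' : List α} (hp : p' = p) (hq : q' = q)
    {B : Fin p.length → Stream' ℕ → Z} {A : Fin q.length → Stream' ℕ → Z} (h : P.Compat B A) :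
    P.Compat (fun k : Fin p'.length => B (Fin.cast (congrArg List.length hp) k))
      (fun l : Fin q'.length => A (Fin.cast (congrArg List.length hq) l)) := by
  subst hp hq
  exact h

theorem IsTreeLike.asymm (hP : P.IsTreeLike) {p q : List α} (h : (p, q) ∈ P.rels) :
    (q, p) ∉ P.rels := by
  intro h'
  have h1 := hP.length_left _ h
  have h2 := hP.length_right _ h'
  simp only at h1 h2
  omega

theorem IsTreeLike.eq_singleton (hP : P.IsTreeLike) {p q : List α} (h : (p, q) ∈ P.rels)
    (k : Fin p.length) : p = [p.get k] := by
  obtain ⟨a, rfl⟩ := List.length_eq_one_iff.1 (hP.length_left _ h)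
  simp

/-- An end of the single letter on the left of a relation is an end of a letter on the right. -/
theorem IsTreeLike.split_end (hP : P.IsTreeLike) {p q : List α} (h : (p, q) ∈ P.rels)
    (k : Fin p.length) {s : Stream' ℕ} (hs : P.IsEnd (p.get k) s) :
    ∃ (l : Fin q.length), s = l.1 ::ₛ s.tail ∧ P.IsEnd (q.get l) s.tail := by
  rw [hP.eq_singleton h k] at h
  obtain ⟨h1, h2⟩ := isEnd_head_tail.1 hs
  have h3 := hP.children_eq h
  refine ⟨⟨s.head, by rwa [h3] at h1⟩, (Stream'.eta s).symm, ?_⟩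
  rw [← hP.child_get h]
  exact h2

theorem IsTreeLike.merge_end (hP : P.IsTreeLike) {p q : List α} (h : (p, q) ∈ P.rels)
    (k : Fin p.length) (l : Fin q.length) {s : Stream' ℕ} (hs : P.IsEnd (q.get l) s) :
    P.IsEnd (p.get k) (l.1 ::ₛ s) := by
  rw [hP.eq_singleton h k] at h
  rw [isEnd_cons, hP.children_eq h, hP.child_get h]
  exact ⟨l.2, hs⟩

/-- Functions at the bottom contacts of a transistor determine those at its top contacts. -/
theorem Compat.eq_top (hP : P.IsTreeLike) {p q : List α} (hpq : (p, q) ∈ P.rels ∨ (q, p) ∈ P.rels)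
    {B B' : Fin p.length → Stream' ℕ → Z} {A A' : Fin q.length → Stream' ℕ → Z}
    (h : P.Compat B A) (h' : P.Compat B' A')
    (hA : ∀ l s, P.IsEnd (q.get l) s → A l s = A' l s) (k : Fin p.length) {s : Stream' ℕ}
    (hs : P.IsEnd (p.get k) s) : B k s = B' k s := by
  rcases hpq with hpq | hpq
  · obtain ⟨l, h1, h2⟩ := hP.split_end hpq k hs
    rw [h1, h.1 hpq k l _ h2, h'.1 hpq k l _ h2, hA _ _ h2]
  · obtain ⟨l⟩ : Nonempty (Fin q.length) := ⟨⟨0, List.length_pos_iff.2 (P.left_ne_nil _ hpq)⟩⟩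
    rw [h.2 hpq k l _ hs, h'.2 hpq k l _ hs, hA _ _ (hP.merge_end hpq l k hs)]

/-- Functions at the bottom contacts of a transistor extend to its top contacts. -/
theorem IsTreeLike.exists_compat [Nonempty Z] (hP : P.IsTreeLike) {p q : List α}
    (hpq : (p, q) ∈ P.rels ∨ (q, p) ∈ P.rels) (A : Fin q.length → Stream' ℕ → Z) :
    ∃ B : Fin p.length → Stream' ℕ → Z, P.Compat B A := by
  classical
  rcases hpq with hpq | hpq
  · refine ⟨fun _ s => if h : s.head < q.length then A ⟨s.head, h⟩ s.tail else Classical.arbitrary Z,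
      fun _ k l s _ => ?_, fun h => absurd h (hP.asymm hpq)⟩
    simp
  · have h0 : 0 < q.length := List.length_pos_iff.2 (P.left_ne_nil _ hpq)
    refine ⟨fun k s => A ⟨0, h0⟩ (k.1 ::ₛ s), fun h => absurd h (hP.asymm hpq), fun _ k l s _ => ?_⟩
    have h1 := hP.length_left _ hpq
    have : l = ⟨0, h0⟩ := Fin.ext (by have := l.2; simp only at h1 ⊢; omega)
    rw [this]

end SemigroupPresentation

namespace BraidedDiagram

variable {α Z : Type*} {P : SemigroupPresentation α} {u v w : List α}

open SemigroupPresentation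

/-- A diagram transports functions `f` on the ends below the top of the frame to functions `g` on the
ends below the bottom of the frame if they extend to functions `A`, `B` at the contacts of all transistors
that agree along the wires and are compatible with the transistors. Values of the functions at streams that
are not ends are ignored. -/
def Transports (D : BraidedDiagram P u v) (f : Fin u.length → Stream' ℕ → Z)
    (g : Fin v.length → Stream' ℕ → Z) : Prop :=
  ∃ (A : (Σ t : D.T, Fin (D.bot t).length) → Stream' ℕ → Z)
    (B : (Σ t : D.T, Fin (D.top t).length) → Stream' ℕ → Z),
    (∀ (o : Port u D.bot) s, P.IsEnd o.letter s → (Sum.elim f A o : Stream' ℕ → Z) s =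
      (Sum.elim g B (D.wire o) : Stream' ℕ → Z) s) ∧
    ∀ t, P.Compat (fun k => B ⟨t, k⟩) (fun l => A ⟨t, l⟩)

theorem wellFounded_above (D : BraidedDiagram P u v) : WellFounded D.Above := by
  have := D.finite
  have hirr : Std.Irrefl (Relation.TransGen D.Above) := ⟨D.acyclic⟩
  have htr : IsTrans D.T (Relation.TransGen D.Above) :=
    ⟨fun _ _ _ h1 h2 => Relation.TransGen.trans h1 h2⟩
  exact Subrelation.wf Relation.TransGen.single
    (Finite.wellFounded_of_trans_of_irrefl (Relation.TransGen D.Above))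

theorem wellFounded_below (D : BraidedDiagram P u v) : WellFounded (Function.swap D.Above) := by
  have := D.finite
  have hirr : Std.Irrefl (Function.swap (Relation.TransGen D.Above)) := ⟨D.acyclic⟩
  have htr : IsTrans D.T (Function.swap (Relation.TransGen D.Above)) :=
    ⟨fun _ _ _ h1 h2 => Relation.TransGen.trans h2 h1⟩
  exact Subrelation.wf (r := Function.swap (Relation.TransGen D.Above))
    (fun h => Relation.TransGen.single h)
    (Finite.wellFounded_of_trans_of_irrefl (Function.swap (Relation.TransGen D.Above)))

/-- Induction over the wires, from the bottom to the top. -/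
theorem wire_induction (D : BraidedDiagram P u v) {Q : Port u D.bot → Prop}
    (h : ∀ o, (∀ t k, D.wire o = .inr ⟨t, k⟩ → ∀ l, Q (.inr ⟨t, l⟩)) → Q o) (o) : Q o := by
  have key : ∀ t l, Q (.inr ⟨t, l⟩) := fun t =>
    D.wellFounded_below.induction (C := fun t => ∀ l, Q (.inr ⟨t, l⟩)) t fun t ih l =>
      h _ fun t' k hk l' => ih t' ⟨l, k, hk⟩ l'
  exact h o fun t _ _ l => key t l

theorem letter_top_eq (D : BraidedDiagram P u v) {o : Port u D.bot} {t k}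
    (h : D.wire o = .inr ⟨t, k⟩) : (D.top t).get k = o.letter := by
  have := D.letter_wire o
  rwa [h] at this

theorem letter_inl_eq (D : BraidedDiagram P u v) {o : Port u D.bot} {j}
    (h : D.wire o = .inl j) : v.get j = o.letter := by
  have := D.letter_wire o
  rwa [h] at this

theorem Transports.congr {D : BraidedDiagram P u v} {f f' : Fin u.length → Stream' ℕ → Z}
    {g g' : Fin v.length → Stream' ℕ → Z} (h : D.Transports f g)
    (hf : ∀ i s, P.IsEnd (u.get i) s → f i s = f' i s)
    (hg : ∀ j s, P.IsEnd (v.get j) s → g j s = g' j s) : D.Transports f' g' := by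
  obtain ⟨A, B, h1, h2⟩ := h
  refine ⟨A, B, fun o s hs => ?_, h2⟩
  have h3 := h1 o s hs
  have h4 : (Sum.elim f A o : Stream' ℕ → Z) s = (Sum.elim f' A o : Stream' ℕ → Z) s := by
    rcases o with i | o
    · exact hf i s hs
    · rfl
  have h5 : (Sum.elim g B (D.wire o) : Stream' ℕ → Z) s =
      (Sum.elim g' B (D.wire o) : Stream' ℕ → Z) s := by
    rcases ho : D.wire o with j | o'
    · exact hg j s (by rwa [D.letter_inl_eq ho])
    · rfl
  rw [← h4, h3, h5]

theorem Transports.comp {W : Type*} {D : BraidedDiagram P u v} {f : Fin u.length → Stream' ℕ → Z}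
    {g : Fin v.length → Stream' ℕ → Z} (h : D.Transports f g) (φ : Z → W) :
    D.Transports (fun i s => φ (f i s)) (fun j s => φ (g j s)) := by
  obtain ⟨A, B, h1, h2⟩ := h
  refine ⟨fun o s => φ (A o s), fun o s => φ (B o s), fun o s hs => ?_, fun t => (h2 t).comp φ⟩
  have h3 := congrArg φ (h1 o s hs)
  rcases o with i | o <;> rcases ho : D.wire _ with j | o' <;> rw [ho] at h3 <;> exact h3

theorem Transports.inv {D : BraidedDiagram P u v} {f : Fin u.length → Stream' ℕ → Z}
    {g : Fin v.length → Stream' ℕ → Z} (h : D.Transports f g) : D.inv.Transports g f := by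
  obtain ⟨A, B, h1, h2⟩ := h
  have key : ∀ (p : Port v D.top) s, P.IsEnd p.letter s → (Sum.elim g B p : Stream' ℕ → Z) s =
      (Sum.elim f A (D.invWire p) : Stream' ℕ → Z) s := by
    intro p s hs
    have h3 := h1 (D.invWire p) s (by rwa [← D.letter_wire, wire_invWire])
    rw [wire_invWire] at h3
    exact h3.symm
  exact ⟨B, A, key, fun t => (h2 t).symm⟩

/-- Functions on the bottom of the frame determine those on the top. -/
theorem Transports.unique_top (hP : P.IsTreeLike) {D : BraidedDiagram P u v}
    {f f' : Fin u.length → Stream' ℕ → Z} {g : Fin v.length → Stream' ℕ → Z}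
    (h : D.Transports f g) (h' : D.Transports f' g) (i) {s} (hs : P.IsEnd (u.get i) s) :
    f i s = f' i s := by
  obtain ⟨A, B, h1, h2⟩ := h
  obtain ⟨A', B', h1', h2'⟩ := h'
  refine D.wire_induction (Q := fun o => ∀ s, P.IsEnd o.letter s →
    (Sum.elim f A o : Stream' ℕ → Z) s = (Sum.elim f' A' o : Stream' ℕ → Z) s) ?_ (.inl i) s hs
  intro o ih s hs
  rw [h1 o s hs, h1' o s hs]
  rcases ho : D.wire o with j | ⟨t, k⟩
  · rfl
  · exact Compat.eq_top hP (D.mem_rels t) (h2 t) (h2' t) (fun l s hs => ih t k ho l s hs) k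
      (by rwa [D.letter_top_eq ho])

theorem Transports.unique_bot (hP : P.IsTreeLike) {D : BraidedDiagram P u v}
    {f : Fin u.length → Stream' ℕ → Z} {g g' : Fin v.length → Stream' ℕ → Z}
    (h : D.Transports f g) (h' : D.Transports f g') (j) {s} (hs : P.IsEnd (v.get j) s) :
    g j s = g' j s :=
  h.inv.unique_top hP h'.inv j hs

/-- Functions on the bottom of the frame can be pulled up through the transistors. -/
theorem exists_transports_top [Nonempty Z] (hP : P.IsTreeLike) (D : BraidedDiagram P u v)
    (g : Fin v.length → Stream' ℕ → Z) : ∃ f, D.Transports f g := by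
  choose top htop using fun (t : D.T) (A : Fin (D.bot t).length → Stream' ℕ → Z) =>
    hP.exists_compat (D.mem_rels t) A
  -- The functions at the bottom of a transistor, by recursion on the transistors below it.
  let F : (t : D.T) → ((t' : D.T) → D.Above t t' → Fin (D.bot t').length → Stream' ℕ → Z) →
      Fin (D.bot t).length → Stream' ℕ → Z := fun t ih l =>
    match h : D.wire (.inr ⟨t, l⟩) with
    | .inl j => g j
    | .inr ⟨t', k⟩ => top t' (ih t' ⟨l, k, h⟩) k
  let A : (t : D.T) → Fin (D.bot t).length → Stream' ℕ → Z := D.wellFounded_below.fix F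
  have hA : ∀ t, A t = F t fun t' _ => A t' := fun t => D.wellFounded_below.fix_eq F t
  let B : (Σ t : D.T, Fin (D.top t).length) → Stream' ℕ → Z := fun p => top p.1 (A p.1) p.2
  refine ⟨fun i => Sum.elim g B (D.wire (.inl i)), fun p => A p.1 p.2, B, ?_, fun t => htop t (A t)⟩
  rintro (i | ⟨t, l⟩) s -
  · rfl
  · refine congrFun (?_ : A t l = _) s
    rw [hA]
    simp only [F]
    split <;> rename_i h <;> rw [h] <;> rfl

theorem exists_transports_bot [Nonempty Z] (hP : P.IsTreeLike) (D : BraidedDiagram P u v)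
    (f : Fin u.length → Stream' ℕ → Z) : ∃ g, D.Transports f g := by
  obtain ⟨g, A, B, h1, h2⟩ := D.inv.exists_transports_top hP f
  refine ⟨g, B, A, fun o s hs => ?_, fun t => (h2 t).symm⟩
  have h3 := h1 (D.wire o) s (Eq.subst (motive := fun a => P.IsEnd a s) (D.letter_wire o).symm hs)
  have h4 : D.inv.wire (D.wire o) = o := D.invWire_eq rfl
  rw [h4] at h3
  exact h3.symm

theorem transports_id (f : Fin u.length → Stream' ℕ → Z) : (idDiagram P u).Transports f f := by
  refine ⟨fun p => p.1.elim, fun p => p.1.elim, ?_, fun t => t.elim⟩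
  rintro (i | ⟨⟨⟩, k⟩) s -
  rfl

theorem Transports.concat {D : BraidedDiagram P u v} {E : BraidedDiagram P v w}
    {f : Fin u.length → Stream' ℕ → Z} {g : Fin v.length → Stream' ℕ → Z}
    {h : Fin w.length → Stream' ℕ → Z} (hD : D.Transports f g) (hE : E.Transports g h) :
    (D.concat E).Transports f h := by
  obtain ⟨A, B, h1, h2⟩ := hD
  obtain ⟨A', B', h1', h2'⟩ := hE
  let B'' : (Σ t : D.T ⊕ E.T, Fin (Sum.elim D.top E.top t).length) → Stream' ℕ → Z := fun
    | ⟨.inl t, k⟩ => B ⟨t, k⟩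
    | ⟨.inr t, k⟩ => B' ⟨t, k⟩
  have hlow : ∀ p : Port w E.top, (Sum.elim h B'' (concatLower p) : Stream' ℕ → Z) =
      Sum.elim h B' p := by
    rintro (i | ⟨t, k⟩) <;> rfl
  have hup : ∀ (p : Port v D.top) s, P.IsEnd p.letter s →
      (Sum.elim h B'' (concatUpper D E p) : Stream' ℕ → Z) s =
        (Sum.elim g B p : Stream' ℕ → Z) s := by
    rintro (i | ⟨t, k⟩) s hs
    · exact (congrFun (hlow _) s).trans (h1' (.inl i) s hs).symm
    · rfl
  refine ⟨fun
    | ⟨.inl t, k⟩ => A ⟨t, k⟩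
    | ⟨.inr t, k⟩ => A' ⟨t, k⟩, B'', ?_, ?_⟩
  · rintro (i | ⟨t | t, k⟩) s hs
    · exact (h1 (.inl i) s hs).trans (hup _ s (by rwa [D.letter_wire])).symm
    · exact (h1 (.inr ⟨t, k⟩) s hs).trans (hup _ s (by rwa [D.letter_wire])).symm
    · exact (h1' (.inr ⟨t, k⟩) s hs).trans (congrFun (hlow _) s).symm
  · rintro (t | t)
    · exact h2 t
    · exact h2' t

theorem letter_map {T T' : Type*} {a : T → List α} {a' : T' → List α} (f : T → T')
    (h : ∀ t, a' (f t) = a t) (p : Port w a) : (p.map f h).letter = p.letter := by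
  rcases p with i | ⟨t, k⟩
  · rfl
  · simp only [Port.map, Port.letter, List.get_eq_getElem, Fin.val_cast]
    exact List.getElem_of_eq (h t) _

theorem Transports.equivalent {D E : BraidedDiagram P u v} (h : Equivalent E D)
    {f : Fin u.length → Stream' ℕ → Z} {g : Fin v.length → Stream' ℕ → Z}
    (hD : D.Transports f g) : E.Transports f g := by
  obtain ⟨φ, ht, hb, h⟩ := h
  obtain ⟨A, B, h1, h2⟩ := hD
  refine ⟨fun p => A ⟨φ p.1, Fin.cast (congrArg List.length (hb p.1).symm) p.2⟩,
    fun p => B ⟨φ p.1, Fin.cast (congrArg List.length (ht p.1).symm) p.2⟩, fun o s hs => ?_,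
    fun t => (h2 (φ t)).cast (ht t).symm (hb t).symm⟩
  have h3 := h1 (o.map φ hb) s (by rwa [letter_map])
  rw [h] at h3
  rcases o with i | o <;> rcases ho : E.wire _ with j | o' <;> rw [ho] at h3 <;> exact h3

theorem Transports.reduces (hP : P.IsTreeLike) {D E : BraidedDiagram P u v} (h : Reduces D E)
    {f : Fin u.length → Stream' ℕ → Z} {g : Fin v.length → Stream' ℕ → Z}
    (hD : D.Transports f g) : E.Transports f g := by
  obtain ⟨s, t, hout, hin, φ, ht, hb, hst, hwire, hφ, hrange, h⟩ := h
  obtain ⟨A, B, h1, h2⟩ := hD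
  refine ⟨fun p => A ⟨φ p.1, Fin.cast (congrArg List.length (hb p.1).symm) p.2⟩,
    fun p => B ⟨φ p.1, Fin.cast (congrArg List.length (ht p.1).symm) p.2⟩, fun o z hz => ?_,
    fun t => (h2 (φ t)).cast (ht t).symm (hb t).symm⟩
  have hA : ∀ (o : Port u E.bot), (Sum.elim f (fun p : (Σ t : E.T, Fin (E.bot t).length) =>
      A ⟨φ p.1, Fin.cast (congrArg List.length (hb p.1).symm) p.2⟩) o : Stream' ℕ → Z) =
      Sum.elim f A (o.map φ hb) := by
    rintro (i | o) <;> rfl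
  have hB : ∀ (o : Port v E.top), (Sum.elim g (fun p : (Σ t : E.T, Fin (E.top t).length) =>
      B ⟨φ p.1, Fin.cast (congrArg List.length (ht p.1).symm) p.2⟩) o : Stream' ℕ → Z) =
      Sum.elim g B (o.map φ ht) := by
    rintro (i | o) <;> rfl
  have hz' : P.IsEnd (o.map φ hb).letter z := by rwa [letter_map]
  rw [hA, hB, h1 _ z hz']
  rcases h o with h | ⟨k, h3, h4⟩
  · rw [h]
  -- The wires of the dipole identify the functions on its top with those on its bottom.
  · rw [h3, ← h4, ← h1 _ z]
    · have h5 : P.Compat (fun k => B ⟨t, Fin.cast (congrArg List.length hin) k⟩)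
          (fun l => A ⟨t, Fin.cast (congrArg List.length hout) l⟩) := (h2 t).cast hin hout
      refine Compat.eq_top hP (D.mem_rels s) (h2 s) h5.symm (fun l r hr => ?_) k ?_
      · exact (h1 (.inr ⟨s, l⟩) r hr).trans (by rw [hwire]; rfl)
      · rwa [D.letter_top_eq h3]
    · rw [← D.letter_top_eq h3] at hz'
      have : (D.bot t).get (Fin.cast (congrArg List.length hout) k) = (D.top s).get k := by
        simp only [List.get_eq_getElem, Fin.val_cast]
        exact (List.getElem_of_eq hout _).symm
      rw [← this] at hz'
      exact hz'

/-- The transport of functions depends on a diagram only up to dipoles. -/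
theorem Transports.of_rel [Nonempty Z] (hP : P.IsTreeLike) {D E : BraidedDiagram P u v}
    (h : dipoleSetoid P u v D E) {f : Fin u.length → Stream' ℕ → Z}
    {g : Fin v.length → Stream' ℕ → Z} : D.Transports f g ↔ E.Transports f g := by
  -- One implication suffices, as functions on the bottom of the frame extend uniquely to the top.
  have key : ∀ {D E : BraidedDiagram P u v}, (∀ {f : Fin u.length → Stream' ℕ → Z}
      {g : Fin v.length → Stream' ℕ → Z}, D.Transports f g → E.Transports f g) →
      ∀ {f : Fin u.length → Stream' ℕ → Z}
      {g : Fin v.length → Stream' ℕ → Z}, D.Transports f g ↔ E.Transports f g := by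
    intro D E h f g
    refine ⟨h, fun hE => ?_⟩
    obtain ⟨f', hf⟩ := D.exists_transports_top hP g
    exact hf.congr (fun i s hs => (h hf).unique_top hP hE i hs) (fun _ _ _ => rfl)
  induction h generalizing f g with
  | rel D E h =>
    rcases h with h | h
    · exact (key fun hE => hE.equivalent h).symm
    · exact key fun hD => hD.reduces hP h
  | refl => rfl
  | symm _ _ _ ih => exact ih.symm
  | trans _ _ _ _ _ ih1 ih2 => exact ih1.trans ih2

/-- Transport is given by local replacements of initial segments of ends: following a wire down from the
top of the frame, every split consumes one step of the end and every merge puts one step in front of it. -/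
theorem exists_replacement (hP : P.IsTreeLike) {D : BraidedDiagram P u v}
    {f : Fin u.length → Stream' ℕ → Z} {g : Fin v.length → Stream' ℕ → Z}
    (h : D.Transports f g) (i) {s} (hs : P.IsEnd (u.get i) s) :
    ∃ n j τ, P.Addr (v.get j) τ ∧ P.label (v.get j) τ = P.label (u.get i) (s.take n) ∧
      ∀ r, P.IsEnd (P.label (u.get i) (s.take n)) r → f i (s.take n ++ₛ r) = g j (τ ++ₛ r) := by
  obtain ⟨A, B, h1, h2⟩ := h
  refine D.wire_induction (Q := fun o => ∀ s, P.IsEnd o.letter s →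
    ∃ n j τ, P.Addr (v.get j) τ ∧ P.label (v.get j) τ = P.label o.letter (s.take n) ∧
      ∀ r, P.IsEnd (P.label o.letter (s.take n)) r →
        (Sum.elim f A o : Stream' ℕ → Z) (s.take n ++ₛ r) = g j (τ ++ₛ r)) ?_ (.inl i) s hs
  intro o ih s hs
  have ho1 : ∀ n r, P.IsEnd (P.label o.letter (s.take n)) r → P.IsEnd o.letter (s.take n ++ₛ r) :=
    fun n r hr => isEnd_append.2 ⟨hs n, hr⟩
  rcases ho : D.wire o with j | ⟨t, k⟩
  · refine ⟨0, j, [], trivial, D.letter_inl_eq ho, fun r hr => ?_⟩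
    rw [h1 _ _ (ho1 0 r hr), ho]
    rfl
  · have hlet := D.letter_top_eq ho
    have h3 : ∀ n r, P.IsEnd (P.label o.letter (s.take n)) r →
        (Sum.elim f A o : Stream' ℕ → Z) (s.take n ++ₛ r) = B ⟨t, k⟩ (s.take n ++ₛ r) := by
      intro n r hr
      rw [h1 _ _ (ho1 n r hr), ho]
      rfl
    rw [← hlet] at hs h3 ⊢
    rcases D.mem_rels t with hr | hr
    · obtain ⟨l, h4, h5⟩ := hP.split_end hr k hs
      obtain ⟨n, j, τ, h6, h7, h8⟩ := ih t k ho l s.tail h5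
      have h9 : P.label ((D.top t).get k) (s.take (n + 1)) =
          P.label ((D.bot t).get l) (s.tail.take n) := by
        rw [h4, Stream'.take_succ_cons, label_cons, Stream'.tail_cons]
        have := hP.eq_singleton hr k
        rw [this] at hr
        rw [hP.child_get hr]
      refine ⟨n + 1, j, τ, h6, h7.trans h9.symm, fun r hr' => ?_⟩
      rw [h3 _ _ hr']
      rw [h9] at hr'
      refine Eq.trans ?_ (h8 r hr')
      have h10 := (h2 t).1 hr k l (s.tail.take n ++ₛ r) (isEnd_append.2 ⟨h5 n, hr'⟩)
      refine Eq.trans ?_ h10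
      rw [← Stream'.cons_append_stream, ← Stream'.take_succ_cons, ← h4]
    · obtain ⟨l⟩ : Nonempty (Fin (D.bot t).length) :=
        ⟨⟨0, List.length_pos_iff.2 (P.left_ne_nil _ hr)⟩⟩
      have h4 := hP.merge_end hr l k hs
      obtain ⟨n, j, τ, h6, h7, h8⟩ := ih t k ho l _ h4
      have hs1 := hP.eq_singleton hr l
      have hr1 := hr
      rw [hs1] at hr1
      have h9 : ∀ n, P.label ((D.bot t).get l) ((k.1 ::ₛ s).take (n + 1)) =
          P.label ((D.top t).get k) (s.take n) := by
        intro n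
        rw [Stream'.take_succ_cons, label_cons, hP.child_get hr1]
      have h10 : ∀ n r, P.IsEnd (P.label ((D.top t).get k) (s.take n)) r →
          B ⟨t, k⟩ (s.take n ++ₛ r) = A ⟨t, l⟩ ((k.1 ::ₛ s).take (n + 1) ++ₛ r) := by
        intro n r hr'
        rw [Stream'.take_succ_cons, Stream'.cons_append_stream]
        exact (h2 t).2 hr k l _ (isEnd_append.2 ⟨hs n, hr'⟩)
      rcases n with _ | n
      -- If nothing is replaced below the merge, one letter has to be read before the merge is crossed.
      · refine ⟨0, j, τ ++ [k.1], ?_, ?_, fun r hr' => ?_⟩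
        · rw [addr_append, h7]
          refine ⟨h6, ?_, trivial⟩
          exact (congrArg List.length (hP.children_eq hr1)).symm ▸ k.2
        · rw [label_append, h7, label_cons, label_nil]
          exact hP.child_get hr1 k
        · rw [h3 _ _ hr', h10 0 r hr', Stream'.append_append_stream]
          exact h8 (k.1 ::ₛ r) (hP.merge_end hr l k hr')
      · refine ⟨n, j, τ, h6, h7.trans (h9 n), fun r hr' => ?_⟩
        rw [h3 _ _ hr', h10 n r hr']
        exact h8 r ((h9 n).symm ▸ hr')

end BraidedDiagram

/-! ### Paths that are determined by their ends -/

namespace SemigroupPresentation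

variable {α : Type*} {P : SemigroupPresentation α}

/-- A path whose last step goes from a letter with a relation to one of its children. Other paths from `a`
are prolongations, by zeros, of a path to a letter without relation, and lead to the same end. -/
def Strict (P : SemigroupPresentation α) (a : α) (τ : List ℕ) : Prop :=
  ∀ σ k, τ = σ ++ [k] → ∃ w, ([P.label a σ], w) ∈ P.rels

theorem strict_nil (a : α) : P.Strict a [] := by
  intro σ k h
  simp at h

theorem strict_concat {a : α} {τ : List ℕ} {k : ℕ} (h : ∃ w, ([P.label a τ], w) ∈ P.rels) :
    P.Strict a (τ ++ [k]) := by
  intro σ l hσ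
  obtain ⟨rfl, -⟩ := List.append_inj' hσ rfl
  exact h

theorem label_leaf {a : α} (h : ¬ ∃ w, ([a], w) ∈ P.rels) (τ : List ℕ) : P.label a τ = a := by
  induction τ with
  | nil => rfl
  | cons k τ ih => rw [label_cons, child_leaf h, ih]

/-- Strict paths to the same letter are determined by the ends they lead to. -/
theorem IsTreeLike.addr_eq_of_ends (hP : P.IsTreeLike) {a c : α} {τ ρ : List ℕ}
    (hτ : P.label a τ = c) (hρ : P.label a ρ = c) (h : ∀ s, P.IsEnd c s → τ ++ₛ s = ρ ++ₛ s)
    (hτ' : P.Strict a τ) (hρ' : P.Strict a ρ) : τ = ρ := by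
  wlog hl : τ.length ≤ ρ.length generalizing τ ρ
  · exact (this hρ hτ (fun s hs => (h s hs).symm) hρ' hτ' (by omega)).symm
  obtain ⟨σ, rfl, -⟩ := append_stream_eq_append_stream hl (h _ (isEnd_zero c))
  have h1 : ∀ s, P.IsEnd c s → ∃ t, P.IsEnd c t ∧ s = σ ++ₛ t := by
    intro s hs
    have := h s hs
    rw [Stream'.append_append_stream] at this
    exact ⟨s, hs, (append_stream_injective rfl this).2⟩
  suffices σ = [] by rw [this, List.append_nil]
  by_cases hc : ∃ w, ([c], w) ∈ P.rels
  · exact hP.eq_nil_of_append hc h1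
  · by_contra hσ
    obtain ⟨σ', k, rfl⟩ := (List.eq_nil_or_concat' σ).resolve_left hσ
    refine hc ?_
    have := hρ' (τ ++ σ') k (List.append_assoc _ _ _).symm
    rwa [label_append, hτ, label_leaf hc] at this

end SemigroupPresentation

/-! ### Removal of dipoles -/

namespace BraidedDiagram

variable {α Z : Type*} {P : SemigroupPresentation α} {u v w : List α}

open SemigroupPresentation

theorem bot_pos (D : BraidedDiagram P u v) (t : D.T) : 0 < (D.bot t).length :=
  List.length_pos_iff.2 ((D.mem_rels t).elim (P.right_ne_nil _) (P.left_ne_nil _))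

theorem top_pos (D : BraidedDiagram P u v) (t : D.T) : 0 < (D.top t).length :=
  List.length_pos_iff.2 ((D.mem_rels t).elim (P.left_ne_nil _) (P.right_ne_nil _))

/-- A dipole: the wires at the bottom of `s` are the wires at the top of `t`, in the same order, and the
outer labels of `s` and `t` coincide. -/
structure IsDipole (D : BraidedDiagram P u v) (s t : D.T) : Prop where
  outer : D.top s = D.bot t
  inner : D.bot s = D.top t
  wires : ∀ k, D.wire (.inr ⟨s, k⟩) = .inr ⟨t, Fin.cast (congrArg List.length inner) k⟩

section Remove

variable {D : BraidedDiagram P u v} {s t : D.T}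

theorem IsDipole.above (h : D.IsDipole s t) : D.Above s t := ⟨⟨0, D.bot_pos s⟩, _, h.wires _⟩

theorem IsDipole.wire_symm (h : D.IsDipole s t) (k : Fin (D.top t).length) :
    D.wire (.inr ⟨s, Fin.cast (congrArg List.length h.inner.symm) k⟩) = .inr ⟨t, k⟩ := h.wires _

theorem IsDipole.ne (h : D.IsDipole s t) : s ≠ t := by
  rintro rfl
  exact D.acyclic _ (.single h.above)

/-- The transistors other than those of a dipole. -/
abbrev Rest (s t : D.T) := {r : D.T // r ≠ s ∧ r ≠ t}

/-- A contact at a remaining transistor, as a contact of the whole diagram. -/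
abbrev restIncl {x : List α} {a : D.T → List α} (s t : D.T)
    (p : Port x (fun r : Rest s t => a r.1)) : Port x a := p.map Subtype.val fun _ => rfl

theorem restIncl_injective {x : List α} {a : D.T → List α} :
    Function.Injective (restIncl (x := x) (a := a) s t) := by
  rintro (i | ⟨⟨r, hr⟩, k⟩) (j | ⟨⟨r', hr'⟩, k'⟩) h
  · cases h; rfl
  · cases h
  · cases h
  · obtain rfl : r = r' := congrArg Sigma.fst (Sum.inr_injective h)
    have := eq_of_heq (Sigma.mk.inj (Sum.inr_injective h)).2
    obtain rfl : k = k' := Fin.ext (congrArg (fun i : Fin (a r).length => i.1) this)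
    rfl

theorem restIncl_ne_left {x : List α} {a : D.T → List α} (p : Port x (fun r : Rest s t => a r.1))
    (k) : restIncl s t p ≠ .inr ⟨s, k⟩ := by
  rcases p with i | ⟨r, l⟩ <;> intro h
  · cases h
  · exact r.2.1 (congrArg Sigma.fst (Sum.inr_injective h))

theorem restIncl_ne_right {x : List α} {a : D.T → List α} (p : Port x (fun r : Rest s t => a r.1))
    (k) : restIncl s t p ≠ .inr ⟨t, k⟩ := by
  rcases p with i | ⟨r, l⟩ <;> intro h
  · cases h
  · exact r.2.2 (congrArg Sigma.fst (Sum.inr_injective h))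

theorem exists_restIncl {x : List α} {a : D.T → List α} (p : Port x a)
    (hs : ∀ k, p ≠ .inr ⟨s, k⟩) (ht : ∀ k, p ≠ .inr ⟨t, k⟩) : ∃ q, restIncl s t q = p := by
  rcases p with i | ⟨r, l⟩
  · exact ⟨.inl i, rfl⟩
  · refine ⟨.inr ⟨⟨r, ?_, ?_⟩, l⟩, rfl⟩
    · rintro rfl
      exact hs l rfl
    · rintro rfl
      exact ht l rfl

/-- The wires after the removal of a dipole: those that avoid it, and those glued from a wire on top of `s`
and the corresponding wire on the bottom of `t`. -/
def IsDipole.Joined (h : D.IsDipole s t) (o : Port u (fun r : Rest s t => D.bot r.1))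
    (p : Port v (fun r : Rest s t => D.top r.1)) : Prop :=
  D.wire (restIncl s t o) = restIncl s t p ∨ ∃ k, D.wire (restIncl s t o) = .inr ⟨s, k⟩ ∧
    D.wire (.inr ⟨t, Fin.cast (congrArg List.length h.outer) k⟩) = restIncl s t p

theorem IsDipole.joined_right_unique (h : D.IsDipole s t) {o p p'} (hp : h.Joined o p)
    (hp' : h.Joined o p') : p = p' := by
  rcases hp with hp | ⟨k, h1, h2⟩ <;> rcases hp' with hp' | ⟨k', h1', h2'⟩
  · exact restIncl_injective (hp.symm.trans hp')
  · exact absurd (hp.symm.trans h1') (restIncl_ne_left _ _)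
  · exact absurd (hp'.symm.trans h1) (restIncl_ne_left _ _)
  · have := h1.symm.trans h1'
    cases this
    exact restIncl_injective (h2.symm.trans h2')

theorem IsDipole.joined_left_unique (h : D.IsDipole s t) {o o' p} (hp : h.Joined o p)
    (hp' : h.Joined o' p) : o = o' := by
  rcases hp with hp | ⟨k, h1, h2⟩ <;> rcases hp' with hp' | ⟨k', h1', h2'⟩
  · exact restIncl_injective (D.bijective.1 (hp.trans hp'.symm))
  · exact absurd (D.bijective.1 (hp.trans h2'.symm)) (restIncl_ne_right _ _)
  · exact absurd (D.bijective.1 (hp'.trans h2.symm)) (restIncl_ne_right _ _)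
  · have := D.bijective.1 (h2.trans h2'.symm)
    have hk : k = k' := by
      have := eq_of_heq (Sigma.mk.inj (Sum.inr_injective this)).2
      exact Fin.ext (congrArg (fun i : Fin _ => i.1) this :)
    subst hk
    exact restIncl_injective (D.bijective.1 (h1.trans h1'.symm))

theorem IsDipole.exists_joined (h : D.IsDipole s t) (o) : ∃ p, h.Joined o p := by
  have ht : ∀ k, D.wire (restIncl s t o) ≠ .inr ⟨t, k⟩ := by
    intro k hk
    rw [← h.wire_symm k] at hk
    exact restIncl_ne_left _ _ (D.bijective.1 hk)
  by_cases hs : ∃ k, D.wire (restIncl s t o) = .inr ⟨s, k⟩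
  · obtain ⟨k, hk⟩ := hs
    obtain ⟨p, hp⟩ := exists_restIncl (s := s) (t := t)
      (D.wire (.inr ⟨t, Fin.cast (congrArg List.length h.outer) k⟩))
      (fun l hl => D.acyclic t (.tail (.single ⟨_, l, hl⟩) h.above))
      (fun l hl => D.acyclic t (.single ⟨_, l, hl⟩))
    exact ⟨p, .inr ⟨k, hk, hp.symm⟩⟩
  · push Not at hs
    obtain ⟨p, hp⟩ := exists_restIncl _ hs ht
    exact ⟨p, .inl hp.symm⟩

theorem IsDipole.exists_joined' (h : D.IsDipole s t) (p) : ∃ o, h.Joined o p := by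
  obtain ⟨o, ho⟩ := D.bijective.2 (restIncl s t p)
  have hs : ∀ k, o ≠ .inr ⟨s, k⟩ := by
    rintro k rfl
    rw [h.wires] at ho
    exact restIncl_ne_right _ _ ho.symm
  by_cases ht : ∃ k, o = .inr ⟨t, k⟩
  · obtain ⟨k, rfl⟩ := ht
    obtain ⟨o', ho'⟩ := D.bijective.2
      (.inr ⟨s, Fin.cast (congrArg List.length h.outer.symm) k⟩)
    obtain ⟨q, hq⟩ := exists_restIncl (s := s) (t := t) o'
      (by rintro l rfl; exact D.acyclic s (.single ⟨_, _, ho'⟩))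
      (by rintro l rfl; exact D.acyclic t (.tail (.single ⟨_, _, ho'⟩) h.above))
    exact ⟨q, .inr ⟨_, (congrArg D.wire hq).trans ho', ho⟩⟩
  · push Not at ht
    obtain ⟨q, hq⟩ := exists_restIncl _ hs ht
    exact ⟨q, .inl ((congrArg D.wire hq).trans ho)⟩

/-- The diagram without the transistors of a dipole. -/
noncomputable def remove (h : D.IsDipole s t) : BraidedDiagram P u v where
  T := Rest s t
  finite := by
    have := D.finite
    infer_instance
  top r := D.top r.1
  bot r := D.bot r.1
  mem_rels r := D.mem_rels r.1
  wire o := (h.exists_joined o).choose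
  bijective := by
    constructor
    · intro o o' ho
      refine h.joined_left_unique (h.exists_joined o).choose_spec ?_
      exact Eq.subst (motive := h.Joined o') ho.symm (h.exists_joined o').choose_spec
    · intro p
      obtain ⟨o, ho⟩ := h.exists_joined' p
      exact ⟨o, h.joined_right_unique (h.exists_joined o).choose_spec ho⟩
  letter_wire o := by
    refine (letter_map Subtype.val (a' := D.top) (fun _ => rfl) _).symm.trans
      (Eq.trans ?_ (letter_map Subtype.val (a' := D.bot) (fun _ => rfl) o))
    rcases (h.exists_joined o).choose_spec with h1 | ⟨k, h1, h2⟩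
    · exact (congrArg Port.letter h1).symm.trans (D.letter_wire _)
    · refine (congrArg Port.letter h2).symm.trans ((D.letter_wire _).trans (Eq.trans ?_
        ((congrArg Port.letter h1).symm.trans (D.letter_wire _))))
      simp only [Port.letter, List.get_eq_getElem, Fin.val_cast]
      exact (List.getElem_of_eq h.outer _).symm
  acyclic r hr := by
    have key : ∀ r r' : Rest s t, (∃ k l, (h.exists_joined (.inr ⟨r, k⟩)).choose = .inr ⟨r', l⟩) →
        Relation.TransGen D.Above r.1 r'.1 := by
      rintro r r' ⟨k, l, hl⟩
      have h1 := (h.exists_joined (.inr ⟨r, k⟩)).choose_spec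
      rw [hl] at h1
      rcases h1 with h1 | ⟨m, h1, h2⟩
      · exact .single ⟨k, l, h1⟩
      · exact .tail (.tail (.single ⟨k, m, h1⟩) h.above) ⟨_, l, h2⟩
    have key' : ∀ r', Relation.TransGen (fun r r' : Rest s t =>
        ∃ k l, (h.exists_joined (.inr ⟨r, k⟩)).choose = .inr ⟨r', l⟩) r r' →
        Relation.TransGen D.Above r.1 r'.1 := by
      intro r' hr
      induction hr with
      | single h => exact key _ _ h
      | tail _ h ih => exact ih.trans (key _ _ h)
    exact D.acyclic r.1 (key' r hr)

theorem reduces_remove (h : D.IsDipole s t) : Reduces D (remove h) := by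
  refine ⟨s, t, h.outer, h.inner, Subtype.val, fun _ => rfl, fun _ => rfl, h.ne, h.wires,
    Subtype.val_injective, ?_, fun o => (h.exists_joined o).choose_spec⟩
  refine Subtype.range_val.trans ?_
  ext r
  change (r ≠ s ∧ r ≠ t) ↔ _
  simp

theorem card_remove (h : D.IsDipole s t) : Nat.card (remove h).T < Nat.card D.T := by
  have := D.finite
  exact Finite.card_subtype_lt (x := s) fun h' => h'.1 rfl

end Remove

/-! ### Diagrams with trivial transport -/

section Address

variable (D : BraidedDiagram P u v)

/-- A transistor whose top word splits into its bottom word. -/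
def IsSplit (t : D.T) : Prop := (D.top t, D.bot t) ∈ P.rels

/-- A transistor whose top word is merged into its bottom word. -/
def IsMerge (t : D.T) : Prop := (D.bot t, D.top t) ∈ P.rels

/-- The wire from the contact `o` is reached from the `i`-th contact on the top of the frame by
following the path `τ` through splits. -/
inductive TopAddr : Port u D.bot → Fin u.length → List ℕ → Prop
  | frame (i) : TopAddr (.inl i) i []
  | split {o i τ t k} (l) : TopAddr o i τ → D.wire o = .inr ⟨t, k⟩ → D.IsSplit t →
      TopAddr (.inr ⟨t, l⟩) i (τ ++ [l.1])

/-- The wire from the contact `o` leads, through merges, to the `j`-th contact on the bottom of the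
frame, and `τ` is the path back from there. -/
inductive BotAddr : Port u D.bot → Fin v.length → List ℕ → Prop
  | frame {o j} : D.wire o = .inl j → BotAddr o j []
  | merge {o j τ t k} (l) : D.wire o = .inr ⟨t, k⟩ → D.IsMerge t → BotAddr (.inr ⟨t, l⟩) j τ →
      BotAddr o j (τ ++ [k.1])

variable {D}

/-- The function at a contact with an address is the function on the frame, restricted to the ends that
start with this address. -/
theorem TopAddr.spec (hP : P.IsTreeLike) {f : Fin u.length → Stream' ℕ → Z}
    {g : Fin v.length → Stream' ℕ → Z} {A B}
    (hw : ∀ (o : Port u D.bot) s, P.IsEnd o.letter s → (Sum.elim f A o : Stream' ℕ → Z) s =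
      (Sum.elim g B (D.wire o) : Stream' ℕ → Z) s)
    (hc : ∀ t, P.Compat (fun k => B ⟨t, k⟩) (fun l => A ⟨t, l⟩)) {o i τ} (h : D.TopAddr o i τ) :
    P.Addr (u.get i) τ ∧ P.label (u.get i) τ = o.letter ∧ P.Strict (u.get i) τ ∧
      ∀ s, P.IsEnd o.letter s → f i (τ ++ₛ s) = (Sum.elim f A o : Stream' ℕ → Z) s := by
  induction h with
  | frame i => exact ⟨trivial, rfl, strict_nil _, fun s _ => rfl⟩
  | @split o i τ t k l h ho ht ih =>
    obtain ⟨ih1, ih2, -, ih3⟩ := ih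
    have hlet := D.letter_top_eq ho
    have ht1 := ht
    rw [IsSplit, hP.eq_singleton ht k, hlet] at ht1
    have hch := hP.children_eq ht1
    refine ⟨addr_append.2 ⟨ih1, ?_, trivial⟩, ?_, strict_concat ⟨_, ih2.symm ▸ ht1⟩, fun s hs => ?_⟩
    · rw [ih2, hch]
      exact l.2
    · rw [label_append, ih2]
      exact hP.child_get ht1 l
    · have hs' : P.IsEnd o.letter (l.1 ::ₛ s) := by
        rw [← hlet]
        exact hP.merge_end ht k l hs
      rw [Stream'.append_append_stream]
      refine (ih3 _ hs').trans ?_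
      rw [hw _ _ hs', ho]
      exact (hc t).1 ht k l s hs

/-- The function at a contact with an address is the function on the frame, restricted to the ends that
start with this address. -/
theorem BotAddr.spec (hP : P.IsTreeLike) {f : Fin u.length → Stream' ℕ → Z}
    {g : Fin v.length → Stream' ℕ → Z} {A B}
    (hw : ∀ (o : Port u D.bot) s, P.IsEnd o.letter s → (Sum.elim f A o : Stream' ℕ → Z) s =
      (Sum.elim g B (D.wire o) : Stream' ℕ → Z) s)
    (hc : ∀ t, P.Compat (fun k => B ⟨t, k⟩) (fun l => A ⟨t, l⟩)) {o j τ} (h : D.BotAddr o j τ) :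
    P.Addr (v.get j) τ ∧ P.label (v.get j) τ = o.letter ∧ P.Strict (v.get j) τ ∧
      ∀ s, P.IsEnd o.letter s → g j (τ ++ₛ s) = (Sum.elim f A o : Stream' ℕ → Z) s := by
  induction h with
  | @frame o j h =>
    refine ⟨trivial, D.letter_inl_eq h, strict_nil _, fun s hs => ?_⟩
    rw [hw o s hs, h]
    rfl
  | @merge o j τ t k l ho ht h ih =>
    obtain ⟨ih1, ih2, -, ih3⟩ := ih
    have hlet := D.letter_top_eq ho
    have ht1 := ht
    rw [IsMerge, hP.eq_singleton ht l] at ht1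
    have hch := hP.children_eq ht1
    refine ⟨addr_append.2 ⟨ih1, ?_, trivial⟩, ?_,
      strict_concat ⟨D.top t, by rw [ih2]; exact ht1⟩, fun s hs => ?_⟩
    · rw [ih2]
      exact hch.symm ▸ k.2
    · rw [label_append, ih2, ← hlet]
      exact hP.child_get ht1 k
    · have hs' : P.IsEnd ((D.bot t).get l) (k.1 ::ₛ s) :=
        hP.merge_end ht l k (by rwa [hlet])
      rw [Stream'.append_append_stream]
      refine (ih3 _ hs').trans ?_
      rw [hw _ _ hs, ho]
      exact ((hc t).2 ht k l s (by rwa [hlet])).symm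

/-- Distinct wires have distinct addresses. -/
theorem BotAddr.unique {o j τ} (h : D.BotAddr o j τ) :
    ∀ {o'}, D.BotAddr o' j τ → o = o' := by
  induction h with
  | @frame o j h =>
    intro o' h'
    generalize hρ : [] = ρ at h'
    rcases h' with h' | _
    · exact D.bijective.1 (h.trans h'.symm)
    · simp at hρ
  | @merge o j τ t k l ho ht h ih =>
    intro o' h'
    generalize hρ : τ ++ [k.1] = ρ at h'
    rcases h' with h' | @⟨_, _, τ', t', k', l', ho', ht', h'⟩
    · simp at hρ
    · obtain ⟨rfl, hk⟩ := List.append_inj' hρ rfl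
      have := ih h'
      cases this
      have hk' : k = k' := Fin.ext (by simpa using hk)
      subst hk'
      exact D.bijective.1 (ho.trans ho'.symm)

theorem isSplit_or_isMerge (t : D.T) : D.IsSplit t ∨ D.IsMerge t := D.mem_rels t

/-- A merge directly above a split forms a dipole with it. -/
theorem isDipole_of_merge_of_split (hP : P.IsTreeLike) {s t : D.T} (h : D.Above s t)
    (hs : D.IsMerge s) (ht : D.IsSplit t) : D.IsDipole s t := by
  obtain ⟨k, l, hkl⟩ := h
  have h1 := D.letter_top_eq hkl
  have hs1 := hP.eq_singleton hs k
  have ht1 := hP.eq_singleton ht l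
  have hin : D.bot s = D.top t := by
    rw [hs1, ht1, h1]
    rfl
  have hout : D.top s = D.bot t := by
    have hs2 := hs
    rw [IsMerge, hin, ht1] at hs2
    have ht2 := ht
    rw [IsSplit, ht1] at ht2
    exact hP.right_unique _ _ _ hs2 ht2
  refine ⟨hout, hin, fun k' => ?_⟩
  have hl1 := hP.length_left _ hs
  have hl2 := hP.length_left _ ht
  simp only at hl1 hl2
  have hk : k' = k := Fin.ext (by omega)
  have hl : Fin.cast (congrArg List.length hin) k' = l :=
    Fin.ext (by have := k'.2; have := l.2; simp only [Fin.val_cast]; omega)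
  rw [hl, hk, hkl]

/-- Without dipoles, everything above a split is a split, so the top of a split has an address. -/
theorem exists_topAddr (hP : P.IsTreeLike) (hD : ∀ s t, ¬ D.IsDipole s t) (t : D.T)
    (ht : D.IsSplit t) :
    ∃ o k i τ, D.wire o = .inr ⟨t, k⟩ ∧ D.TopAddr o i τ := by
  induction t using D.wellFounded_above.induction with
  | _ t ih =>
    obtain ⟨o, ho⟩ := D.bijective.2 (.inr ⟨t, ⟨0, D.top_pos t⟩⟩)
    rcases o with i | ⟨s, k⟩
    · exact ⟨_, _, i, [], ho, .frame i⟩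
    · have hst : D.Above s t := ⟨_, _, ho⟩
      have hs : D.IsSplit s := (isSplit_or_isMerge s).resolve_right fun hs =>
        hD s t (isDipole_of_merge_of_split hP hst hs ht)
      obtain ⟨o', k', i, τ, ho', h⟩ := ih s hst hs
      exact ⟨_, _, i, _, ho, .split k h ho' hs⟩

/-- Without dipoles, everything below a merge is a merge, so the bottom of a merge has an address. -/
theorem exists_botAddr (hP : P.IsTreeLike) (hD : ∀ s t, ¬ D.IsDipole s t) (t : D.T)
    (ht : D.IsMerge t) (l : Fin (D.bot t).length) : ∃ j τ, D.BotAddr (.inr ⟨t, l⟩) j τ := by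
  induction t using D.wellFounded_below.induction with
  | _ t ih =>
    rcases ho : D.wire (.inr ⟨t, l⟩) with j | ⟨s, k⟩
    · exact ⟨j, [], .frame ho⟩
    · have hts : D.Above t s := ⟨_, _, ho⟩
      have hs : D.IsMerge s := (isSplit_or_isMerge s).resolve_left fun hs =>
        hD t s (isDipole_of_merge_of_split hP hts ht hs)
      obtain ⟨j, τ, h⟩ := ih s hts hs ⟨0, D.bot_pos s⟩
      exact ⟨j, _, .merge _ ho hs h⟩

/-- In a diagram without dipoles that transports the ends to themselves there is no split: the wires
at the bottom of a lowest split would all lead to the corresponding contacts of one merge, which would form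
a dipole with the split. -/
theorem not_isSplit (hP : P.IsTreeLike) {D : BraidedDiagram P u u} (hD : ∀ s t, ¬ D.IsDipole s t)
    (h : D.Transports (fun i s => (i, s)) (fun i s => (i, s))) (t : D.T) : ¬ D.IsSplit t := by
  intro ht
  obtain ⟨A, B, hw, hc⟩ := h
  obtain ⟨t, ht, hmin⟩ := D.wellFounded_below.has_min {t | D.IsSplit t} ⟨t, ht⟩
  obtain ⟨o, k₀, i, τ, ho₀, htop₀⟩ := exists_topAddr hP hD t ht
  have htop : ∀ l : Fin (D.bot t).length, D.TopAddr (.inr ⟨t, l⟩) i (τ ++ [l.1]) :=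
    fun l => .split l htop₀ ho₀ ht
  -- As the ends are transported to themselves, the two addresses of a wire coincide.
  have key : ∀ l : Fin (D.bot t).length, D.BotAddr (.inr ⟨t, l⟩) i (τ ++ [l.1]) := by
    intro l
    obtain ⟨j, ρ, hb⟩ : ∃ j ρ, D.BotAddr (.inr ⟨t, l⟩) j ρ := by
      rcases ho : D.wire (.inr ⟨t, l⟩) with j | ⟨s, k⟩
      · exact ⟨j, [], .frame ho⟩
      · have hs : D.IsMerge s := (isSplit_or_isMerge s).resolve_left fun hs => hmin s hs ⟨_, _, ho⟩
        obtain ⟨j, ρ, hb⟩ := exists_botAddr hP hD s hs ⟨0, D.bot_pos s⟩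
        exact ⟨j, _, .merge _ ho hs hb⟩
    obtain ⟨-, h1, h2, h3⟩ := (htop l).spec hP hw hc
    obtain ⟨-, h1', h2', h3'⟩ := hb.spec hP hw hc
    have h4 := fun s hs => (h3 s hs).trans (h3' s hs).symm
    obtain rfl : i = j := congrArg Prod.fst (h4 _ (isEnd_zero _))
    have h5 := hP.addr_eq_of_ends h1 h1' (fun s hs => congrArg Prod.snd (h4 s hs)) h2 h2'
    exact h5 ▸ hb
  have hpred : ∀ l : Fin (D.bot t).length, ∃ s k l', D.wire (.inr ⟨t, l⟩) = .inr ⟨s, k⟩ ∧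
      D.IsMerge s ∧ k.1 = l.1 ∧ D.BotAddr (.inr ⟨s, l'⟩) i τ := by
    intro l
    have hb := key l
    generalize hρ : τ ++ [l.1] = ρ at hb
    rcases hb with hb | @⟨_, _, τ', s, k, l', ho, hs, hb⟩
    · simp at hρ
    · obtain ⟨rfl, hk⟩ := List.append_inj' hρ rfl
      exact ⟨s, k, l', ho, hs, by simpa using hk.symm, hb⟩
  -- The merges below the wires all have the address `τ` at the bottom, so they are equal.
  obtain ⟨s, k, l', ho, hs, -, hb⟩ := hpred ⟨0, D.bot_pos t⟩
  have hall : ∀ l : Fin (D.bot t).length, ∃ k, D.wire (.inr ⟨t, l⟩) = .inr ⟨s, k⟩ ∧ k.1 = l.1 := by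
    intro l
    obtain ⟨s₁, k₁, l₁, ho₁, hs₁, hk₁, hb₁⟩ := hpred l
    cases hb.unique hb₁
    exact ⟨k₁, ho₁, hk₁⟩
  have hout : D.top t = D.bot s := by
    obtain ⟨-, h1, -, -⟩ := htop₀.spec hP hw hc
    obtain ⟨-, h2, -, -⟩ := hb.spec hP hw hc
    rw [hP.eq_singleton ht k₀, hP.eq_singleton hs l', D.letter_top_eq ho₀, ← h1, h2]
    rfl
  have hin : D.bot t = D.top s := by
    have ht1 : (D.top t, D.bot t) ∈ P.rels := ht
    have hs1 : (D.bot s, D.top s) ∈ P.rels := hs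
    rw [← hout] at hs1
    rw [hP.eq_singleton ht k₀] at ht1 hs1
    exact hP.right_unique _ _ _ ht1 hs1
  refine hD t s ⟨hout, hin, fun l => ?_⟩
  obtain ⟨k, h1, h2⟩ := hall l
  rw [h1]
  congr 2
  exact Fin.ext h2

/-- In a diagram without dipoles that transports the ends to themselves there is no merge either: the wires on
top of a highest merge start on the frame, so they would have an empty and a nonempty address. -/
theorem isEmpty_of_transports (hP : P.IsTreeLike) {D : BraidedDiagram P u u}
    (hD : ∀ s t, ¬ D.IsDipole s t)
    (h : D.Transports (fun i s => (i, s)) (fun i s => (i, s))) : IsEmpty D.T := by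
  have hsplit := not_isSplit hP hD h
  by_contra hne
  rw [not_isEmpty_iff] at hne
  obtain ⟨A, B, hw, hc⟩ := h
  obtain ⟨t, -, hmin⟩ := D.wellFounded_above.has_min Set.univ (Set.univ_nonempty)
  have ht := (isSplit_or_isMerge t).resolve_left (hsplit t)
  obtain ⟨o, ho⟩ := D.bijective.2 (.inr ⟨t, ⟨0, D.top_pos t⟩⟩)
  rcases o with i | ⟨s, k⟩
  · obtain ⟨j, τ, hb⟩ := exists_botAddr hP hD t ht ⟨0, D.bot_pos t⟩
    obtain ⟨-, h1, h2, h3⟩ := (TopAddr.frame (D := D) i).spec hP hw hc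
    obtain ⟨-, h1', h2', h3'⟩ := (BotAddr.merge _ ho ht hb).spec hP hw hc
    have h4 := fun s hs => (h3 s hs).trans (h3' s hs).symm
    obtain rfl : i = j := congrArg Prod.fst (h4 _ (isEnd_zero _))
    have h5 := hP.addr_eq_of_ends h1 h1' (fun s hs => congrArg Prod.snd (h4 s hs)) h2 h2'
    simp at h5
  · exact hmin s trivial ⟨_, _, ho⟩

/-- A diagram that transports the ends to themselves is trivial up to dipoles. -/
theorem rel_id_of_transports (hP : P.IsTreeLike) (D : BraidedDiagram P u u)
    (h : D.Transports (fun i s => (i, s)) (fun i s => (i, s))) :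
    dipoleSetoid P u u D (idDiagram P u) := by
  induction hn : Nat.card D.T using Nat.strong_induction_on generalizing D with
  | _ n ih =>
    by_cases hD : ∃ s t, D.IsDipole s t
    · obtain ⟨s, t, hst⟩ := hD
      exact .trans _ _ _ (.rel _ _ (.inr (reduces_remove hst)))
        (ih _ (hn ▸ card_remove hst) _ (h.reduces hP (reduces_remove hst)) rfl)
    · push Not at hD
      have hT := isEmpty_of_transports hP hD h
      refine .rel _ _ (.inl ⟨Equiv.equivOfIsEmpty D.T Empty, fun t => hT.elim t,
        fun t => hT.elim t, ?_⟩)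
      rintro (i | ⟨t, k⟩)
      · rcases ho : D.wire (.inl i) with j | ⟨t, k⟩
        · obtain ⟨A, B, hw, hc⟩ := h
          have h1 := hw (.inl i) _ (isEnd_zero _)
          rw [ho] at h1
          obtain rfl : i = j := congrArg Prod.fst h1
          rfl
        · exact (hT.false t).elim
      · exact (hT.false t).elim

end Address

end BraidedDiagram

/-! ### Covers of the space of ends by paths -/

namespace SemigroupPresentation

variable {α : Type*} {P : SemigroupPresentation α}

theorem take_append_stream {n : ℕ} {τ : List ℕ} {s : Stream' ℕ} (h : n ≤ τ.length) :
    (τ ++ₛ s).take n = τ.take n := Stream'.take_append_of_le_length _ _ _ h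

/-- The stream `s` starts with the word `τ`. -/
def StartsWith (s : Stream' ℕ) (τ : List ℕ) : Prop := s.take τ.length = τ

instance (s : Stream' ℕ) : DecidablePred (StartsWith s) := fun τ =>
  inferInstanceAs (Decidable (s.take τ.length = τ))

theorem StartsWith.append_drop {s : Stream' ℕ} {τ : List ℕ} (h : StartsWith s τ) :
    τ ++ₛ s.drop τ.length = s := by
  conv_rhs => rw [← Stream'.append_take_drop τ.length s, h]

theorem startsWith_iff {s : Stream' ℕ} {τ : List ℕ} : StartsWith s τ ↔ ∃ r, s = τ ++ₛ r := by
  constructor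
  · intro h
    exact ⟨s.drop τ.length, h.append_drop.symm⟩
  · rintro ⟨r, rfl⟩
    rw [StartsWith, take_append_stream le_rfl, List.take_length]

theorem startsWith_append (τ : List ℕ) (r : Stream' ℕ) : StartsWith (τ ++ₛ r) τ :=
  startsWith_iff.2 ⟨r, rfl⟩

theorem startsWith_take (s : Stream' ℕ) (n : ℕ) : StartsWith s (s.take n) := by
  rw [StartsWith, Stream'.length_take]

theorem StartsWith.get {s : Stream' ℕ} {τ : List ℕ} {k : ℕ} (h : StartsWith s (τ ++ [k])) :
    s.get τ.length = k := by
  rw [StartsWith, List.length_append, List.length_singleton, Stream'.take_succ'] at h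
  have := (List.append_inj' h rfl).2
  simpa using this

theorem startsWith_concat {s : Stream' ℕ} {τ : List ℕ} {k : ℕ} :
    StartsWith s (τ ++ [k]) ↔ StartsWith s τ ∧ s.get τ.length = k := by
  constructor
  · intro h
    refine ⟨?_, h.get⟩
    obtain ⟨r, rfl⟩ := startsWith_iff.1 h
    rw [Stream'.append_append_stream]
    exact startsWith_append _ _
  · rintro ⟨h1, h2⟩
    rw [StartsWith, List.length_append, List.length_singleton, Stream'.take_succ', h1, h2]

/-- The paths one step longer than `τ`. -/
noncomputable def childAddrs (P : SemigroupPresentation α) (x : α) (τ : List ℕ) : List (List ℕ) :=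
  (List.range (P.children (P.label x τ)).length).map fun k => τ ++ [k]

theorem mem_childAddrs {x : α} {τ σ : List ℕ} :
    σ ∈ P.childAddrs x τ ↔ ∃ k < (P.children (P.label x τ)).length, σ = τ ++ [k] := by
  simp [childAddrs, eq_comm]

theorem countP_childAddrs {x : α} {τ : List ℕ} {s : Stream' ℕ} (hs : P.IsEnd x s) :
    (P.childAddrs x τ).countP (StartsWith s) = if StartsWith s τ then 1 else 0 := by
  split_ifs with h
  · rw [childAddrs, List.countP_map]
    have h1 : s.get τ.length < (P.children (P.label x τ)).length := by
      have := hs (τ.length + 1)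
      rw [Stream'.take_succ', h, addr_append] at this
      exact this.2.1
    rw [← List.count_eq_one_of_mem List.nodup_range (List.mem_range.2 h1), List.count]
    refine List.countP_congr fun k _ => ?_
    simp only [Function.comp_apply, startsWith_concat, h, true_and, decide_eq_true_eq, beq_iff_eq]
    exact eq_comm
  · rw [List.countP_eq_zero]
    intro σ hσ
    obtain ⟨k, -, rfl⟩ := mem_childAddrs.1 hσ
    simp [startsWith_concat, h]

/-- A list of paths from `x` such that every end starts with exactly one entry. -/
def Cover (P : SemigroupPresentation α) (x : α) (L : List (List ℕ)) : Prop :=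
  (∀ τ ∈ L, P.Addr x τ) ∧ ∀ s, P.IsEnd x s → L.countP (StartsWith s) = 1

variable {x : α} {L L' R : List (List ℕ)} {τ : List ℕ}

theorem cover_nil : P.Cover x [[]] := by
  refine ⟨by simp, fun s _ => ?_⟩
  have : StartsWith s [] := rfl
  simp [this]

theorem Cover.perm (h : P.Cover x L) (hL : L.Perm L') : P.Cover x L' :=
  ⟨fun τ hτ => h.1 τ (hL.mem_iff.2 hτ), fun s hs => hL.countP_eq _ ▸ h.2 s hs⟩

/-- An entry of a cover may be replaced by its children, and conversely. -/
theorem cover_childAddrs : P.Cover x (P.childAddrs x τ ++ R) ↔ P.Cover x (τ :: R) := by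
  have h1 : (∀ σ ∈ P.childAddrs x τ ++ R, P.Addr x σ) ↔ ∀ σ ∈ τ :: R, P.Addr x σ := by
    rw [List.forall_mem_append, List.forall_mem_cons]
    refine and_congr_left fun _ => ⟨fun h => ?_, fun h σ hσ => ?_⟩
    · exact (addr_append.1 (h _ (mem_childAddrs.2 ⟨0, children_pos _, rfl⟩))).1
    · obtain ⟨k, hk, rfl⟩ := mem_childAddrs.1 hσ
      exact addr_append.2 ⟨h, hk, trivial⟩
  refine and_congr h1 (forall₂_congr fun s hs => ?_)
  rw [List.countP_append, countP_childAddrs hs, List.countP_cons, add_comm]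
  simp

theorem Cover.exists_mem (h : P.Cover x L) {s : Stream' ℕ} (hs : P.IsEnd x s) :
    ∃ τ ∈ L, StartsWith s τ := by
  have := h.2 s hs
  obtain ⟨τ, h1, h2⟩ := List.countP_pos_iff.1 (this ▸ one_pos)
  exact ⟨τ, h1, by simpa using h2⟩

theorem Cover.unique (h : P.Cover x L) {s : Stream' ℕ} (hs : P.IsEnd x s) {σ : List ℕ} (hτ : τ ∈ L)
    (hσ : σ ∈ L) (hsτ : StartsWith s τ) (hsσ : StartsWith s σ) : τ = σ := by
  have := h.2 s hs
  rw [List.countP_eq_length_filter, List.length_eq_one_iff] at this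
  obtain ⟨ρ, hρ⟩ := this
  have key : ∀ σ ∈ L, StartsWith s σ → σ = ρ := by
    intro σ h1 h2
    have : σ ∈ L.filter (StartsWith s) := List.mem_filter.2 ⟨h1, by simpa using h2⟩
    rwa [hρ, List.mem_singleton] at this
  rw [key _ hτ hsτ, key _ hσ hsσ]

theorem isEnd_append_zero (h : P.Addr x τ) : P.IsEnd x (τ ++ₛ Stream'.const 0) :=
  isEnd_append.2 ⟨h, isEnd_zero _⟩

theorem Cover.nodup (h : P.Cover x L) : L.Nodup := by
  rw [List.nodup_iff_count_le_one]
  intro τ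
  by_cases hτ : τ ∈ L
  · rw [← h.2 _ (isEnd_append_zero (h.1 τ hτ)), List.count]
    refine List.countP_mono_left fun σ _ hσ => ?_
    have : σ = τ := by simpa using hσ
    subst this
    simpa using startsWith_append _ _
  · rw [List.count_eq_zero.2 hτ]
    exact zero_le_one

/-- The siblings of a longest entry of a cover are entries as well. -/
theorem Cover.exists_siblings (h : P.Cover x L) {ρ : List ℕ} {k : ℕ} (hρ : ρ ++ [k] ∈ L)
    (hmax : ∀ σ ∈ L, σ.length ≤ ρ.length + 1) : ∃ R, L.Perm (P.childAddrs x ρ ++ R) := by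
  have hsub : P.childAddrs x ρ ⊆ L := by
    intro σ hσ
    obtain ⟨l, hl, rfl⟩ := mem_childAddrs.1 hσ
    have ha := h.1 _ hρ
    have hl' : P.Addr x (ρ ++ [l]) := addr_append.2 ⟨(addr_append.1 ha).1, hl, trivial⟩
    obtain ⟨π, h1, h2⟩ := h.exists_mem (isEnd_append_zero hl')
    have hlen := hmax π h1
    rcases hlen.eq_or_lt with hlen | hlen
    · rw [StartsWith, hlen, take_append_stream (by simp),
        List.take_of_length_le (by simp)] at h2
      exact h2 ▸ h1
    · exfalso
      rw [StartsWith, Stream'.append_append_stream, take_append_stream (by omega)]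
        at h2
      have h3 : StartsWith (ρ ++ [k] ++ₛ Stream'.const 0) π := by
        rw [StartsWith, Stream'.append_append_stream, take_append_stream (by omega)]
        exact h2
      have := h.unique (isEnd_append_zero ha) hρ h1 (startsWith_append _ _) h3
      rw [← this] at hlen
      simp at hlen
  have hnd : (P.childAddrs x ρ).Nodup :=
    List.nodup_range.map fun k l hkl => by simpa using hkl
  obtain ⟨l, hl, hl'⟩ := List.subperm_of_subset hnd hsub
  obtain ⟨R, hR⟩ := hl'.exists_perm_append
  exact ⟨R, hR.trans (hl.append_right R)⟩

/-- A cover is obtained from the trivial one by replacing entries by their children. Conversely, a longest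
entry and its siblings may be merged, which decreases the total length. -/
theorem Cover.induction {Q : List (List ℕ) → Prop} (nil : Q [[]])
    (split : ∀ τ R, P.Cover x (τ :: R) → Q (τ :: R) → Q (P.childAddrs x τ ++ R))
    (perm : ∀ L L', P.Cover x L → L.Perm L' → Q L → Q L') (h : P.Cover x L) : Q L := by
  induction hn : (L.map List.length).sum using Nat.strong_induction_on generalizing L with
  | _ n ih =>
    have hne : L ≠ [] := by
      rintro rfl
      have := h.2 _ (isEnd_zero x)
      simp at this
    obtain ⟨τ, hτ, hmax⟩ : ∃ τ ∈ L, ∀ σ ∈ L, σ.length ≤ τ.length := by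
      obtain ⟨τ, h1, h2⟩ := L.toFinset.exists_max_image List.length
        (by simpa [List.toFinset_nonempty_iff] using hne)
      exact ⟨τ, by simpa using h1, fun σ hσ => h2 σ (by simpa using hσ)⟩
    rcases List.eq_nil_or_concat' τ with rfl | ⟨ρ, k, rfl⟩
    · have h1 : ∀ σ ∈ L, σ = [] := fun σ hσ => by simpa using hmax σ hσ
      have h2 : L = [[]] := by
        rcases L with _ | ⟨a, L⟩
        · exact absurd rfl hne
        · rcases L with _ | ⟨b, L⟩
          · rw [h1 a (by simp)]
          · have := h.nodup
            rw [h1 a (by simp), h1 b (by simp)] at this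
            simp at this
      rw [h2]
      exact nil
    · obtain ⟨R, hR⟩ := h.exists_siblings hτ (by simpa using hmax)
      have h1 := cover_childAddrs.1 (h.perm hR)
      refine perm _ _ (h.perm hR) hR.symm (split ρ R h1 (ih _ ?_ h1 rfl))
      have h2 := (hR.map List.length).sum_eq
      rw [← hn, h2, List.map_append, List.sum_append, List.map_cons, List.sum_cons]
      refine Nat.add_lt_add_right ?_ _
      have h3 : ρ ++ [0] ∈ P.childAddrs x ρ := mem_childAddrs.2 ⟨0, children_pos _, rfl⟩
      have := List.single_le_sum (l := (P.childAddrs x ρ).map List.length) (by simp) _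
        (List.mem_map_of_mem h3)
      simp at this
      omega

/-- Bar induction: if every end has an initial segment with a property, there is a cover by paths with this
property. -/
theorem exists_cover {Good : List ℕ → Prop} (h : ∀ s, P.IsEnd x s → ∃ n, Good (s.take n)) :
    ∃ L, P.Cover x L ∧ ∀ τ ∈ L, Good τ := by
  -- In every cover, a barred path may be replaced by paths with the property.
  let Barred : List ℕ → Prop := fun τ =>
    ∀ R, P.Cover x (τ :: R) → ∃ L, (∀ τ ∈ L, Good τ) ∧ P.Cover x (L ++ R)
  have hgood : ∀ τ, Good τ → Barred τ := fun τ hτ R hR => ⟨[τ], by simpa using hτ, hR⟩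
  have hlist : ∀ C : List (List ℕ), (∀ τ ∈ C, Barred τ) → ∀ R, P.Cover x (C ++ R) →
      ∃ L, (∀ τ ∈ L, Good τ) ∧ P.Cover x (L ++ R) := by
    intro C
    induction C with
    | nil => exact fun _ R hR => ⟨[], by simp, hR⟩
    | cons τ C ih =>
      intro hC R hR
      obtain ⟨L, h1, h2⟩ := hC τ (by simp) (C ++ R) hR
      obtain ⟨L', h1', h2'⟩ := ih (fun σ hσ => hC σ (by simp [hσ])) (L ++ R)
        (h2.perm (by rw [← List.append_assoc, ← List.append_assoc]
                     exact List.perm_append_comm.append_right R))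
      refine ⟨L' ++ L, ?_, by rwa [List.append_assoc]⟩
      intro σ hσ
      exact (List.mem_append.1 hσ).elim (h1' σ) (h1 σ)
  by_cases h0 : Barred []
  · obtain ⟨L, h1, h2⟩ := h0 [] cover_nil
    exact ⟨L, by simpa using h2, h1⟩
  -- A path that is not barred has a child that is not barred, so such paths lead to an end that violates
  -- the hypothesis.
  exfalso
  have hstep : ∀ τ, P.Addr x τ ∧ ¬ Barred τ → ∃ k, P.Addr x (τ ++ [k]) ∧ ¬ Barred (τ ++ [k]) := by
    rintro τ ⟨h1, h2⟩
    by_contra h3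
    push Not at h3
    refine h2 fun R hR => hlist (P.childAddrs x τ) ?_ R (cover_childAddrs.2 hR)
    intro σ hσ
    obtain ⟨k, hk, rfl⟩ := mem_childAddrs.1 hσ
    exact h3 k (addr_append.2 ⟨h1, hk, trivial⟩)
  choose! F hF using hstep
  let T : ℕ → List ℕ := fun n => Nat.rec [] (fun _ τ => τ ++ [F τ]) n
  let s : Stream' ℕ := fun n => F (T n)
  have hT : ∀ n, s.take n = T n := by
    intro n
    induction n with
    | zero => rfl
    | succ n ih => rw [Stream'.take_succ', ih]; rfl
  have hbad : ∀ n, P.Addr x (T n) ∧ ¬ Barred (T n) := by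
    intro n
    induction n with
    | zero => exact ⟨trivial, h0⟩
    | succ n ih => exact hF _ ih
  obtain ⟨n, hn⟩ := h s fun n => hT n ▸ (hbad n).1
  exact (hbad n).2 (hgood _ (hT n ▸ hn))

end SemigroupPresentation

/-! ### Diagrams for covers -/

namespace BraidedDiagram

variable {α Z : Type*} {P : SemigroupPresentation α} {u v w : List α}

open SemigroupPresentation

/-- The diagram without transistors whose wires realize a permutation of letters. -/
def permDiagram (P : SemigroupPresentation α) (e : Fin u.length ≃ Fin v.length)
    (he : ∀ i, v.get (e i) = u.get i) : BraidedDiagram P u v where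
  T := Empty
  finite := inferInstance
  top := Empty.elim
  bot := Empty.elim
  mem_rels := fun t => t.elim
  wire := Sum.map e fun t => t.1.elim
  bijective := by
    constructor
    · rintro (i | ⟨⟨⟩, k⟩) (j | ⟨⟨⟩, k⟩) h
      exact congrArg _ (e.injective (Sum.inl_injective h))
    · rintro (i | ⟨⟨⟩, k⟩)
      exact ⟨.inl (e.symm i), congrArg _ (e.apply_symm_apply i)⟩
  letter_wire := by
    rintro (i | ⟨⟨⟩, k⟩)
    exact he i
  acyclic := fun t => t.elim

theorem transports_permDiagram {e : Fin u.length ≃ Fin v.length} (he : ∀ i, v.get (e i) = u.get i)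
    {f : Fin u.length → Stream' ℕ → Z} {g : Fin v.length → Stream' ℕ → Z}
    (h : ∀ i, g (e i) = f i) : (permDiagram P e he).Transports f g := by
  refine ⟨fun p => p.1.elim, fun p => p.1.elim, ?_, fun t => t.elim⟩
  rintro (i | ⟨⟨⟩, k⟩) s -
  exact (congrFun (h i) s).symm

/-- The wires of the diagram with one transistor that splits the first letter of a word. -/
def splitWire (a : α) (w r : List α) :
    Port (a :: r) (fun _ : Unit => w) → Port (w ++ r) (fun _ : Unit => [a])
  | .inl ⟨0, _⟩ => .inr ⟨(), 0⟩
  | .inl ⟨i + 1, h⟩ => .inl ⟨w.length + i, by simpa using h⟩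
  | .inr ⟨_, k⟩ => .inl ⟨k.1, Nat.lt_of_lt_of_le k.2 (by simp)⟩

theorem splitWire_bijective (a : α) (w r : List α) : Function.Bijective (splitWire a w r) := by
  constructor
  · rintro (⟨_ | i, hi⟩ | ⟨⟨⟩, k⟩) (⟨_ | j, hj⟩ | ⟨⟨⟩, l⟩) h
    · rfl
    · cases h
    · cases h
    · cases h
    · have := congrArg Fin.val (Sum.inl_injective h)
      simp only [Nat.add_left_cancel_iff] at this
      subst this
      rfl
    · have := congrArg Fin.val (Sum.inl_injective h)
      have := l.2
      simp only at *
      omega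
    · cases h
    · have := congrArg Fin.val (Sum.inl_injective h)
      have := k.2
      simp only at *
      omega
    · have := congrArg Fin.val (Sum.inl_injective h)
      rw [Fin.ext (a := k) (b := l) this]
  · rintro (⟨i, hi⟩ | ⟨⟨⟩, k⟩)
    · by_cases h : i < w.length
      · exact ⟨.inr ⟨(), ⟨i, h⟩⟩, rfl⟩
      · refine ⟨.inl ⟨i - w.length + 1, ?_⟩, ?_⟩
        · simp only [List.length_append, List.length_cons] at hi ⊢
          omega
        · simp only [splitWire]
          congr 2
          omega
    · refine ⟨.inl ⟨0, by simp⟩, ?_⟩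
      obtain rfl : k = (0 : Fin 1) := Subsingleton.elim (α := Fin 1) _ _
      rfl

/-- The diagram with one transistor that splits the first letter of a word. -/
def splitDiagram {a : α} {w : List α} (h : ([a], w) ∈ P.rels) (r : List α) :
    BraidedDiagram P (a :: r) (w ++ r) where
  T := Unit
  finite := inferInstance
  top := fun _ => [a]
  bot := fun _ => w
  mem_rels := fun _ => .inl h
  wire := splitWire a w r
  bijective := splitWire_bijective a w r
  letter_wire := by
    rintro (⟨_ | i, hi⟩ | ⟨⟨⟩, k⟩)
    · rfl
    · simp [splitWire, Port.letter]
    · simp [splitWire, Port.letter]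
  acyclic := by
    have : ∀ s t : Unit, ¬ ∃ k l, splitWire a w r (.inr ⟨s, k⟩) = .inr ⟨t, l⟩ := by
      rintro s t ⟨k, l, h⟩
      cases h
    intro t ht
    cases ht with
    | single h => exact this _ _ h
    | tail _ h => exact this _ _ h

theorem transports_splitDiagram (hP : P.IsTreeLike) {a : α} {w : List α} (h : ([a], w) ∈ P.rels)
    (r : List α) {f g : ℕ → Stream' ℕ → Z} (h1 : ∀ l < w.length, ∀ s, g l s = f 0 (l ::ₛ s))
    (h2 : ∀ i, g (w.length + i) = f (i + 1)) :
    (splitDiagram h r).Transports (fun i => f i.1) (fun j => g j.1) := by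
  refine ⟨fun p => g p.2.1, fun p => f p.2.1, ?_, fun _ => ⟨fun _ k l s hs => ?_, fun h' => ?_⟩⟩
  · rintro (⟨_ | i, hi⟩ | ⟨⟨⟩, k⟩) s -
    · rfl
    · exact (congrFun (h2 i) s).symm
    · rfl
  · obtain rfl : k = (0 : Fin 1) := Subsingleton.elim (α := Fin 1) _ _
    exact (h1 l.1 l.2 s).symm
  · exact absurd h' (hP.asymm h)

/-- The function on the ends below the letters of a word that puts given paths in front of them. -/
def prefixFun {n : ℕ} (L : List (List ℕ)) : Fin n → Stream' ℕ → Stream' ℕ :=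
  fun i s => L.getD i.1 [] ++ₛ s

theorem exists_transports_perm {x : α} {L L' : List (List ℕ)} (hL : L.Nodup) (h : L.Perm L') :
    ∃ D : BraidedDiagram P (L.map (P.label x)) (L'.map (P.label x)),
      D.Transports (prefixFun L) (prefixFun L') := by
  have hL' := h.nodup_iff.1 hL
  let e : Fin L.length ≃ Fin L'.length := ((hL.getEquiv L).trans
    (Equiv.subtypeEquivRight fun σ => h.mem_iff)).trans (hL'.getEquiv L').symm
  have he : ∀ i, L'.get (e i) = L.get i := by
    intro i
    have := (hL'.getEquiv L').apply_symm_apply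
      ((Equiv.subtypeEquivRight fun σ => h.mem_iff) (hL.getEquiv L i))
    exact congrArg Subtype.val this
  let e' : Fin (L.map (P.label x)).length ≃ Fin (L'.map (P.label x)).length :=
    ((finCongr (by simp)).trans e).trans (finCongr (by simp))
  have he' : ∀ i : Fin (L.map (P.label x)).length,
      L'.getD (e' i).1 [] = L.getD i.1 [] := by
    intro i
    have := he (finCongr (by simp) i)
    have h1 : i.1 < L.length := by simpa using i.2
    have h2 : (e' i).1 < L'.length := by simpa using (e' i).2
    simp only [List.getD_eq_getElem?_getD, h1, h2, getElem?_pos, Option.getD_some]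
    exact this
  refine ⟨permDiagram P e' fun i => ?_, transports_permDiagram _ fun i => ?_⟩
  · have h1 := he' i
    have h2 : i.1 < L.length := by simpa using i.2
    have h3 : (e' i).1 < L'.length := by simpa using (e' i).2
    simp only [List.getD_eq_getElem?_getD, h2, h3, getElem?_pos, Option.getD_some] at h1
    simp [h1]
  · funext s
    simp only [prefixFun, he']

theorem exists_transports_split (hP : P.IsTreeLike) (x : α) (τ : List ℕ) (R : List (List ℕ)) :
    ∃ D : BraidedDiagram P ((τ :: R).map (P.label x)) ((P.childAddrs x τ ++ R).map (P.label x)),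
      D.Transports (prefixFun (τ :: R)) (prefixFun (P.childAddrs x τ ++ R)) := by
  have hw : (P.childAddrs x τ).map (P.label x) = P.children (P.label x τ) := by
    refine List.ext_getElem (by simp [childAddrs]) fun k h1 h2 => ?_
    simp [childAddrs, label_append, child_eq h2]
  have hlen : (P.childAddrs x τ).length = (P.children (P.label x τ)).length := by
    simp [childAddrs]
  have hg : ∀ l < (P.children (P.label x τ)).length,
      (P.childAddrs x τ ++ R).getD l [] = τ ++ [l] := by
    intro l hl
    rw [List.getD_append _ _ _ _ (by rwa [hlen])]
    simp [childAddrs, hl]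
  have hg' : ∀ i, (P.childAddrs x τ ++ R).getD ((P.children (P.label x τ)).length + i) [] =
      R.getD i [] := by
    intro i
    rw [List.getD_append_right _ _ _ _ (by omega), hlen, Nat.add_sub_cancel_left]
  rw [List.map_append, hw, List.map_cons]
  by_cases ha : ∃ w, ([P.label x τ], w) ∈ P.rels
  · refine ⟨splitDiagram (children_mem ha) _, transports_splitDiagram hP (children_mem ha) _
      (f := fun i s => (τ :: R).getD i [] ++ₛ s)
      (g := fun i s => (P.childAddrs x τ ++ R).getD i [] ++ₛ s) (fun l hl s => ?_) fun i => ?_⟩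
    · rw [hg l hl, Stream'.append_append_stream]
      rfl
    · funext s
      rw [hg' i]
      rfl
  -- The only end below a leaf is constant, so it does not matter that its path is prolonged.
  · have h1 : (P.children (P.label x τ)).length = 1 := by rw [children_leaf ha]; rfl
    have key : (idDiagram P (P.label x τ :: R.map (P.label x))).Transports (prefixFun (τ :: R))
        (prefixFun (P.childAddrs x τ ++ R)) := by
      refine (transports_id (prefixFun (τ :: R))).congr (fun _ _ _ => rfl) fun j s hs => ?_
      rcases j with ⟨_ | j, hj⟩
      · have := isEnd_leaf ha hs
        simp only [prefixFun]
        rw [hg 0 (by omega), this, Stream'.append_append_stream]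
        change τ ++ₛ _ = τ ++ₛ _
        congr 1
        exact Stream'.const_eq 0
      · simp only [prefixFun]
        have := hg' j
        rw [h1, add_comm] at this
        rw [this]
        rfl
    rw [children_leaf ha]
    exact ⟨_, key⟩

/-- Every cover is the bottom of a diagram consisting of splits and a permutation. -/
theorem exists_transports_cover (hP : P.IsTreeLike) {x : α} {L : List (List ℕ)}
    (h : P.Cover x L) : ∃ D : BraidedDiagram P [x] (L.map (P.label x)),
      D.Transports (fun _ s => s) (prefixFun L) := by
  refine h.induction (Q := fun L => ∃ D : BraidedDiagram P [x] (L.map (P.label x)),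
      D.Transports (fun _ s => s) (prefixFun L)) ?_ ?_ ?_
  · refine ⟨idDiagram P [x], (transports_id _).congr (fun _ _ _ => rfl) fun j s _ => ?_⟩
    have : j = (0 : Fin 1) := Subsingleton.elim (α := Fin 1) _ _
    subst this
    rfl
  · rintro τ R hR ⟨D, hD⟩
    obtain ⟨E, hE⟩ := exists_transports_split hP x τ R
    exact ⟨D.concat E, hD.concat hE⟩
  · rintro L L' hL hp ⟨D, hD⟩
    obtain ⟨E, hE⟩ := exists_transports_perm (P := P) (x := x) hL.nodup hp
    exact ⟨D.concat E, hD.concat hE⟩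

end BraidedDiagram

/-! ### The action of the braided diagram group on the ends -/

namespace SemigroupPresentation

variable {α : Type*} (P : SemigroupPresentation α)

/-- The space of ends of the tree of iterated children of a letter. -/
abbrev Ends (x : α) := {s : Stream' ℕ // P.IsEnd x s}

variable {P}

/-- The transformation `h` replaces the path `τ` from `x` by the path `ρ` to the same letter in all ends that
start with `τ`. -/
structure Replaces {x : α} (h : P.Ends x → P.Ends x) (τ ρ : List ℕ) : Prop where
  left : P.Addr x τ
  right : P.Addr x ρ
  label_eq : P.label x ρ = P.label x τ
  apply_eq : ∀ (t : P.Ends x) r, t.1 = τ ++ₛ r → (h t).1 = ρ ++ₛ r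

/-- A transformation of the ends that replaces an initial segment of every end by a path to the same
letter, and does so for all ends with this initial segment. -/
def IsLocal {x : α} (h : P.Ends x → P.Ends x) : Prop :=
  ∀ s : P.Ends x, ∃ n ρ, Replaces h (s.1.take n) ρ

end SemigroupPresentation

namespace BraidedDiagram

variable {α Z : Type*} {P : SemigroupPresentation α} {x : α}

open SemigroupPresentation

/-- The diagram `D` acts on the ends by `h`: it transports the inclusion of the ends to `h`. So an end at the
bottom of the frame is mapped to the end that it comes from at the top. -/
def Acts (D : BraidedDiagram P [x] [x]) (h : P.Ends x → P.Ends x) : Prop :=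
  ∃ g : Stream' ℕ → Stream' ℕ, D.Transports (fun _ s => s) (fun _ s => g s) ∧
    ∀ s : P.Ends x, g s = (h s).1

theorem get_singleton (i : Fin [x].length) : [x].get i = x := by
  simp

/-- Every diagram acts on the ends, by a local transformation. -/
theorem exists_acts (hP : P.IsTreeLike) (D : BraidedDiagram P [x] [x]) :
    ∃ h, D.Acts h ∧ IsLocal h := by
  obtain ⟨g, hg⟩ := D.exists_transports_bot hP fun _ s => s
  have key : ∀ s : P.Ends x, ∃ n τ, P.Addr x τ ∧ P.label x τ = P.label x (s.1.take n) ∧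
      ∀ r, P.IsEnd (P.label x (s.1.take n)) r → g 0 (s.1.take n ++ₛ r) = τ ++ₛ r := by
    intro s
    obtain ⟨n, j, τ, h1, h2, h3⟩ := exists_replacement hP hg.inv 0 s.2
    rw [get_singleton] at h1 h2
    exact ⟨n, τ, h1, h2, h3⟩
  have hend : ∀ s : P.Ends x, P.IsEnd x (g 0 s.1) := by
    intro s
    obtain ⟨n, τ, h1, h2, h3⟩ := key s
    have h4 := s.2.drop n
    have := h3 _ h4
    rw [Stream'.append_take_drop] at this
    rw [this, isEnd_append]
    exact ⟨h1, h2 ▸ h4⟩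
  refine ⟨fun s => ⟨g 0 s.1, hend s⟩, ⟨g 0, ?_, fun _ => rfl⟩, fun s => ?_⟩
  · refine hg.congr (fun _ _ _ => rfl) fun j s _ => ?_
    have : j = 0 := Subsingleton.elim (α := Fin 1) _ _
    rw [this]
  · obtain ⟨n, τ, h1, h2, h3⟩ := key s
    refine ⟨n, τ, s.2 n, h1, h2, fun t r hr => ?_⟩
    have ht := t.2
    rw [hr, isEnd_append] at ht
    exact (congrArg (g 0) hr).trans (h3 r ht.2)

theorem Acts.unique (hP : P.IsTreeLike) {D : BraidedDiagram P [x] [x]} {h h' : P.Ends x → P.Ends x}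
    (hD : D.Acts h) (hD' : D.Acts h') : h = h' := by
  obtain ⟨g, h1, h2⟩ := hD
  obtain ⟨g', h1', h2'⟩ := hD'
  funext s
  refine Subtype.ext ?_
  rw [← h2, ← h2']
  exact h1.unique_bot hP h1' 0 s.2

theorem Acts.of_rel (hP : P.IsTreeLike) {D E : BraidedDiagram P [x] [x]}
    (h : dipoleSetoid P [x] [x] D E) {φ : P.Ends x → P.Ends x} (hD : D.Acts φ) : E.Acts φ := by
  obtain ⟨g, h1, h2⟩ := hD
  exact ⟨g, (Transports.of_rel hP h).1 h1, h2⟩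

theorem acts_id : (idDiagram P [x]).Acts id := ⟨id, transports_id _, fun _ => rfl⟩

theorem Acts.concat {D E : BraidedDiagram P [x] [x]} {h h' : P.Ends x → P.Ends x}
    (hD : D.Acts h) (hE : E.Acts h') : (D.concat E).Acts (h ∘ h') := by
  obtain ⟨g, h1, h2⟩ := hD
  obtain ⟨g', h1', h2'⟩ := hE
  refine ⟨g ∘ g', h1.concat (h1'.comp g), fun s => ?_⟩
  rw [Function.comp_apply, Function.comp_apply, h2', h2]

/-- A diagram with trivial action is trivial up to dipoles. -/
theorem Acts.rel_id (hP : P.IsTreeLike) {D : BraidedDiagram P [x] [x]} (hD : D.Acts id) :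
    dipoleSetoid P [x] [x] D (idDiagram P [x]) := by
  obtain ⟨g, h1, h2⟩ := hD
  refine rel_id_of_transports hP D ?_
  have h3 : D.Transports (fun _ s => s) (fun _ s => s) :=
    h1.congr (fun _ _ _ => rfl) fun j s hs => h2 ⟨s, by rwa [get_singleton] at hs⟩
  refine (h3.comp fun s => ((0 : Fin 1), s)).congr (fun i s _ => ?_) fun i s _ => ?_ <;>
  · have : i = (0 : Fin 1) := Subsingleton.elim (α := Fin 1) _ _
    subst this
    rfl

/-- Every local permutation `h` of the ends is the action of a diagram: `h` maps the ends below the entries of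
a cover to those below the entries of another cover with the same letters, and the diagrams of these covers
are glued along their bottoms. -/
theorem exists_acts_eq (hP : P.IsTreeLike) (h : Equiv.Perm (P.Ends x)) (hh : IsLocal h) :
    ∃ D : BraidedDiagram P [x] [x], D.Acts h := by
  obtain ⟨L, hL, hgood⟩ := exists_cover (P := P) (x := x) (Good := fun τ => ∃ ρ, Replaces h τ ρ)
    fun s hs => hh ⟨s, hs⟩
  choose! φ hφ using hgood
  have hL' : P.Cover x (L.map φ) := by
    refine ⟨?_, fun s hs => ?_⟩
    · rintro σ hσ
      obtain ⟨τ, hτ, rfl⟩ := List.mem_map.1 hσ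
      exact (hφ τ hτ).right
    · rw [List.countP_map, ← hL.2 _ (h.symm ⟨s, hs⟩).2]
      refine List.countP_congr fun τ hτ => ?_
      simp only [Function.comp_apply, decide_eq_true_eq]
      rw [startsWith_iff, startsWith_iff]
      have h1 := hφ τ hτ
      constructor
      · rintro ⟨r, rfl⟩
        have hr := (isEnd_append.1 hs).2
        rw [h1.label_eq] at hr
        refine ⟨r, ?_⟩
        have h2 := h1.apply_eq ⟨τ ++ₛ r, isEnd_append.2 ⟨h1.left, hr⟩⟩ r rfl
        have h3 : h ⟨τ ++ₛ r, isEnd_append.2 ⟨h1.left, hr⟩⟩ = ⟨φ τ ++ₛ r, hs⟩ := Subtype.ext h2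
        rw [← h3, Equiv.symm_apply_apply]
      · rintro ⟨r, hr⟩
        have h2 := h1.apply_eq _ r hr
        rw [Equiv.apply_symm_apply] at h2
        exact ⟨r, h2⟩
  have hw : (L.map φ).map (P.label x) = L.map (P.label x) := by
    rw [List.map_map]
    exact List.map_congr_left fun τ hτ => (hφ τ hτ).label_eq
  obtain ⟨D, hD⟩ := exists_transports_cover hP hL
  obtain ⟨E, hE⟩ : ∃ E : BraidedDiagram P [x] (L.map (P.label x)),
      E.Transports (fun _ s => s) (prefixFun (L.map φ)) := by
    rw [← hw]
    exact exists_transports_cover hP hL'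
  classical
  let g : Stream' ℕ → Stream' ℕ := fun s => if hs : P.IsEnd x s then (h ⟨s, hs⟩).1 else s
  have hg : ∀ s : P.Ends x, g s = (h s).1 := fun s => dif_pos s.2
  refine ⟨E.concat D.inv, g,
    hE.concat ((hD.inv.comp g).congr (fun i s hs => ?_) fun _ _ _ => rfl), hg⟩
  have hi : i.1 < L.length := by simpa using i.2
  have h1 := hφ _ (List.getElem_mem hi)
  have hs' : P.IsEnd (P.label x L[i.1]) s := by simpa using hs
  simp only [prefixFun, List.getD_eq_getElem?_getD, hi, getElem?_pos, List.getElem?_map,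
    Option.map_some, Option.getD_some]
  exact (hg ⟨L[i.1] ++ₛ s, isEnd_append.2 ⟨h1.left, hs'⟩⟩).trans (h1.apply_eq _ s rfl)

end BraidedDiagram

namespace BraidedDiagramGroup

variable {α : Type*} {P : SemigroupPresentation α} {x : α}

open SemigroupPresentation BraidedDiagram

/-- The action of the braided diagram group on the ends. As it is a homomorphism to transformations of the
ends, the transformations are permutations. -/
noncomputable def endAction (hP : P.IsTreeLike) (x : α) :
    BraidedDiagramGroup P [x] →* Equiv.Perm (P.Ends x) :=
  MonoidHom.toHomPerm
    { toFun := Quotient.lift (fun D => (D.exists_acts hP).choose) fun D E h =>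
        ((D.exists_acts hP).choose_spec.1.of_rel hP h).unique hP (E.exists_acts hP).choose_spec.1
      map_one' := ((idDiagram P [x]).exists_acts hP).choose_spec.1.unique hP acts_id
      map_mul' := by
        rintro ⟨D⟩ ⟨E⟩
        exact ((D.concat E).exists_acts hP).choose_spec.1.unique hP
          ((D.exists_acts hP).choose_spec.1.concat (E.exists_acts hP).choose_spec.1) }

theorem acts_endAction (hP : P.IsTreeLike) (D : BraidedDiagram P [x] [x]) :
    D.Acts (endAction hP x (Quotient.mk _ D)) := (D.exists_acts hP).choose_spec.1

theorem isLocal_endAction (hP : P.IsTreeLike) (q : BraidedDiagramGroup P [x]) :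
    IsLocal (endAction hP x q) := by
  obtain ⟨D⟩ := q
  exact (D.exists_acts hP).choose_spec.2

theorem endAction_injective (hP : P.IsTreeLike) : Function.Injective (endAction hP x) := by
  rw [injective_iff_map_eq_one]
  rintro ⟨D⟩ h
  have h1 := acts_endAction hP D
  rw [show endAction hP x (Quotient.mk _ D) = 1 from h] at h1
  exact Quotient.sound (h1.rel_id hP)

theorem range_endAction (hP : P.IsTreeLike) (h : Equiv.Perm (P.Ends x)) :
    h ∈ (endAction hP x).range ↔ IsLocal h := by
  constructor
  · rintro ⟨q, rfl⟩
    exact isLocal_endAction hP q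
  · intro hh
    obtain ⟨D, hD⟩ := exists_acts_eq hP h hh
    exact ⟨Quotient.mk _ D, Equiv.coe_fn_injective ((acts_endAction hP D).unique hP hD)⟩

end BraidedDiagramGroup

/-! ### Similarity structures coded by ends -/

open SemigroupPresentation BraidedDiagramGroup

theorem MetricBall.isOpen {X : Type*} [MetricSpace X] [IsUltrametricDist X] (B : MetricBall X) :
    IsOpen B.1 := by
  obtain ⟨x, r, hr, h⟩ := B.2
  rw [h]
  exact IsUltrametricDist.isOpen_closedBall x hr.ne'

namespace FiniteSimilarityStructure

variable {X : Type*} [MetricSpace X] {α : Type*} {P : SemigroupPresentation α} {x : α}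

/-- The map `g` between balls corresponds, under an identification of the ends with the points, to the
replacement of the path `τ` by the path `ρ`. -/
structure Represents (e : P.Ends x ≃ X) {B B' : MetricBall X} (g : B.1 ≃ B'.1) (τ ρ : List ℕ) :
    Prop where
  left : P.Addr x τ
  right : P.Addr x ρ
  label_eq : P.label x ρ = P.label x τ
  mem_iff : ∀ s, e s ∈ B.1 ↔ StartsWith s.1 τ
  apply_eq : ∀ s t r, s.1 = τ ++ₛ r → t.1 = ρ ++ₛ r → ∀ hs : e s ∈ B.1, (g ⟨e s, hs⟩ : X) = e t

/-- An identification of the ends of the tree of iterated children of `x` with the points of a space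
under which the similarities are the replacements of paths to the same letter. -/
structure Coding (S : FiniteSimilarityStructure X) (e : P.Ends x ≃ X) : Prop where
  exists_sim : ∀ τ ρ, P.Addr x τ → P.Addr x ρ → P.label x ρ = P.label x τ →
    ∃ B B', ∃ g ∈ S.Sim B B', Represents e g τ ρ
  exists_addr : ∀ B B', ∀ g ∈ S.Sim B B', ∃ τ ρ, Represents e g τ ρ

variable {S : FiniteSimilarityStructure X} {e : P.Ends x ≃ X}

/-- A map that is locally given by similarities is continuous, because balls are open. -/
theorem continuous_of_locally [IsUltrametricDist X] (f : X → X)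
    (hf : ∀ y, ∃ B : MetricBall X, y ∈ B.1 ∧ ∃ B' : MetricBall X, ∃ g ∈ S.Sim B B',
      ∀ z : B.1, (g z : X) = f z) : Continuous f := by
  rw [continuous_iff_continuousAt]
  intro y
  obtain ⟨B, hy, B', g, hg, h⟩ := hf y
  obtain ⟨c, hc, hd⟩ := S.similarity _ _ g hg
  have hcont : Continuous g :=
    (LipschitzWith.of_dist_le_mul (K := ⟨c, hc.le⟩) fun a b => (hd a b).le).continuous
  have hon : ContinuousOn f B.1 := by
    rw [continuousOn_iff_continuous_domRestrict]
    exact (continuous_subtype_val.comp hcont).congr h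
  exact hon.continuousAt (B.isOpen.mem_nhds hy)

/-- Local transformations of the ends are locally given by similarities. -/
theorem Coding.locally_of_isLocal (hS : S.Coding e) {h : Equiv.Perm (P.Ends x)} (hh : IsLocal h)
    (y : X) : ∃ B : MetricBall X, y ∈ B.1 ∧ ∃ B' : MetricBall X, ∃ g ∈ S.Sim B B',
      ∀ z : B.1, (g z : X) = e (h (e.symm z)) := by
  obtain ⟨n, ρ, hr⟩ := hh (e.symm y)
  obtain ⟨B, B', g, hg, hrep⟩ := hS.exists_sim _ _ hr.left hr.right hr.label_eq
  refine ⟨B, ?_, B', g, hg, fun z => ?_⟩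
  · rw [← e.apply_symm_apply y, hrep.mem_iff]
    exact startsWith_take _ _
  · have hz : e (e.symm z) ∈ B.1 := by rw [e.apply_symm_apply]; exact z.2
    obtain ⟨r, hz'⟩ := startsWith_iff.1 ((hrep.mem_iff _).1 hz)
    rw [← hrep.apply_eq _ (h (e.symm z)) r hz' (hr.apply_eq _ r hz') hz]
    congr 2
    exact Subtype.ext (e.apply_symm_apply z.1).symm

variable [IsUltrametricDist X]

/-- The action of the group of a similarity structure on the ends that are identified with the points. -/
def groupToPerm (S : FiniteSimilarityStructure X) (e : P.Ends x ≃ X) :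
    S.group →* Equiv.Perm (P.Ends x) where
  toFun h := (e.trans h.1.toEquiv).trans e.symm
  map_one' := Equiv.ext fun s => e.symm_apply_apply s
  map_mul' a b := Equiv.ext fun s => by
    change e.symm (a.1 (b.1 (e s))) = e.symm (a.1 (e (e.symm (b.1 (e s)))))
    rw [e.apply_symm_apply]

theorem groupToPerm_injective : Function.Injective (groupToPerm S e) := by
  intro a b h
  refine Subtype.ext (Homeomorph.ext fun y => ?_)
  have := congrArg (fun f : Equiv.Perm (P.Ends x) => f (e.symm y)) h
  change e.symm (a.1 (e (e.symm y))) = e.symm (b.1 (e (e.symm y))) at this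
  rw [e.apply_symm_apply] at this
  exact e.symm.injective this

theorem Coding.range_groupToPerm (hP : P.IsTreeLike) (hS : S.Coding e)
    (h : Equiv.Perm (P.Ends x)) : h ∈ (groupToPerm S e).range ↔ IsLocal h := by
  constructor
  · rintro ⟨h, rfl⟩ s
    obtain ⟨B, hs, B', g, hg, hgh⟩ := h.2 (e s)
    obtain ⟨τ, ρ, hr⟩ := hS.exists_addr _ _ g hg
    have hτ : s.1.take τ.length = τ := (hr.mem_iff s).1 hs
    refine ⟨τ.length, ρ, ?_⟩
    rw [hτ]
    refine ⟨hr.left, hr.right, hr.label_eq, fun t r ht => ?_⟩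
    have htB : e t ∈ B.1 := (hr.mem_iff t).2 (startsWith_iff.2 ⟨r, ht⟩)
    have ht' := t.2
    rw [ht, isEnd_append, ← hr.label_eq] at ht'
    have h1 := hr.apply_eq t ⟨ρ ++ₛ r, isEnd_append.2 ⟨hr.right, ht'.2⟩⟩ r ht rfl htB
    rw [hgh] at h1
    have h2 : e.symm (h.1 (e t)) = _ := e.symm_apply_eq.2 h1
    exact congrArg Subtype.val h2
  · intro hh
    -- Local permutations form a group, being the actions of diagrams.
    have hh' : IsLocal (h⁻¹ : Equiv.Perm _) :=
      (range_endAction hP _).1 (inv_mem ((range_endAction hP h).2 hh))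
    let f : X ≃ₜ X :=
      { toEquiv := (e.symm.trans h).trans e
        continuous_toFun := continuous_of_locally (S := S) _ (hS.locally_of_isLocal hh)
        continuous_invFun := continuous_of_locally (S := S) _ (hS.locally_of_isLocal hh') }
    refine ⟨⟨f, hS.locally_of_isLocal hh⟩, Equiv.ext fun s => ?_⟩
    change e.symm (e (h (e.symm (e s)))) = h s
    rw [e.symm_apply_apply, e.symm_apply_apply]

/-- The group of a coded similarity structure and the braided diagram group act faithfully on the ends,
by the same permutations. -/
theorem Coding.nonempty_mulEquiv (hP : P.IsTreeLike) (hS : S.Coding e) :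
    Nonempty (S.group ≃* BraidedDiagramGroup P [x]) := by
  have hrange : (groupToPerm S e).range = (endAction hP x).range :=
    Subgroup.ext fun h => (hS.range_groupToPerm hP h).trans (range_endAction hP h).symm
  exact ⟨((MonoidHom.ofInjective groupToPerm_injective).trans
    (MulEquiv.subgroupCongr hrange)).trans
    (MonoidHom.ofInjective (endAction_injective hP)).symm⟩

end FiniteSimilarityStructure

/-! ### The space of ends as a linearly ordered compact ultrametric space -/

open FiniteSimilarityStructure

namespace SemigroupPresentation

variable {α : Type*} {P : SemigroupPresentation α} {x : α}

/-- Streams at distance `2⁻ⁿ` if they differ for the first time at the place `n`. -/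
@[reducible]
noncomputable def streamMetric : MetricSpace (Stream' ℕ) := PiNat.metricSpaceNatNat

attribute [local instance] streamMetric

theorem stream_dist_le {s t : Stream' ℕ} {n : ℕ} :
    dist s t ≤ (1 / 2) ^ n ↔ s.take n = t.take n := by
  have h1 : dist s t ≤ (1 / 2) ^ n ↔ ∀ i < n, s.get i = t.get i :=
    (PiNat.mem_cylinder_iff_dist_le (E := fun _ => ℕ) (x := t) (y := s)).symm
  rw [h1]
  constructor
  · intro h
    refine List.ext_getElem (by simp) fun i h1 h2 => ?_
    simpa using h i (by simpa using h1)
  · intro h i hi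
    have := congrArg (fun l => l[i]?) h
    simpa [Stream'.getElem?_take hi] using this

theorem stream_dist_lt {s t : Stream' ℕ} {n : ℕ} (h : dist s t < (1 / 2) ^ n) :
    s.take (n + 1) = t.take (n + 1) := by
  refine List.ext_getElem (by simp) fun i h1 h2 => ?_
  have : s.get i = t.get i := PiNat.apply_eq_of_dist_lt (E := fun _ => ℕ) (x := s) (y := t) h
    (by simp at h1; omega)
  simpa using this

theorem stream_dist_triangle (s t r : Stream' ℕ) : dist s r ≤ max (dist s t) (dist t r) :=
  PiNat.dist_triangle_nonarch (E := fun _ => ℕ) s t r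

theorem stream_dist_le_one (s t : Stream' ℕ) : dist s t ≤ 1 := by
  simpa using (stream_dist_le (s := s) (t := t) (n := 0)).2 rfl

theorem stream_dist_cons (k : ℕ) (s t : Stream' ℕ) :
    dist (k ::ₛ s) (k ::ₛ t) = 1 / 2 * dist s t := by
  by_cases h : s = t
  · subst h
    simp
  have h' : k ::ₛ s ≠ k ::ₛ t := fun h1 => h (Stream'.cons_injective2 h1).2
  have h1 : dist s t = (1 / 2) ^ PiNat.firstDiff (E := fun _ => ℕ) s t :=
    PiNat.dist_eq_of_ne (E := fun _ => ℕ) h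
  have h2 : dist (k ::ₛ s) (k ::ₛ t) =
      (1 / 2) ^ PiNat.firstDiff (E := fun _ => ℕ) (k ::ₛ s) (k ::ₛ t) :=
    PiNat.dist_eq_of_ne (E := fun _ => ℕ) h'
  have h3 := PiNat.apply_firstDiff_ne (E := fun _ => ℕ) h
  have h4 := PiNat.apply_firstDiff_ne (E := fun _ => ℕ) h'
  have h5 : PiNat.firstDiff (E := fun _ => ℕ) (k ::ₛ s) (k ::ₛ t) =
      PiNat.firstDiff (E := fun _ => ℕ) s t + 1 := by
    refine le_antisymm ?_ ?_
    · by_contra hlt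
      exact h3 (PiNat.apply_eq_of_lt_firstDiff (E := fun _ => ℕ) (x := k ::ₛ s) (y := k ::ₛ t)
        (not_le.1 hlt))
    · by_contra hlt
      rw [not_le, Nat.lt_succ_iff] at hlt
      rcases hd : PiNat.firstDiff (E := fun _ => ℕ) (k ::ₛ s) (k ::ₛ t) with _ | n
      · rw [hd] at h4
        exact h4 rfl
      · rw [hd] at h4 hlt
        exact h4 (PiNat.apply_eq_of_lt_firstDiff (E := fun _ => ℕ) (x := s) (y := t) hlt)
  rw [h1, h2, h5, pow_succ']

theorem stream_dist_append (τ : List ℕ) (s t : Stream' ℕ) :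
    dist (τ ++ₛ s) (τ ++ₛ t) = (1 / 2) ^ τ.length * dist s t := by
  induction τ with
  | nil => simp
  | cons k τ ih =>
    rw [Stream'.cons_append_stream, Stream'.cons_append_stream, stream_dist_cons, ih,
      List.length_cons, pow_succ']
    ring

noncomputable instance instMetricSpaceEnds : MetricSpace (P.Ends x) :=
  MetricSpace.induced Subtype.val Subtype.val_injective streamMetric

theorem ends_dist (s t : P.Ends x) : dist s t = dist s.1 t.1 := rfl

instance instIsUltrametricDistEnds : IsUltrametricDist (P.Ends x) :=
  ⟨fun s t r => stream_dist_triangle s.1 t.1 r.1⟩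

instance instNonemptyEnds : Nonempty (P.Ends x) := ⟨⟨Stream'.const 0, isEnd_zero x⟩⟩

instance instCompactSpaceEnds : CompactSpace (P.Ends x) := by
  refine ⟨isCompact_of_finite_subcover fun {ι} U hU hcover => ?_⟩
  -- By bar induction there is a finite cover by paths below which all ends lie in one of the open sets.
  obtain ⟨L, hL, hgood⟩ := exists_cover (P := P) (x := x)
    (Good := fun τ => ∃ i, ∀ s : P.Ends x, StartsWith s.1 τ → s ∈ U i) fun s hs => by
      obtain ⟨i, hi⟩ := Set.mem_iUnion.1 (hcover (Set.mem_univ (⟨s, hs⟩ : P.Ends x)))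
      obtain ⟨ε, hε, hball⟩ := Metric.isOpen_iff.1 (hU i) _ hi
      obtain ⟨n, hn⟩ := exists_pow_lt_of_lt_one hε (one_half_lt_one (α := ℝ))
      refine ⟨n, i, fun t ht => hball ?_⟩
      rw [StartsWith, Stream'.length_take] at ht
      rw [Metric.mem_ball, ends_dist]
      exact (stream_dist_le.2 ht).trans_lt hn
  have : Nonempty ι := by
    obtain ⟨i, -⟩ := Set.mem_iUnion.1 (hcover (Set.mem_univ (Classical.arbitrary (P.Ends x))))
    exact ⟨i⟩
  choose! φ hφ using hgood
  classical
  refine ⟨(L.map φ).toFinset, fun s _ => ?_⟩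
  obtain ⟨τ, h1, h2⟩ := hL.exists_mem s.2
  refine Set.mem_iUnion₂.2 ⟨φ τ, ?_, hφ τ h1 s h2⟩
  rw [List.mem_toFinset]
  exact List.mem_map_of_mem h1

/-- Ends are ordered lexicographically. -/
noncomputable instance instLinearOrderEnds : LinearOrder (P.Ends x) :=
  LinearOrder.lift' (fun s => toLex (fun n : ℕ => s.1.get n)) fun _ _ h =>
    Subtype.ext (Stream'.ext fun n => congrFun (toLex.injective h) n)

theorem ends_lt {s t : P.Ends x} :
    s < t ↔ ∃ i, (∀ j < i, s.1.get j = t.1.get j) ∧ s.1.get i < t.1.get i := Iff.rfl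

theorem mem_closedBall_iff (s t : P.Ends x) (n : ℕ) :
    t ∈ Metric.closedBall s ((1 / 2) ^ n) ↔ StartsWith t.1 (s.1.take n) := by
  rw [Metric.mem_closedBall, ends_dist, stream_dist_le, StartsWith, Stream'.length_take]

/-- Balls consist of the ends that start with a given path. -/
theorem exists_addr_ball (B : MetricBall (P.Ends x)) :
    ∃ τ, P.Addr x τ ∧ ∀ s, s ∈ B.1 ↔ StartsWith s.1 τ := by
  obtain ⟨s, r, hr, hB⟩ := B.2
  have hex : ∃ n : ℕ, (1 / 2 : ℝ) ^ n ≤ r := by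
    obtain ⟨n, hn⟩ := exists_pow_lt_of_lt_one hr (one_half_lt_one (α := ℝ))
    exact ⟨n, hn.le⟩
  classical
  refine ⟨s.1.take (Nat.find hex), s.2 _, fun t => ?_⟩
  rw [← mem_closedBall_iff, hB]
  refine ⟨fun h => ?_, fun h => Metric.closedBall_subset_closedBall (Nat.find_spec hex) h⟩
  rcases hn : Nat.find hex with _ | n
  · rw [Metric.mem_closedBall, pow_zero]
    exact stream_dist_le_one _ _
  · have h1 := Nat.find_min hex (m := n) (by omega)
    rw [mem_closedBall_iff, StartsWith, Stream'.length_take]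
    exact stream_dist_lt (lt_of_le_of_lt (Metric.mem_closedBall.1 h) (not_le.1 h1))

/-- The ball of the ends that start with a given path. -/
def coneBall {τ : List ℕ} (h : P.Addr x τ) : MetricBall (P.Ends x) :=
  ⟨{s | StartsWith s.1 τ}, ⟨τ ++ₛ Stream'.const 0, isEnd_append_zero h⟩, (1 / 2) ^ τ.length,
    by positivity, by
      ext t
      rw [mem_closedBall_iff, take_append_stream le_rfl, List.take_length]
      rfl⟩

/-- Replacement of the path `τ` by a path `ρ` to the same letter. -/
def coneEquiv {τ ρ : List ℕ} (hτ : P.Addr x τ) (hρ : P.Addr x ρ) (h : P.label x ρ = P.label x τ) :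
    (coneBall hτ).1 ≃ (coneBall hρ).1 where
  toFun s := ⟨⟨ρ ++ₛ s.1.1.drop τ.length, by
    have h1 := s.1.2.drop τ.length
    rw [show s.1.1.take τ.length = τ from s.2, ← h] at h1
    exact isEnd_append.2 ⟨hρ, h1⟩⟩, startsWith_append _ _⟩
  invFun s := ⟨⟨τ ++ₛ s.1.1.drop ρ.length, by
    have h1 := s.1.2.drop ρ.length
    rw [show s.1.1.take ρ.length = ρ from s.2, h] at h1
    exact isEnd_append.2 ⟨hτ, h1⟩⟩, startsWith_append _ _⟩
  left_inv s := by
    refine Subtype.ext (Subtype.ext ?_)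
    simp only [Stream'.drop_append_stream]
    exact StartsWith.append_drop (show StartsWith s.1.1 τ from s.2)
  right_inv s := by
    refine Subtype.ext (Subtype.ext ?_)
    simp only [Stream'.drop_append_stream]
    exact StartsWith.append_drop (show StartsWith s.1.1 ρ from s.2)

theorem represents_coneEquiv {τ ρ : List ℕ} (hτ : P.Addr x τ) (hρ : P.Addr x ρ)
    (h : P.label x ρ = P.label x τ) :
    Represents (Equiv.refl _) (coneEquiv hτ hρ h) τ ρ := by
  refine ⟨hτ, hρ, h, fun s => Iff.rfl, fun s t r hs ht hsB => Subtype.ext ?_⟩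
  change ρ ++ₛ s.1.drop τ.length = t.1
  rw [hs, ht, Stream'.drop_append_stream]

/-- Two paths that lead to the same ends coincide, or they lead to the same leaf. -/
theorem IsTreeLike.eq_or_leaf (hP : P.IsTreeLike) {τ σ : List ℕ} (hτ : P.Addr x τ)
    (hσ : P.Addr x σ) (h : ∀ s : P.Ends x, StartsWith s.1 τ ↔ StartsWith s.1 σ) :
    τ = σ ∨ P.label x τ = P.label x σ ∧
      ∀ s t : P.Ends x, StartsWith s.1 τ → StartsWith t.1 τ → s = t := by
  wlog hl : τ.length ≤ σ.length generalizing τ σ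
  · rcases this hσ hτ (fun s => (h s).symm) (by omega) with h1 | ⟨h1, h2⟩
    · exact .inl h1.symm
    · exact .inr ⟨h1.symm, fun s t hs ht => h2 s t ((h s).1 hs) ((h t).1 ht)⟩
  obtain ⟨r, hr⟩ := startsWith_iff.1 ((h ⟨_, isEnd_append_zero hσ⟩).2 (startsWith_append _ _))
  obtain ⟨π, rfl, -⟩ := append_stream_eq_append_stream hl hr.symm
  by_cases ha : ∃ w, ([P.label x τ], w) ∈ P.rels
  · left
    have := hP.eq_nil_of_append ha (b := P.label x (τ ++ π)) (τ := π) fun s hs => by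
      obtain ⟨t, ht⟩ := startsWith_iff.1 ((h ⟨τ ++ₛ s, isEnd_append.2 ⟨hτ, hs⟩⟩).1
        (startsWith_append _ _))
      refine ⟨t, ?_, ?_⟩
      · have h1 := isEnd_append.2 ⟨hτ, hs⟩
        rw [show τ ++ₛ s = _ from ht, isEnd_append] at h1
        exact h1.2
      · rw [Stream'.append_append_stream] at ht
        exact (append_stream_injective rfl ht).2
    rw [this, List.append_nil]
  · right
    refine ⟨by rw [label_append, label_leaf ha], fun s t hs ht => Subtype.ext ?_⟩
    obtain ⟨r, hr⟩ := startsWith_iff.1 hs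
    obtain ⟨r', hr'⟩ := startsWith_iff.1 ht
    have h1 := s.2
    have h2 := t.2
    rw [hr, isEnd_append] at h1
    rw [hr', isEnd_append] at h2
    rw [hr, hr', isEnd_leaf ha h1.2, isEnd_leaf ha h2.2]

end SemigroupPresentation

/-! ### The similarity structure on the space of ends -/

namespace FiniteSimilarityStructure.Represents

variable {α : Type*} {P : SemigroupPresentation α} {x : α}
variable {B B' B'' : MetricBall (P.Ends x)} {g : B.1 ≃ B'.1} {τ ρ σ : List ℕ}

theorem symm (h : Represents (Equiv.refl _) g τ ρ) :
    Represents (Equiv.refl _) g.symm ρ τ := by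
  have key : ∀ s t : P.Ends x, ∀ r, s.1 = τ ++ₛ r → t.1 = ρ ++ₛ r → ∃ hs : s ∈ B.1,
      (g ⟨s, hs⟩ : P.Ends x) = t := fun s t r hs ht =>
    ⟨(h.mem_iff s).2 (startsWith_iff.2 ⟨r, hs⟩), h.apply_eq s t r hs ht _⟩
  have hend : ∀ r, P.IsEnd x (ρ ++ₛ r) → P.IsEnd x (τ ++ₛ r) := by
    intro r hr
    rw [isEnd_append, h.label_eq] at hr
    exact isEnd_append.2 ⟨h.left, hr.2⟩
  have hend' : ∀ r, P.IsEnd x (τ ++ₛ r) → P.IsEnd x (ρ ++ₛ r) := by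
    intro r hr
    rw [isEnd_append, ← h.label_eq] at hr
    exact isEnd_append.2 ⟨h.right, hr.2⟩
  refine ⟨h.right, h.left, h.label_eq.symm, fun t => ⟨fun ht => ?_, fun ht => ?_⟩,
    fun t s r ht hs htB => ?_⟩
  · obtain ⟨r, hr⟩ := startsWith_iff.1 ((h.mem_iff _).1 (g.symm ⟨t, ht⟩).2)
    have h1 : P.IsEnd x (τ ++ₛ r) := by
      rw [← hr]
      exact (g.symm ⟨t, ht⟩).1.2
    obtain ⟨h2, h3⟩ := key (g.symm ⟨t, ht⟩) ⟨ρ ++ₛ r, hend' r h1⟩ r hr rfl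
    have h4 : g ⟨(g.symm ⟨t, ht⟩).1, h2⟩ = ⟨t, ht⟩ := g.apply_symm_apply _
    rw [h4] at h3
    exact startsWith_iff.2 ⟨r, congrArg Subtype.val h3⟩
  · obtain ⟨r, hr⟩ := startsWith_iff.1 ht
    have h1 : P.IsEnd x (ρ ++ₛ r) := hr ▸ t.2
    obtain ⟨h2, h3⟩ := key ⟨τ ++ₛ r, hend r h1⟩ t r rfl hr
    exact h3 ▸ (g ⟨_, h2⟩).2
  · obtain ⟨h2, h3⟩ := key s t r hs ht
    have h4 : g ⟨s, h2⟩ = ⟨t, htB⟩ := Subtype.ext h3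
    exact congrArg Subtype.val (g.symm_apply_eq.2 h4.symm)

/-- The path that describes the source of a similarity may be replaced. -/
theorem change_left (hP : P.IsTreeLike) (h : Represents (Equiv.refl _) g τ ρ)
    (hσ : P.Addr x σ) (hB : ∀ s, s ∈ B.1 ↔ StartsWith s.1 σ) :
    Represents (Equiv.refl _) g σ ρ := by
  rcases hP.eq_or_leaf h.left hσ fun s => (h.mem_iff s).symm.trans (hB s) with rfl | ⟨h1, h2⟩
  · exact h
  refine ⟨hσ, h.right, h.label_eq.trans h1, hB, fun s t r hs ht hsB => ?_⟩
  have htB : t ∈ B'.1 := (h.symm.mem_iff t).2 (startsWith_iff.2 ⟨r, ht⟩)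
  have h3 : g.symm ⟨t, htB⟩ = ⟨s, hsB⟩ := Subtype.ext
    (h2 _ _ ((h.mem_iff _).1 (g.symm ⟨t, htB⟩).2) ((h.mem_iff _).1 hsB))
  exact congrArg Subtype.val (g.symm_apply_eq.1 h3).symm

theorem trans {g' : B'.1 ≃ B''.1} (h : Represents (Equiv.refl _) g τ ρ)
    (h' : Represents (Equiv.refl _) g' ρ σ) : Represents (Equiv.refl _) (g.trans g') τ σ := by
  refine ⟨h.left, h'.right, h'.label_eq.trans h.label_eq, h.mem_iff, fun s t r hs ht hsB => ?_⟩
  have h1 := s.2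
  rw [hs, isEnd_append, ← h.label_eq] at h1
  have h2 := h.apply_eq s ⟨ρ ++ₛ r, isEnd_append.2 ⟨h.right, h1.2⟩⟩ r hs rfl hsB
  have h3 := h'.apply_eq ⟨ρ ++ₛ r, isEnd_append.2 ⟨h.right, h1.2⟩⟩ t r rfl ht
    (h2 ▸ (g ⟨s, hsB⟩).2)
  refine Eq.trans ?_ h3
  exact congrArg (fun y => (g' y : P.Ends x)) (Subtype.ext h2)

theorem apply_val (h : Represents (Equiv.refl _) g τ ρ) (s : B.1) :
    ∃ r, P.IsEnd (P.label x τ) r ∧ s.1.1 = τ ++ₛ r ∧ (g s).1.1 = ρ ++ₛ r := by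
  obtain ⟨r, hr⟩ := startsWith_iff.1 ((h.mem_iff _).1 s.2)
  have h1 := s.1.2
  rw [hr, isEnd_append] at h1
  have h2 := h1
  rw [← h.label_eq] at h2
  exact ⟨r, h1.2, hr, congrArg Subtype.val
    (h.apply_eq s.1 ⟨ρ ++ₛ r, isEnd_append.2 ⟨h.right, h2.2⟩⟩ r hr rfl s.2)⟩

theorem eq {g' : B.1 ≃ B'.1} (h : Represents (Equiv.refl _) g τ ρ)
    (h' : Represents (Equiv.refl _) g' τ ρ) : g = g' := by
  refine Equiv.ext fun s => Subtype.ext (Subtype.ext ?_)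
  obtain ⟨r, -, h1, h2⟩ := h.apply_val s
  obtain ⟨r', -, h1', h2'⟩ := h'.apply_val s
  rw [(append_stream_injective rfl (h1.symm.trans h1')).2] at h2
  exact h2.trans h2'.symm

end FiniteSimilarityStructure.Represents

namespace SemigroupPresentation

variable {α : Type*} {P : SemigroupPresentation α} {x : α}

attribute [local instance] streamMetric

/-- A similarity is determined by its source and its target, whichever paths describe them. -/
theorem represents_subsingleton (hP : P.IsTreeLike) {B B' : MetricBall (P.Ends x)} {g g' : B.1 ≃ B'.1}
    {τ ρ τ' ρ' : List ℕ} (h : Represents (Equiv.refl _) g τ ρ)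
    (h' : Represents (Equiv.refl _) g' τ' ρ') : g = g' :=
  h.eq ((h'.change_left hP h.left h.mem_iff).symm.change_left hP h.right h.symm.mem_iff).symm

/-- The similarities between balls of ends that replace a path by a path to the same letter. -/
def endSimilarities (hP : P.IsTreeLike) (x : α) : FiniteSimilarityStructure (P.Ends x) where
  Sim _ _ := {g | ∃ τ ρ, Represents (Equiv.refl _) g τ ρ}
  similarity := by
    rintro B B' g ⟨τ, ρ, h⟩
    refine ⟨(1 / 2) ^ ρ.length / (1 / 2) ^ τ.length, by positivity, fun s t => ?_⟩
    obtain ⟨r, -, h1, h2⟩ := h.apply_val s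
    obtain ⟨r', -, h1', h2'⟩ := h.apply_val t
    change dist (g s).1.1 (g t).1.1 = _ * dist s.1.1 t.1.1
    rw [h1, h2, h1', h2',
      stream_dist_append, stream_dist_append]
    field_simp
  finite B B' := Set.Subsingleton.finite
    fun g ⟨_, _, h⟩ g' ⟨_, _, h'⟩ => represents_subsingleton hP h h'
  id_mem B := by
    obtain ⟨τ, h1, h2⟩ := exists_addr_ball B
    exact ⟨τ, τ, h1, h1, rfl, h2, fun s t r hs ht _ => Subtype.ext (hs.trans ht.symm)⟩
  symm_mem := by
    rintro B B' g ⟨τ, ρ, h⟩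
    exact ⟨ρ, τ, h.symm⟩
  trans_mem := by
    rintro B B' B'' g ⟨τ, ρ, h⟩ g' ⟨τ', ρ', h'⟩
    exact ⟨τ, ρ', h.trans (h'.change_left hP h.right h.symm.mem_iff)⟩
  restrict_mem := by
    rintro B B' g ⟨τ, ρ, h⟩ C hC
    obtain ⟨π, hπ, hCπ⟩ : ∃ π, P.Addr x (τ ++ π) ∧ ∀ s, s ∈ C.1 ↔ StartsWith s.1 (τ ++ π) := by
      obtain ⟨σ, h1, h2⟩ := exists_addr_ball C
      have h3 : ∀ s : P.Ends x, StartsWith s.1 σ → StartsWith s.1 τ := fun s hs =>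
        (h.mem_iff s).1 (hC ((h2 s).2 hs))
      obtain ⟨r, hr⟩ := startsWith_iff.1 (h3 ⟨_, isEnd_append_zero h1⟩ (startsWith_append _ _))
      rcases le_total τ.length σ.length with hl | hl
      · obtain ⟨π, rfl, -⟩ := append_stream_eq_append_stream hl hr.symm
        exact ⟨π, h1, h2⟩
      · obtain ⟨π, rfl, -⟩ := append_stream_eq_append_stream hl hr
        refine ⟨[], by simpa using h.left, fun s => ?_⟩
        rw [List.append_nil, h2]
        refine ⟨h3 s, fun hs => ?_⟩
        obtain ⟨r, hr⟩ := startsWith_iff.1 hs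
        rw [hr, Stream'.append_append_stream]
        exact startsWith_append _ _
    have hlab : P.label x (ρ ++ π) = P.label x (τ ++ π) := by
      rw [label_append, label_append, h.label_eq]
    have hρπ : P.Addr x (ρ ++ π) := by
      rw [addr_append] at hπ ⊢
      exact ⟨h.right, h.label_eq ▸ hπ.2⟩
    obtain rfl : C = coneBall hπ := Subtype.ext (Set.ext hCπ)
    refine ⟨coneBall hρπ, coneEquiv hπ hρπ hlab, ⟨_, _, represents_coneEquiv hπ hρπ hlab⟩,
      fun s => ?_⟩
    obtain ⟨r, h0, h1, h2⟩ := (represents_coneEquiv hπ hρπ hlab).apply_val s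
    refine (h.apply_eq s.1 _ (π ++ₛ r) ?_ ?_ _).symm
    · rw [h1, Stream'.append_append_stream]
    · refine h2.trans ?_
      rw [Stream'.append_append_stream]

theorem coding_endSimilarities (hP : P.IsTreeLike) (x : α) :
    (endSimilarities hP x).Coding (Equiv.refl _) :=
  ⟨fun τ ρ hτ hρ h => ⟨_, _, coneEquiv hτ hρ h, ⟨τ, ρ, represents_coneEquiv hτ hρ h⟩,
    represents_coneEquiv hτ hρ h⟩, fun _ _ _ h => h⟩

/-- A common initial path does not affect the lexicographic order. -/
theorem append_get_lt (τ : List ℕ) {r r' : Stream' ℕ} :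
    (∃ i, (∀ j < i, (τ ++ₛ r).get j = (τ ++ₛ r').get j) ∧ (τ ++ₛ r).get i < (τ ++ₛ r').get i) ↔
      ∃ i, (∀ j < i, r.get j = r'.get j) ∧ r.get i < r'.get i := by
  induction τ with
  | nil => rfl
  | cons k τ ih =>
    rw [← ih]
    constructor
    · rintro ⟨_ | i, h1, h2⟩
      · exact absurd h2 (lt_irrefl k)
      · exact ⟨i, fun j hj => h1 (j + 1) (by omega), h2⟩
    · rintro ⟨i, h1, h2⟩
      refine ⟨i + 1, fun j hj => ?_, h2⟩
      rcases j with _ | j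
      · rfl
      · exact h1 j (by omega)

theorem isSmall_endSimilarities (hP : P.IsTreeLike) (x : α) : (endSimilarities hP x).IsSmall where
  subsingleton _ _ := fun _ ⟨_, _, h⟩ _ ⟨_, _, h'⟩ => represents_subsingleton hP h h'
  order_preserving := by
    rintro B B' g ⟨τ, ρ, h⟩ s t hst
    obtain ⟨r, -, h1, h2⟩ := h.apply_val s
    obtain ⟨r', -, h1', h2'⟩ := h.apply_val t
    have hst : s.1 < t.1 := hst
    change (g s).1 < (g t).1
    rw [ends_lt, h1, h1', append_get_lt] at hst
    rwa [ends_lt, h2, h2', append_get_lt]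

theorem orderSeparatesBalls_ends : OrderSeparatesBalls (P.Ends x) := by
  rintro B C hBC ⟨s, hs, t, ht, hst⟩ s' hs' t' ht'
  obtain ⟨τ, h1, h2⟩ := exists_addr_ball B
  obtain ⟨σ, h1', h2'⟩ := exists_addr_ball C
  obtain ⟨i, h3, h4⟩ := ends_lt.1 hst
  have hget : ∀ (a b : P.Ends x) (π : List ℕ), StartsWith a.1 π → StartsWith b.1 π →
      ∀ j < π.length, a.1.get j = b.1.get j := by
    intro a b π ha hb j hj
    have h : a.1.take π.length = b.1.take π.length := ha.trans hb.symm
    have := congrArg (fun l => l[j]?) h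
    simpa [Stream'.getElem?_take hj] using this
  have hagree : ∀ (a b : P.Ends x) (π : List ℕ), StartsWith a.1 π →
      (∀ j < π.length, a.1.get j = b.1.get j) → StartsWith b.1 π := by
    intro a b π ha hab
    refine Eq.trans (List.ext_getElem (by simp) fun j h1 h2 => ?_) ha
    simpa using (hab j (by simpa using h1)).symm
  have hi : i < τ.length := by
    by_contra hi
    exact Set.disjoint_left.1 hBC ((h2 t).2 (hagree s t τ ((h2 s).1 hs)
      fun j hj => h3 j (by omega))) ht
  have hi' : i < σ.length := by
    by_contra hi
    exact Set.disjoint_left.1 hBC hs ((h2' s).2 (hagree t s σ ((h2' t).1 ht)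
      fun j hj => (h3 j (by omega)).symm))
  have h5 := hget s s' τ ((h2 s).1 hs) ((h2 s').1 hs')
  have h6 := hget t t' σ ((h2' t).1 ht) ((h2' t').1 ht')
  refine ends_lt.2 ⟨i, fun j hj => ?_, ?_⟩
  · rw [← h5 j (by omega), ← h6 j (by omega)]
    exact h3 j hj
  · rw [← h5 i hi, ← h6 i hi']
    exact h4

end SemigroupPresentation

/-! ### Balls in compact ultrametric spaces -/

namespace MetricBall

variable {X : Type*} [MetricSpace X]

theorem nonempty (B : MetricBall X) : B.1.Nonempty := by
  obtain ⟨x, r, hr, h⟩ := B.2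
  rw [h]
  exact ⟨x, Metric.mem_closedBall_self hr.le⟩

theorem isClosed (B : MetricBall X) : IsClosed B.1 := by
  obtain ⟨x, r, -, h⟩ := B.2
  rw [h]
  exact Metric.isClosed_closedBall

/-- Two points are separated by a ball. -/
theorem exists_separating {y z : X} (h : y ≠ z) : ∃ B : MetricBall X, y ∈ B.1 ∧ z ∉ B.1 := by
  have h0 : 0 < dist y z := dist_pos.2 h
  refine ⟨⟨Metric.closedBall y (dist y z / 2), y, dist y z / 2, half_pos h0, rfl⟩,
    Metric.mem_closedBall_self (half_pos h0).le, fun hz => ?_⟩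
  have : dist z y ≤ dist y z / 2 := hz
  rw [dist_comm] at this
  linarith

/-- `C` is a maximal proper subball of `B`. -/
def IsMaxSub (B C : MetricBall X) : Prop := Maximal (fun C : MetricBall X => C.1 ⊂ B.1) C

theorem IsMaxSub.nontrivial {B C : MetricBall X} (hC : IsMaxSub B C) : B.1.Nontrivial := by
  obtain ⟨y, hy⟩ := C.nonempty
  obtain ⟨z, hz, hzC⟩ := Set.exists_of_ssubset hC.prop
  exact ⟨y, hC.prop.1 hy, z, hz, fun h => hzC (h ▸ hy)⟩

variable [IsUltrametricDist X]

theorem eq_closedBall (B : MetricBall X) {y : X} (hy : y ∈ B.1) :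
    ∃ r, 0 < r ∧ B.1 = Metric.closedBall y r := by
  obtain ⟨x, r, hr, h⟩ := B.2
  rw [h] at hy
  exact ⟨r, hr, h.trans (IsUltrametricDist.closedBall_eq_of_mem hy)⟩

/-- Two balls with a common point are nested. -/
theorem nested (B C : MetricBall X) {y : X} (hB : y ∈ B.1) (hC : y ∈ C.1) :
    B.1 ⊆ C.1 ∨ C.1 ⊆ B.1 := by
  obtain ⟨r, -, h⟩ := B.eq_closedBall hB
  obtain ⟨r', -, h'⟩ := C.eq_closedBall hC
  rw [h, h']
  exact (le_total r r').imp Metric.closedBall_subset_closedBall Metric.closedBall_subset_closedBall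

theorem IsMaxSub.eq_of_mem {B C C' : MetricBall X} (h : IsMaxSub B C) (h' : IsMaxSub B C') {y : X}
    (hy : y ∈ C.1) (hy' : y ∈ C'.1) : C = C' := by
  rcases C.nested C' hy hy' with h1 | h1
  · exact Subtype.ext (Set.Subset.antisymm h1 (h.le_of_ge h'.prop h1))
  · exact Subtype.ext (Set.Subset.antisymm (h'.le_of_ge h.prop h1) h1)

variable [CompactSpace X]

/-- Every ball containing a ball of radius `r` is a union of balls of radius `r`, of which there are
finitely many in a compact space. -/
theorem finite_superballs (B : MetricBall X) : {C : MetricBall X | B.1 ⊆ C.1}.Finite := by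
  obtain ⟨y, r, hr, hB⟩ := B.2
  have hF : (Set.range fun z : X => Metric.closedBall z r).Finite := by
    obtain ⟨t, ht⟩ := isCompact_univ.elim_finite_subcover (fun z : X => Metric.closedBall z r)
      (fun z => IsUltrametricDist.isOpen_closedBall z hr.ne')
      fun z _ => Set.mem_iUnion.2 ⟨z, Metric.mem_closedBall_self hr.le⟩
    refine (t.finite_toSet.image fun z : X => Metric.closedBall z r).subset ?_
    rintro _ ⟨z, rfl⟩
    obtain ⟨w, hw, hz⟩ := Set.mem_iUnion₂.1 (ht (Set.mem_univ z))
    exact ⟨w, hw, IsUltrametricDist.closedBall_eq_of_mem hz⟩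
  refine Set.Finite.of_finite_image (f := Subtype.val) ?_ Subtype.val_injective.injOn
  refine (hF.finite_subsets.image Set.sUnion).subset ?_
  rintro _ ⟨C, hC, rfl⟩
  have hC : B.1 ⊆ C.1 := hC
  refine ⟨{D | D ∈ Set.range (fun z : X => Metric.closedBall z r) ∧ D ⊆ C.1}, fun D hD => hD.1, ?_⟩
  refine Set.Subset.antisymm (Set.sUnion_subset fun D hD => hD.2) fun z hz => ?_
  refine ⟨Metric.closedBall z r, ⟨⟨z, rfl⟩, ?_⟩, Metric.mem_closedBall_self hr.le⟩
  obtain ⟨r', -, hC'⟩ := C.eq_closedBall hz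
  rcases le_total r r' with h | h
  · rw [hC']
    exact Metric.closedBall_subset_closedBall h
  · have hy : y ∈ C.1 := hC (by rw [hB]; exact Metric.mem_closedBall_self hr.le)
    rw [hC'] at hy
    rw [IsUltrametricDist.closedBall_eq_of_mem (Metric.closedBall_subset_closedBall h hy), ← hB]
    exact hC

/-- A decreasing sequence of balls that contain a given ball does not decrease strictly. -/
theorem exists_eq_succ (D : MetricBall X) (b : ℕ → MetricBall X) (hb : ∀ n, (b (n + 1)).1 ⊆ (b n).1)
    (hD : ∀ n, D.1 ⊆ (b n).1) : ∃ n, b (n + 1) = b n := by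
  have hanti : Antitone fun n => (b n).1 := antitone_nat_of_succ_le hb
  have hfin := D.finite_superballs
  obtain ⟨m, -, n, -, hmn, h⟩ := Set.infinite_univ.exists_lt_map_eq_of_mapsTo
    (f := b) (t := {C : MetricBall X | D.1 ⊆ C.1}) (fun n _ => hD n) hfin
  refine ⟨m, Subtype.ext (Set.Subset.antisymm (hb m) ?_)⟩
  rw [h]
  exact hanti (Nat.succ_le_of_lt hmn)

theorem exists_maxSub_ge {B C : MetricBall X} (h : C.1 ⊂ B.1) :
    ∃ C', IsMaxSub B C' ∧ C.1 ⊆ C'.1 := by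
  have hfin : {D : MetricBall X | C.1 ⊆ D.1 ∧ D.1 ⊂ B.1}.Finite :=
    C.finite_superballs.subset fun D hD => hD.1
  obtain ⟨D, hCD, hD⟩ := hfin.exists_le_maximal (a := C) ⟨subset_rfl, h⟩
  exact ⟨D, ⟨hD.prop.2, fun E hE hDE => hD.le_of_ge ⟨hCD.trans hDE, hE⟩ hDE⟩, hCD⟩

theorem exists_maxSub_mem {B : MetricBall X} (hB : B.1.Nontrivial) {y : X} (hy : y ∈ B.1) :
    ∃ C, IsMaxSub B C ∧ y ∈ C.1 := by
  obtain ⟨z, hz, hzy⟩ := hB.exists_ne y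
  obtain ⟨D, h1, h2⟩ := exists_separating hzy.symm
  have hD : D.1 ⊂ B.1 := by
    rcases D.nested B h1 hy with h | h
    · exact ⟨h, fun h' => h2 (h' hz)⟩
    · exact absurd (h hz) h2
  obtain ⟨C, hC, hDC⟩ := exists_maxSub_ge hD
  exact ⟨C, hC, hDC h1⟩

theorem finite_maxSub (B : MetricBall X) : {C : MetricBall X | IsMaxSub B C}.Finite := by
  by_cases hB : B.1.Nontrivial
  · obtain ⟨t, ht⟩ := B.isClosed.isCompact.elim_finite_subcover
      (fun C : {C : MetricBall X // IsMaxSub B C} => C.1.1) (fun C => C.1.isOpen) fun y hy => by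
        obtain ⟨C, hC, hyC⟩ := exists_maxSub_mem hB hy
        exact Set.mem_iUnion.2 ⟨⟨C, hC⟩, hyC⟩
    refine (t.finite_toSet.image Subtype.val).subset fun C (hC : IsMaxSub B C) => ?_
    obtain ⟨y, hy⟩ := C.nonempty
    obtain ⟨D, hD, hyD⟩ := Set.mem_iUnion₂.1 (ht (hC.prop.1 hy))
    exact ⟨D, hD, D.2.eq_of_mem hC hyD hy⟩
  · convert Set.finite_empty
    exact Set.eq_empty_of_forall_notMem fun C (hC : IsMaxSub B C) => hB hC.nontrivial

end MetricBall

namespace FiniteSimilarityStructure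

open MetricBall

variable {X : Type*} [MetricSpace X] [LinearOrder X]

theorem MaximalSubballs.eq {B : MetricBall X} {L L' : List (MetricBall X)}
    (h : MaximalSubballs B L) (h' : MaximalSubballs B L') : L = L' := by
  have hnd : ∀ {L : List (MetricBall X)}, MaximalSubballs B L → L.Nodup := fun h =>
    h.2.imp fun {C D} hCD hne => by
      obtain ⟨y, hy⟩ := C.nonempty
      exact lt_irrefl y (hCD y hy y (hne ▸ hy))
  refine List.Perm.eq_of_pairwise (fun C D _ _ h1 h2 => ?_) h.2 h'.2
    ((List.perm_ext_iff_of_nodup (hnd h) (hnd h')).2 fun C => (h.1 C).trans (h'.1 C).symm)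
  obtain ⟨y, hy⟩ := C.nonempty
  obtain ⟨z, hz⟩ := D.nonempty
  exact absurd (h1 y hy z hz) (h2 z hz y hy).not_gt

variable [IsUltrametricDist X] [CompactSpace X]

theorem exists_maximalSubballs (hX : OrderSeparatesBalls X) (B : MetricBall X) :
    ∃ L, MaximalSubballs B L := by
  classical
  let p : MetricBall X → X := fun C => C.nonempty.some
  have hp : ∀ C, p C ∈ C.1 := fun C => C.nonempty.some_mem
  let r : MetricBall X → MetricBall X → Prop := fun C D => p C ≤ p D
  have : Std.Total r := ⟨fun C D => le_total (p C) (p D)⟩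
  have : IsTrans (MetricBall X) r := ⟨fun C D E h1 h2 => le_trans h1 h2⟩
  let L := (finite_maxSub B).toFinset.toList.insertionSort r
  have hperm : L.Perm (finite_maxSub B).toFinset.toList := List.perm_insertionSort _ _
  have hmem : ∀ C, C ∈ L ↔ IsMaxSub B C := fun C => by
    rw [hperm.mem_iff, Finset.mem_toList, Set.Finite.mem_toFinset]
    rfl
  have hnd : L.Nodup := hperm.nodup_iff.2 (Finset.nodup_toList _)
  refine ⟨L, hmem, ?_⟩
  refine List.Pairwise.imp_of_mem ?_ ((List.pairwise_insertionSort r _).and hnd)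
  rintro C D hC hD ⟨hr, hne⟩
  have hdis : Disjoint C.1 D.1 := Set.disjoint_left.2 fun y h1 h2 =>
    hne (((hmem C).1 hC).eq_of_mem ((hmem D).1 hD) h1 h2)
  refine hX C D hdis ⟨p C, hp C, p D, hp D, lt_of_le_of_ne hr fun h => ?_⟩
  exact Set.disjoint_left.1 hdis (hp C) (h ▸ hp D)

end FiniteSimilarityStructure

/-! ### Coding a small similarity structure -/

open MetricBall

namespace FiniteSimilarityStructure

variable {X : Type*} [MetricSpace X] {S : FiniteSimilarityStructure X}
  {B B' C C' D D' : MetricBall X}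

/-- The bijection `g` between balls maps the subball `C` onto the subball `C'`. -/
structure Corresponds (g : B.1 ≃ B'.1) (C C' : MetricBall X) : Prop where
  left : C.1 ⊆ B.1
  right : C'.1 ⊆ B'.1
  mem_iff : ∀ y : B.1, y.1 ∈ C.1 ↔ (g y).1 ∈ C'.1

/-- The similarity `g` restricts to the similarity `g'`. -/
def Restricts (g : B.1 ≃ B'.1) (g' : C.1 ≃ C'.1) : Prop :=
  ∀ y (hy : y ∈ C.1) (hy' : y ∈ B.1), (g' ⟨y, hy⟩).1 = (g ⟨y, hy'⟩).1

theorem Corresponds.symm {g : B.1 ≃ B'.1} (h : Corresponds g C C') : Corresponds g.symm C' C :=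
  ⟨h.right, h.left, fun y => by rw [h.mem_iff, g.apply_symm_apply]⟩

theorem Corresponds.mono {g : B.1 ≃ B'.1} (h : Corresponds g C C') (h' : Corresponds g D D')
    (hCD : C.1 ⊆ D.1) : C'.1 ⊆ D'.1 := by
  intro y hy
  have h1 := (h.symm.mem_iff ⟨y, h.right hy⟩).1 hy
  have h2 := (h'.mem_iff _).1 (hCD h1)
  rwa [g.apply_symm_apply] at h2

theorem Corresponds.unique {g : B.1 ≃ B'.1} (h : Corresponds g C C') (h' : Corresponds g C D') :
    C' = D' :=
  Subtype.ext (Set.Subset.antisymm (h.mono h' subset_rfl) (h'.mono h subset_rfl))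

theorem corresponds_self (g : B.1 ≃ B'.1) : Corresponds g B B' :=
  ⟨subset_rfl, subset_rfl, fun y => iff_of_true y.2 (g y).2⟩

theorem Corresponds.ssubset {g : B.1 ≃ B'.1} (h : Corresponds g C C') (hC : C.1 ⊂ B.1) :
    C'.1 ⊂ B'.1 :=
  ⟨h.right, fun h' => hC.2 ((corresponds_self g).symm.mono h.symm h')⟩

theorem exists_corresponds {g : B.1 ≃ B'.1} (hg : g ∈ S.Sim B B') (hC : C.1 ⊆ B.1) :
    ∃ C', Corresponds g C C' ∧ ∃ g' ∈ S.Sim C C', Restricts g g' := by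
  obtain ⟨C', g', hg', h⟩ := S.restrict_mem _ _ g hg C hC
  refine ⟨C', ⟨hC, fun y hy => ?_, fun y => ⟨fun hy => ?_, fun hy => ?_⟩⟩, g', hg',
    fun y hy _ => h ⟨y, hy⟩⟩
  · have h1 := h (g'.symm ⟨y, hy⟩)
    rw [g'.apply_symm_apply] at h1
    rw [show y = _ from h1]
    exact (g _).2
  · have h1 := h ⟨y, hy⟩
    rw [show (⟨(⟨y, hy⟩ : C.1).1, _⟩ : B.1) = y from rfl] at h1
    rw [← h1]
    exact (g' _).2
  · have h1 := h (g'.symm ⟨(g y).1, hy⟩)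
    rw [g'.apply_symm_apply] at h1
    have h2 := g.injective (Subtype.ext h1)
    rw [h2]
    exact (g'.symm ⟨(g y).1, hy⟩).2

theorem Corresponds.isMaxSub {g : B.1 ≃ B'.1} (hg : g ∈ S.Sim B B') (h : Corresponds g C C')
    (hC : IsMaxSub B C) : IsMaxSub B' C' := by
  refine ⟨h.ssubset hC.prop, fun D' hD' hCD' => ?_⟩
  obtain ⟨D, hD, -⟩ := exists_corresponds (S.symm_mem _ _ g hg) hD'.1
  have h1 : C.1 ⊆ D.1 := h.symm.mono hD hCD'
  exact hD.symm.mono h (hC.le_of_ge (hD.ssubset hD') h1)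

theorem cls_eq_iff : S.cls B = S.cls B' ↔ (S.Sim B B').Nonempty := Quotient.eq (r := S.setoid)

theorem Restricts.cls_eq {L L' : List (MetricBall X)} {g : B.1 ≃ B'.1}
    (h : List.Forall₂ (fun C C' => ∃ g' ∈ S.Sim C C', Restricts g g') L L') :
    L.map S.cls = L'.map S.cls := by
  induction h with
  | nil => rfl
  | cons h _ ih =>
    obtain ⟨g', hg', -⟩ := h
    rw [List.map_cons, List.map_cons, ih, cls_eq_iff.2 ⟨g', hg'⟩]

variable [LinearOrder X]

/-- A similarity maps the maximal proper subballs to the maximal proper subballs, in order. -/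
theorem IsSmall.forall₂_maximalSubballs (hS : S.IsSmall) {L L' : List (MetricBall X)}
    (hL : MaximalSubballs B L) (hL' : MaximalSubballs B' L') {g : B.1 ≃ B'.1}
    (hg : g ∈ S.Sim B B') :
    List.Forall₂ (fun C C' => ∃ g' ∈ S.Sim C C', Restricts g g') L L' := by
  have hmax : ∀ C ∈ L, IsMaxSub B C := fun C hC => (hL.1 C).1 hC
  choose! φ hφ hφ' using fun C (hC : C ∈ L) => exists_corresponds hg (hmax C hC).prop.1
  have hmap : MaximalSubballs B' (L.map φ) := by
    refine ⟨fun C' => ⟨fun hC' => ?_, fun hC' => ?_⟩, ?_⟩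
    · obtain ⟨C, hC, rfl⟩ := List.mem_map.1 hC'
      exact (hφ C hC).isMaxSub hg (hmax C hC)
    · obtain ⟨C, hC, -⟩ := exists_corresponds (S.symm_mem _ _ g hg) hC'.prop.1
      have hCL : C ∈ L := (hL.1 C).2 (hC.isMaxSub (S.symm_mem _ _ g hg) hC')
      exact List.mem_map.2 ⟨C, hCL, (hφ C hCL).unique hC.symm⟩
    · rw [List.pairwise_map]
      refine hL.2.imp_of_mem fun {C D} hC hD h y hy z hz => ?_
      have h1 := ((hφ C hC).symm.mem_iff ⟨y, (hφ C hC).right hy⟩).1 hy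
      have h2 := ((hφ D hD).symm.mem_iff ⟨z, (hφ D hD).right hz⟩).1 hz
      have h3 := hS.order_preserving _ _ g hg _ _ (Subtype.coe_lt_coe.1 (h _ h1 _ h2))
      rwa [g.apply_symm_apply, g.apply_symm_apply] at h3
  rw [← hmap.eq hL', List.forall₂_map_right_iff, List.forall₂_same]
  exact hφ'

open Classical in
/-- The maximal proper subballs of a ball in order, or the ball itself if it is a single point. -/
noncomputable def kids (B : MetricBall X) : List (MetricBall X) :=
  if h : ∃ L, L ≠ [] ∧ MaximalSubballs B L then h.choose else [B]

theorem kids_pos {L : List (MetricBall X)} (h : L ≠ []) (hL : MaximalSubballs B L) : kids B = L := by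
  have h' : ∃ L, L ≠ [] ∧ MaximalSubballs B L := ⟨L, h, hL⟩
  rw [kids, dif_pos h']
  exact h'.choose_spec.2.eq hL

/-- The `k`-th kid of a ball (and the ball itself if it has fewer kids). -/
noncomputable def kid (B : MetricBall X) (k : ℕ) : MetricBall X := (kids B).getD k B

/-- The ball reached from `B` by a path of kids. -/
noncomputable def descend : MetricBall X → List ℕ → MetricBall X
  | B, [] => B
  | B, k :: τ => descend (kid B k) τ

theorem descend_append (B : MetricBall X) (τ ρ : List ℕ) :
    descend B (τ ++ ρ) = descend (descend B τ) ρ := by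
  induction τ generalizing B with
  | nil => rfl
  | cons k τ ih => exact ih _

theorem descend_take_succ (B : MetricBall X) (s : Stream' ℕ) (n : ℕ) :
    descend B (s.take (n + 1)) = kid (descend B (s.take n)) (s.get n) := by
  rw [Stream'.take_succ', descend_append]
  rfl

variable [IsUltrametricDist X] [CompactSpace X]

/-- A ball with several points has at least two maximal proper subballs, and their classes depend only on the
class of the ball. -/
theorem isTreeLike_presentation (hS : S.IsSmall) : S.presentation.IsTreeLike where
  length_left := by
    rintro _ ⟨B, L, -, -, rfl⟩
    rfl
  length_right := by
    rintro _ ⟨B, L, hne, hL, rfl⟩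
    obtain ⟨C, hC⟩ := List.exists_mem_of_ne_nil L hne
    have hC' : IsMaxSub B C := (hL.1 C).1 hC
    obtain ⟨z, hz, hzC⟩ := Set.exists_of_ssubset hC'.prop
    obtain ⟨D, hD, hzD⟩ := exists_maxSub_mem hC'.nontrivial hz
    have hDL : D ∈ L := (hL.1 D).2 hD
    simp only [List.length_map]
    rcases L with _ | ⟨a, _ | ⟨b, L⟩⟩
    · exact absurd rfl hne
    · rw [List.mem_singleton] at hC hDL
      rw [hDL, ← hC] at hzD
      exact absurd hzD hzC
    · simp
  right_unique := by
    rintro a w w' ⟨B, L, -, hL, h⟩ ⟨B', L', -, hL', h'⟩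
    rw [Prod.mk.injEq, List.cons.injEq] at h h'
    obtain ⟨⟨h1, -⟩, rfl⟩ := h
    obtain ⟨⟨h1', -⟩, rfl⟩ := h'
    obtain ⟨g, hg⟩ := cls_eq_iff.1 (h1.symm.trans h1')
    exact Restricts.cls_eq (hS.forall₂_maximalSubballs hL hL' hg)

/-- A ball has several points and its kids are its maximal proper subballs, or it has one point and is its
only kid. -/
theorem kids_cases (hX : OrderSeparatesBalls X) (B : MetricBall X) :
    (B.1.Nontrivial ∧ kids B ≠ [] ∧ MaximalSubballs B (kids B)) ∨
    (B.1.Subsingleton ∧ kids B = [B] ∧ MaximalSubballs B []) := by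
  obtain ⟨L, hL⟩ := exists_maximalSubballs hX B
  by_cases h : L = []
  · subst h
    refine .inr ⟨?_, ?_, hL⟩
    · rw [← Set.not_nontrivial_iff]
      intro hB
      obtain ⟨y, hy⟩ := B.nonempty
      obtain ⟨C, hC, -⟩ := exists_maxSub_mem hB hy
      exact absurd ((hL.1 C).2 hC) (List.not_mem_nil)
    · rw [kids, dif_neg]
      rintro ⟨L', h1, h2⟩
      exact h1 (h2.eq hL)
  · left
    rw [kids_pos h hL]
    obtain ⟨C, hC⟩ := List.exists_mem_of_ne_nil L h
    exact ⟨IsMaxSub.nontrivial ((hL.1 C).1 hC), h, hL⟩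

/-- A similarity maps the kids of a ball to the kids of its image. -/
theorem forall₂_kids (hX : OrderSeparatesBalls X) (hS : S.IsSmall) {g : B.1 ≃ B'.1}
    (hg : g ∈ S.Sim B B') :
    List.Forall₂ (fun C C' => ∃ g' ∈ S.Sim C C', Restricts g g') (kids B) (kids B') := by
  rcases kids_cases hX B with ⟨-, h2, h3⟩ | ⟨-, h2, h3⟩ <;>
    rcases kids_cases hX B' with ⟨-, h2', h3'⟩ | ⟨-, h2', h3'⟩
  · exact hS.forall₂_maximalSubballs h3 h3' hg
  · exact absurd (List.forall₂_nil_right_iff.1 (hS.forall₂_maximalSubballs h3 h3' hg)) h2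
  · exact absurd (List.forall₂_nil_left_iff.1 (hS.forall₂_maximalSubballs h3 h3' hg)) h2'
  · rw [h2, h2']
    exact .cons ⟨g, hg, fun _ _ _ => rfl⟩ .nil

/-- The classes of the kids of a ball are the children of its class. -/
theorem children_cls (hX : OrderSeparatesBalls X) (hS : S.IsSmall) (B : MetricBall X) :
    S.presentation.children (S.cls B) = (kids B).map S.cls := by
  rcases kids_cases hX B with ⟨-, h2, h3⟩ | ⟨-, h2, h3⟩
  · exact (isTreeLike_presentation hS).children_eq ⟨B, _, h2, h3, rfl⟩
  · rw [children_leaf, h2]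
    · rfl
    · rintro ⟨w, B', L, hL, hL', h⟩
      rw [Prod.mk.injEq, List.cons.injEq] at h
      obtain ⟨g, hg⟩ := cls_eq_iff.1 h.1.1
      exact hL (List.forall₂_nil_left_iff.1 (hS.forall₂_maximalSubballs h3 hL' hg))

theorem cls_kid (hX : OrderSeparatesBalls X) (hS : S.IsSmall) (B : MetricBall X) (k : ℕ) :
    S.cls (kid B k) = S.presentation.child (S.cls B) k := by
  rw [kid, child, children_cls hX hS, List.getD_map]

theorem cls_descend (hX : OrderSeparatesBalls X) (hS : S.IsSmall) (B : MetricBall X) (τ : List ℕ) :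
    S.cls (descend B τ) = S.presentation.label (S.cls B) τ := by
  induction τ generalizing B with
  | nil => rfl
  | cons k τ ih => rw [descend, ih, cls_kid hX hS, label_cons]

theorem kid_subset (hX : OrderSeparatesBalls X) (B : MetricBall X) (k : ℕ) :
    (kid B k).1 ⊆ B.1 := by
  by_cases hk : k < (kids B).length
  · have h : kid B k = (kids B)[k] := by simp [kid, hk]
    rcases kids_cases hX B with ⟨-, -, h3⟩ | ⟨-, h2, -⟩
    · rw [h]
      exact ((h3.1 _).1 (List.getElem_mem hk)).prop.1
    · have : kid B k ∈ kids B := h ▸ List.getElem_mem hk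
      rw [h2, List.mem_singleton] at this
      rw [this]
  · simp [kid, hk]

theorem descend_subset (hX : OrderSeparatesBalls X) (B : MetricBall X) (τ : List ℕ) :
    (descend B τ).1 ⊆ B.1 := by
  induction τ generalizing B with
  | nil => exact subset_rfl
  | cons k τ ih => exact (ih _).trans (kid_subset hX B k)

theorem isMaxSub_kid (hX : OrderSeparatesBalls X) (hB : B.1.Nontrivial) {k : ℕ}
    (hk : k < (kids B).length) : IsMaxSub B (kid B k) := by
  have h : kid B k = (kids B)[k] := by simp [kid, hk]
  rcases kids_cases hX B with ⟨-, -, h3⟩ | ⟨h1, -, -⟩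
  · rw [h]
    exact (h3.1 _).1 (List.getElem_mem hk)
  · exact absurd hB (Set.not_nontrivial_iff.2 h1)

theorem exists_mem_kid (hX : OrderSeparatesBalls X) {y : X} (hy : y ∈ B.1) :
    ∃ k < (kids B).length, y ∈ (kid B k).1 := by
  obtain ⟨C, hC, hyC⟩ : ∃ C ∈ kids B, y ∈ C.1 := by
    rcases kids_cases hX B with ⟨h1, -, h3⟩ | ⟨-, h2, -⟩
    · obtain ⟨C, hC, hyC⟩ := exists_maxSub_mem h1 hy
      exact ⟨C, (h3.1 C).2 hC, hyC⟩
    · exact ⟨B, by simp [h2], hy⟩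
  obtain ⟨k, hk, rfl⟩ := List.getElem_of_mem hC
  exact ⟨k, hk, by simpa [kid, hk] using hyC⟩

theorem kid_unique (hX : OrderSeparatesBalls X) {k l : ℕ} (hk : k < (kids B).length)
    (hl : l < (kids B).length) {y : X} (hy : y ∈ (kid B k).1) (hy' : y ∈ (kid B l).1) : k = l := by
  have hk' : kid B k = (kids B)[k] := by simp [kid, hk]
  have hl' : kid B l = (kids B)[l] := by simp [kid, hl]
  rcases kids_cases hX B with ⟨h1, -, h3⟩ | ⟨-, h2, -⟩
  · rw [hk'] at hy
    rw [hl'] at hy'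
    by_contra hne
    rcases Nat.lt_or_gt_of_ne hne with h | h
    · exact lt_irrefl y (List.pairwise_iff_getElem.1 h3.2 k l hk hl h y hy y hy')
    · exact lt_irrefl y (List.pairwise_iff_getElem.1 h3.2 l k hl hk h y hy' y hy)
  · rw [h2, List.length_singleton] at hk hl
    omega

/-- The point `y` lies in all balls on the path `s` below `B`. -/
def PathTo (B : MetricBall X) (s : Stream' ℕ) (y : X) : Prop := ∀ n, y ∈ (descend B (s.take n)).1

theorem pathTo_cons (hX : OrderSeparatesBalls X) {k : ℕ} {s : Stream' ℕ} {y : X} :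
    PathTo B (k ::ₛ s) y ↔ PathTo (kid B k) s y :=
  ⟨fun h n => h (n + 1), fun h n => by
    rcases n with _ | n
    · exact kid_subset hX B k (h 0)
    · exact h n⟩

theorem pathTo_append (hX : OrderSeparatesBalls X) {τ : List ℕ} {s : Stream' ℕ} {y : X} :
    PathTo B (τ ++ₛ s) y ↔ PathTo (descend B τ) s y := by
  induction τ generalizing B with
  | nil => rfl
  | cons k τ ih => rw [Stream'.cons_append_stream, pathTo_cons hX, ih, descend]

theorem get_lt_kids (hX : OrderSeparatesBalls X) (hS : S.IsSmall) {s : Stream' ℕ}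
    (hs : S.presentation.IsEnd (S.cls B) s) (n : ℕ) :
    s.get n < (kids (descend B (s.take n))).length := by
  have := hs (n + 1)
  rw [Stream'.take_succ', addr_append, ← cls_descend hX hS] at this
  have := this.2.1
  rwa [children_cls hX hS, List.length_map] at this

/-- Every point of a ball lies in all balls on some path, given by an end of the class of the ball. -/
theorem exists_pathTo (hX : OrderSeparatesBalls X) (hS : S.IsSmall) {y : X} (hy : y ∈ B.1) :
    ∃ s, S.presentation.IsEnd (S.cls B) s ∧ PathTo B s y := by
  choose! f hf hf' using fun (C : MetricBall X) (h : y ∈ C.1) => exists_mem_kid hX h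
  let T : ℕ → List ℕ := fun n => Nat.rec [] (fun _ τ => τ ++ [f (descend B τ)]) n
  let s : Stream' ℕ := fun n => f (descend B (T n))
  have hT : ∀ n, s.take n = T n := by
    intro n
    induction n with
    | zero => rfl
    | succ n ih => rw [Stream'.take_succ', ih]; rfl
  have hmem : PathTo B s y := by
    intro n
    induction n with
    | zero => exact hy
    | succ n ih =>
      rw [descend_take_succ]
      rw [hT] at ih ⊢
      exact hf' _ ih
  refine ⟨s, fun n => ?_, hmem⟩
  induction n with
  | zero => trivial
  | succ n ih =>
    rw [Stream'.take_succ', addr_append]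
    refine ⟨ih, ?_, trivial⟩
    rw [← cls_descend hX hS, children_cls hX hS, List.length_map]
    have := hf _ (hmem n)
    rw [hT] at this ⊢
    exact this

theorem PathTo.unique_path (hX : OrderSeparatesBalls X) (hS : S.IsSmall) {s t : Stream' ℕ} {y : X}
    (hs : S.presentation.IsEnd (S.cls B) s) (ht : S.presentation.IsEnd (S.cls B) t)
    (h : PathTo B s y) (h' : PathTo B t y) : s = t := by
  refine Stream'.take_theorem _ _ fun n => ?_
  induction n with
  | zero => rfl
  | succ n ih =>
    have h1 := h (n + 1)
    have h2 := h' (n + 1)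
    have h3 := get_lt_kids hX hS hs n
    have h4 := get_lt_kids hX hS ht n
    rw [descend_take_succ] at h1 h2
    rw [← ih] at h2 h4
    rw [Stream'.take_succ', Stream'.take_succ', ← ih, kid_unique hX h3 h4 h1 h2]

/-- By compactness the balls on a path have a common point. -/
theorem exists_point (hX : OrderSeparatesBalls X) (B : MetricBall X) (s : Stream' ℕ) :
    ∃ y, PathTo B s y := by
  obtain ⟨y, hy⟩ := IsCompact.nonempty_iInter_of_sequence_nonempty_isCompact_isClosed
    (fun n => (descend B (s.take n)).1) (fun n => by
      rw [descend_take_succ]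
      exact kid_subset hX _ _) (fun n => MetricBall.nonempty _) (MetricBall.isClosed _).isCompact
    (fun n => MetricBall.isClosed _)
  exact ⟨y, Set.mem_iInter.1 hy⟩

/-- If all balls on a path contain a given ball, then two successive ones are equal, so the path has reached a
point. -/
theorem exists_subsingleton_descend (hX : OrderSeparatesBalls X) (hS : S.IsSmall) {s : Stream' ℕ}
    (hs : S.presentation.IsEnd (S.cls B) s) (D : MetricBall X)
    (hD : ∀ n, D.1 ⊆ (descend B (s.take n)).1) : ∃ n, (descend B (s.take n)).1.Subsingleton := by
  obtain ⟨n, hn⟩ := D.exists_eq_succ (fun n => descend B (s.take n)) (fun n => by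
    rw [descend_take_succ]
    exact kid_subset hX _ _) hD
  refine ⟨n, Set.not_nontrivial_iff.1 fun h => ?_⟩
  have h1 := (isMaxSub_kid hX h (get_lt_kids hX hS hs n)).prop
  rw [← descend_take_succ, hn] at h1
  exact h1.2 subset_rfl

/-- The balls on a path have only one common point. -/
theorem PathTo.unique_point (hX : OrderSeparatesBalls X) (hS : S.IsSmall) {s : Stream' ℕ} {y z : X}
    (hs : S.presentation.IsEnd (S.cls B) s) (h : PathTo B s y) (h' : PathTo B s z) : y = z := by
  by_contra hne
  obtain ⟨D, h1, h2⟩ := exists_separating hne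
  obtain ⟨n, hn⟩ := exists_subsingleton_descend hX hS hs D fun n =>
    (D.nested _ h1 (h n)).resolve_right fun h3 => h2 (h3 (h' n))
  exact hne (hn (h n) (h' n))

/-- Every subball is reached by a path. -/
theorem exists_descend_eq (hX : OrderSeparatesBalls X) (hS : S.IsSmall) {C : MetricBall X}
    (hC : C.1 ⊆ B.1) : ∃ τ, S.presentation.Addr (S.cls B) τ ∧ descend B τ = C := by
  obtain ⟨y, hy⟩ := C.nonempty
  obtain ⟨s, hs, hsy⟩ := exists_pathTo hX hS (hC hy)
  suffices ∃ n, descend B (s.take n) = C by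
    obtain ⟨n, hn⟩ := this
    exact ⟨_, hs n, hn⟩
  by_contra hne
  push Not at hne
  have hsub : ∀ n, C.1 ⊆ (descend B (s.take n)).1 := by
    intro n
    induction n with
    | zero => exact hC
    | succ n ih =>
      have hss : C.1 ⊂ (descend B (s.take n)).1 :=
        ih.ssubset_of_ne fun h => hne n (Subtype.ext h.symm)
      obtain ⟨z, hz, hzC⟩ := Set.exists_of_ssubset hss
      obtain ⟨C₁, h1, h2⟩ := exists_maxSub_ge hss
      have h3 := isMaxSub_kid hX h1.nontrivial (get_lt_kids hX hS hs n)
      have h4 := hsy (n + 1)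
      rw [descend_take_succ] at h4 ⊢
      rw [← h1.eq_of_mem h3 (h2 hy) h4]
      exact h2
  obtain ⟨n, hn⟩ := exists_subsingleton_descend hX hS hs C hsub
  refine hne n (Subtype.ext (Set.Subset.antisymm (fun z hz => ?_) (hsub n)))
  rw [hn hz (hsy n)]
  exact hy

/-- Similarities respect paths. -/
theorem exists_restricts_descend (hX : OrderSeparatesBalls X) (hS : S.IsSmall) (τ : List ℕ)
    {B B' : MetricBall X} {g : B.1 ≃ B'.1} (hg : g ∈ S.Sim B B') :
    ∃ g' ∈ S.Sim (descend B τ) (descend B' τ), Restricts g g' := by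
  induction τ generalizing B B' with
  | nil => exact ⟨g, hg, fun _ _ _ => rfl⟩
  | cons k τ ih =>
    have h := forall₂_kids hX hS hg
    obtain ⟨g₁, hg₁, h₁⟩ : ∃ g' ∈ S.Sim (kid B k) (kid B' k), Restricts g g' := by
      by_cases hk : k < (kids B).length
      · have hk' : k < (kids B').length := h.length_eq ▸ hk
        have := h.get hk hk'
        have e1 : kid B k = (kids B)[k] := by simp [kid, hk]
        have e2 : kid B' k = (kids B')[k] := by simp [kid, hk']
        rw [e1, e2]
        exact this
      · have hk' : ¬ k < (kids B').length := h.length_eq ▸ hk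
        have e1 : kid B k = B := by simp [kid, hk]
        have e2 : kid B' k = B' := by simp [kid, hk']
        rw [e1, e2]
        exact ⟨g, hg, fun _ _ _ => rfl⟩
    obtain ⟨g₂, hg₂, h₂⟩ := ih hg₁
    refine ⟨g₂, hg₂, fun y hy hy' => ?_⟩
    have hy₁ : y ∈ (kid B k).1 := descend_subset hX (kid B k) τ hy
    exact (h₂ y hy hy₁).trans (h₁ y hy₁ hy')

theorem PathTo.map (hX : OrderSeparatesBalls X) (hS : S.IsSmall) {B B' : MetricBall X}
    {g : B.1 ≃ B'.1} (hg : g ∈ S.Sim B B') {s : Stream' ℕ} {y : X} (h : PathTo B s y)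
    (hy : y ∈ B.1) : PathTo B' s (g ⟨y, hy⟩) := by
  intro n
  obtain ⟨g', -, h'⟩ := exists_restricts_descend hX hS (s.take n) hg
  rw [← h' y (h n) hy]
  exact (g' _).2

variable [Nonempty X]

/-- The points of the space are the ends of the tree of classes of balls. -/
theorem exists_equiv (hX : OrderSeparatesBalls X) (hS : S.IsSmall) :
    ∃ e : S.presentation.Ends (S.cls (MetricBall.whole X)) ≃ X,
      ∀ s, PathTo (MetricBall.whole X) s.1 (e s) := by
  choose f hf using fun s : S.presentation.Ends (S.cls (MetricBall.whole X)) =>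
    exists_point hX (MetricBall.whole X) s.1
  refine ⟨Equiv.ofBijective f ⟨fun s t hst => ?_, fun y => ?_⟩, hf⟩
  · exact Subtype.ext ((hf s).unique_path hX hS s.2 t.2 (hst ▸ hf t))
  · obtain ⟨s, hs, hsy⟩ := exists_pathTo (B := MetricBall.whole X) hX hS (Set.mem_univ y)
    exact ⟨⟨s, hs⟩, (hf ⟨s, hs⟩).unique_point hX hS hs hsy⟩

/-- The group of a small similarity structure is coded by the tree of classes of balls: paths to the same
class lead to balls with a similarity between them, and a similarity respects paths. -/
theorem exists_coding (hX : OrderSeparatesBalls X) (hS : S.IsSmall) :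
    ∃ e : S.presentation.Ends (S.cls (MetricBall.whole X)) ≃ X, S.Coding e := by
  obtain ⟨e, he⟩ := exists_equiv hX hS
  have key : ∀ τ ρ, S.presentation.Addr (S.cls (MetricBall.whole X)) τ →
      S.presentation.Addr (S.cls (MetricBall.whole X)) ρ →
      ∀ g ∈ S.Sim (descend (MetricBall.whole X) τ) (descend (MetricBall.whole X) ρ),
        Represents e g τ ρ := by
    intro τ ρ hτ hρ g hg
    refine ⟨hτ, hρ, ?_, fun s => ⟨fun hs => ?_, fun hs => ?_⟩, fun s t r hs ht hsB => ?_⟩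
    · rw [← cls_descend hX hS, ← cls_descend hX hS]
      exact (cls_eq_iff.2 ⟨g, hg⟩).symm
    · obtain ⟨t, ht, hty⟩ := exists_pathTo hX hS hs
      rw [cls_descend hX hS] at ht
      rw [(he s).unique_path hX hS s.2 (isEnd_append.2 ⟨hτ, ht⟩) ((pathTo_append hX).2 hty)]
      exact startsWith_append _ _
    · have := he s τ.length
      rwa [show s.1.take τ.length = τ from hs] at this
    · have h1 := he s
      rw [hs, pathTo_append hX] at h1
      have h2 := (pathTo_append hX).2 (h1.map hX hS hg hsB)
      have h3 := he t
      refine PathTo.unique_point hX hS t.2 ?_ h3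
      rwa [ht]
  refine ⟨e, fun τ ρ hτ hρ h => ?_, fun B B' g hg => ?_⟩
  · rw [← cls_descend hX hS, ← cls_descend hX hS] at h
    obtain ⟨g, hg⟩ := cls_eq_iff.1 h.symm
    exact ⟨_, _, g, hg, key τ ρ hτ hρ g hg⟩
  · obtain ⟨τ, hτ, rfl⟩ := exists_descend_eq hX hS (B := MetricBall.whole X) (Set.subset_univ B.1)
    obtain ⟨ρ, hρ, rfl⟩ := exists_descend_eq hX hS (B := MetricBall.whole X) (Set.subset_univ B'.1)
    exact ⟨τ, ρ, key τ ρ hτ hρ g hg⟩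

end FiniteSimilarityStructure

theorem mainTheorem4 :
    (∀ (X : Type*) [MetricSpace X] [IsUltrametricDist X] [CompactSpace X] [Nonempty X]
      [LinearOrder X] (S : FiniteSimilarityStructure X),
      OrderSeparatesBalls X → S.IsSmall →
      S.presentation.IsTreeLike ∧
        Nonempty (S.group ≃* BraidedDiagramGroup S.presentation [S.cls (MetricBall.whole X)])) ∧
    (∀ (α : Type*) (P : SemigroupPresentation α) (x : α), P.IsTreeLike →
      ∃ (X : Type) (_ : MetricSpace X) (_ : IsUltrametricDist X) (_ : CompactSpace X)
        (_ : Nonempty X) (_ : LinearOrder X) (S : FiniteSimilarityStructure X),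
        OrderSeparatesBalls X ∧ S.IsSmall ∧
          Nonempty (BraidedDiagramGroup P [x] ≃* S.group)) := by
  constructor
  · intro X _ _ _ _ _ S hX hS
    obtain ⟨e, he⟩ := FiniteSimilarityStructure.exists_coding hX hS
    have hP := FiniteSimilarityStructure.isTreeLike_presentation hS
    exact ⟨hP, he.nonempty_mulEquiv hP⟩
  · intro α P x hP
    obtain ⟨e⟩ := (coding_endSimilarities hP x).nonempty_mulEquiv hP
    exact ⟨P.Ends x, inferInstance, inferInstance, inferInstance, inferInstance, inferInstance,
      endSimilarities hP x, orderSeparatesBalls_ends, isSmall_endSimilarities hP x, ⟨e.symm⟩⟩
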